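/- **Setting.** Let $k$ be a field of characteristic $0$ (e.g. $k=\mathbb C$), let $\mathcal A=\prod_{i\ge 0}\mathcal A_i$ be a commutative complete graded $k$-algebra with a derivation $D$ such that $\mathcal A_i\mathcal A_j\subset\mathcal A_{i+j}$ and $D(\mathcal A_i)\subset\mathcal A_{i+1}$. Put $\mathcal F=\mathcal A/(D(\mathcal A)\oplus k)$ and write $\int f\,dx$ for the class of $f$. Formal operators $\sum_{i\in\mathbb Z}f_iD^i$, $f_i\in\mathcal A$, are multiplied by $fD^i\cdot gD^j=\sum_{r\ge0}\binom ir f\,D^r(g)\,D^{i+j-r}$ whenever the resulting sums are finite in each degree. Let $\mathcal D^-=\bigcup_N\mathcal D^-_{(N)}$, where $\mathcal D^-_{(N)}$ consists of the operators of order $\le N$, and $\mathcal D^+=\bigcup_m\mathcal D^+_{(m)}$, where $\mathcal D^+_{(m)}$ consists of the operators all of whose homogeneous components have degree $\ge m$ ($aD^i$ with $a\in\mathcal A_j$ having degree $i+j$). Let $X_+=\sum_{i\ge0}f_iD^i$, $X_-=\sum_{i<0}f_iD^i$, $\operatorname{res}X=f_{-1}$ for $X=\sum_i f_iD^i$. On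 $\mathfrak D=\mathcal D^-\times\mathcal D^+$, with componentwise product, put $\langle (X,\hat X),(Y,\hat Y)\rangle=\int\operatorname{res}(XY)\,dx+\int\operatorname{res}(\hat X\hat Y)\,dx\in\mathcal F$. **(1)** The map $R(X,\hat X)=(X_+-X_-+2\hat X_-,\ \hat X_--\hat X_++2X_+)$ maps $\mathfrak D$ to itself and has the adjoint $R^*(X,\hat X)=(X_--X_++2\hat X_-,\ \hat X_+-\hat X_-+2X_+)$ with respect to $\langle\,,\rangle$. Both $T=R$ and $T=R_a=\frac12(R-R^*)$ satisfy the modified Yang–Baxter equation $[T\mathbf X,T\mathbf Y]-T([T\mathbf X,\mathbf Y]+[\mathbf X,T\mathbf Y])=-[\mathbf X,\mathbf Y]$ for all $\mathbf X,\mathbf Y\in\mathfrak D$. **(2)** For $\mathbf A=(A,\hat A)\in\mathfrak D$ and $(X,\hat X)\in\mathfrak D$ put $$\mathcal P_{(A,\hat A)}(X,\hat X)=\big(A(XA)_--(AX)_-A-A(\hat A\hat X)_-+(\hat X\hat A)_-A,\ \ \hat A(\hat X\hat A)_+-(\hat A\hat X)_+\hat A-\hat A(AX)_++(XA)_+\hat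 A\big).$$ Then $\mathcal P_{\mathbf A}$ maps $\mathfrak D$ to $\mathfrak D$, is skew for $\langle\,,\rangle$, and is the tensor of the quadratic $R$-matrix bracket: for all $\mathbf A,\mathbf X,\mathbf Y\in\mathfrak D$, $$\tfrac14\big(\langle[\mathbf A,\mathbf X],R(\mathbf A\mathbf Y+\mathbf Y\mathbf A)\rangle-\langle[\mathbf A,\mathbf Y],R(\mathbf A\mathbf X+\mathbf X\mathbf A)\rangle\big)=\langle\mathbf X,\mathcal P_{\mathbf A}(\mathbf Y)\rangle .$$ Moreover, for all integers $N,m$ and $\mathbf A\in\mathfrak D_{N,m}=\mathcal D^-_{(N)}\times\mathcal D^+_{(m)}$, $\mathcal P_{\mathbf A}$ takes values in $\mathfrak D_{N,m}$ and $\mathcal P_{\mathbf A}(\mathbf X)$ does not change if an element of $\mathcal D^-_{(-N-2)}\times 0$ is added to $\mathbf X$. **(3)** Let $N,m$ be any integers, so that $\mathfrak D$ is the union of the $\mathfrak D_{N,m}$. Use as coordinates on $\mathfrak D_{N,m}$ the coefficients of the general element $\mathbf A=(\sum_{i\le N}w_iD^i,\ \sum_{i\in\mathbb Z}\hat w_iD^i)$,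 where $w_i$ has degree $0$ and $\hat w_i$ has degree $\max\{0,m-i\}$; the $s$-th derivative adds $s$ to the degree. Let now $\mathcal A$ be the completed graded algebra of differential functions of these variables: products over all degrees of homogeneous polynomials in the jet variables $w_i^{(s)},\hat w_i^{(s)}$ of positive degree, with coefficients in an algebra $\mathcal O$ of functions of the jet variables of degree $0$ (a commutative $k$-algebra that contains these coordinates, with commuting partial derivatives, each element having only finitely many non-zero partial derivatives; e.g. polynomials, or smooth functions each depending on finitely many coordinates), and let $D$ be the total derivative. Then $\mathbf A\in\mathfrak D_{N,m}$ over this $\mathcal A$. For $F=\int f\,dx\in\mathcal F$ let $$\frac{\delta F}{\delta\mathbf A}=\Big(\sum_{i\le N}D^{-i-1}\frac{\delta F}{\delta w_i},\ \sum_{i\in\mathbb Z}D^{-i-1}\frac{\delta F}{\delta\hat w_i}\Big),\qquad \frac{\delta F}{\delta u}=\sum_{s\ge0}(-D)^s\frac{\partial f}{\partial u^{(s)}}$$ (this depends only on $F$, not on $f$), and let $\mathcal F_0$ be the set of $F\in\mathcal F$ with $\delta F/\delta\mathbf A\in\mathfrak D$. Then $\mathcal F_0$ is a linear subspace of $\mathcal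 F$, and $$\{F,G\}(\mathbf A)=\Big\langle\frac{\delta F}{\delta\mathbf A},\ \mathcal P_{\mathbf A}\Big(\frac{\delta G}{\delta\mathbf A}\Big)\Big\rangle ,$$ which is the quadratic $R$-matrix bracket of the gradients, is a Poisson bracket on $\mathcal F_0$: it takes $\mathcal F_0\times\mathcal F_0$ to $\mathcal F_0$, is bilinear and skew-symmetric, and satisfies the Jacobi identity. -/

import Mathlib

namespace TwoBKP

noncomputable section

/-! ### Graded differential algebras and their degree-wise completion -/

section GradedDifferentialAlgebra

variable {k : Type*} [Field k] {B : Type*} [CommRing B] [Algebra k B]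

/-- A derivation of `B` that raises the degree by one with respect to the pieces `𝒢 0, 𝒢 1, …`. -/
class GradedDerivation (𝒢 : ℕ → Submodule k B) where
  der : Derivation k B B
  der_mem : ∀ n, ∀ b ∈ 𝒢 n, der b ∈ 𝒢 (n + 1)

variable (𝒢 : ℕ → Submodule k B) [SetLike.GradedMonoid 𝒢]

/-- The complete graded algebra `𝒜 = ∏_{n ≥ 0} 𝒢 n`: sequences `(a₀, a₁, …)` with `aₙ ∈ 𝒢 n`,
multiplied by the Cauchy product (i.e. as power series in an auxiliary variable). -/
def Coeffs : Subalgebra k (PowerSeries B) where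
  carrier := {a | ∀ n, PowerSeries.coeff n a ∈ 𝒢 n}
  mul_mem' := by
    intro a b ha hb n
    rw [PowerSeries.coeff_mul]
    refine Submodule.sum_mem _ fun p hp => ?_
    rw [← Finset.HasAntidiagonal.mem_antidiagonal.mp hp]
    exact SetLike.GradedMul.mul_mem (ha _) (hb _)
  add_mem' := by
    intro a b ha hb n
    rw [map_add]
    exact Submodule.add_mem _ (ha n) (hb n)
  algebraMap_mem' := by
    intro r n
    have h : PowerSeries.coeff n (algebraMap k (PowerSeries B) r)
        = r • PowerSeries.coeff n (1 : PowerSeries B) := by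
      rw [Algebra.algebraMap_eq_smul_one]; rfl
    rw [h, PowerSeries.coeff_one]
    split_ifs with hn
    · subst hn
      exact Submodule.smul_mem _ _ SetLike.GradedOne.one_mem
    · simp

variable {𝒢}

/-- The homogeneous component of degree `n`. -/
def Coeffs.comp (n : ℕ) (a : Coeffs 𝒢) : B := PowerSeries.coeff n (a : PowerSeries B)

/-- The element with prescribed homogeneous components. -/
def Coeffs.ofComp (a : ℕ → B) (ha : ∀ n, a n ∈ 𝒢 n) : Coeffs 𝒢 :=
  ⟨PowerSeries.mk a, fun n => by rw [PowerSeries.coeff_mk]; exact ha n⟩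

/-- The homogeneous element `b ∈ 𝒢 n`, as an element of the completion. -/
def Coeffs.ofHomogeneous (n : ℕ) (b : B) (hb : b ∈ 𝒢 n) : Coeffs 𝒢 :=
  Coeffs.ofComp (fun m => if m = n then b else 0) fun m => by
    by_cases h : m = n
    · subst h; simpa using hb
    · simp [h]

/-- The sum of a family that is finite in every degree. -/
def Coeffs.sum {ι : Type*} (f : ι → Coeffs 𝒢) : Coeffs 𝒢 :=
  Coeffs.ofComp (fun n => ∑ᶠ i, Coeffs.comp n (f i)) fun n =>
    finsum_induction (fun b => b ∈ 𝒢 n) (Submodule.zero_mem _)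
      (fun _ _ => Submodule.add_mem _) (fun i => (f i).2 n)

/-- The derivation `D` on the completion. -/
def Coeffs.D [GradedDerivation 𝒢] : Coeffs 𝒢 →ₗ[k] Coeffs 𝒢 where
  toFun a := Coeffs.ofComp
    (fun n => Nat.casesOn n 0 fun j => GradedDerivation.der 𝒢 (Coeffs.comp j a)) fun n => by
      cases n with
      | zero => exact Submodule.zero_mem _
      | succ j => exact GradedDerivation.der_mem j _ (a.2 j)
  map_add' a b := by
    refine Subtype.ext (PowerSeries.ext fun n => ?_)
    cases n <;> simp [Coeffs.ofComp, Coeffs.comp]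
  map_smul' r a := by
    refine Subtype.ext (PowerSeries.ext fun n => ?_)
    cases n <;> simp [Coeffs.ofComp, Coeffs.comp]

variable (𝒢) in
/-- Local functionals: the quotient of `𝒜` by `D(𝒜) ⊕ k`. -/
def LocalFunctional [GradedDerivation 𝒢] : Type _ :=
  Coeffs 𝒢 ⧸ (LinearMap.range (Coeffs.D (𝒢 := 𝒢)) ⊔ Submodule.span k {(1 : Coeffs 𝒢)})

instance [GradedDerivation 𝒢] : AddCommGroup (LocalFunctional 𝒢) :=
  inferInstanceAs (AddCommGroup
    (Coeffs 𝒢 ⧸ (LinearMap.range (Coeffs.D (𝒢 := 𝒢)) ⊔ Submodule.span k {(1 : Coeffs 𝒢)})))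

instance [GradedDerivation 𝒢] : Module k (LocalFunctional 𝒢) :=
  inferInstanceAs (Module k
    (Coeffs 𝒢 ⧸ (LinearMap.range (Coeffs.D (𝒢 := 𝒢)) ⊔ Submodule.span k {(1 : Coeffs 𝒢)})))

/-- The local functional `∫ f dx`. -/
def functional [GradedDerivation 𝒢] (f : Coeffs 𝒢) : LocalFunctional 𝒢 :=
  Submodule.Quotient.mk (p := LinearMap.range (Coeffs.D (𝒢 := 𝒢)) ⊔
    Submodule.span k {(1 : Coeffs 𝒢)}) f

/-! ### Pseudo-differential operators -/

variable (𝒢) in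
/-- The linear space of all formal sums `∑_{i ∈ ℤ} fᵢ Dⁱ`, `fᵢ ∈ 𝒜`; `P i` is the coefficient
of `Dⁱ`. -/
abbrev Op : Type _ := ℤ → Coeffs 𝒢

/-- The operator `a Dⁱ`. -/
def opMonomial (i : ℤ) (a : Coeffs 𝒢) : Op 𝒢 := Pi.single i a

/-- The sum of a family of operators that is finite in every coefficient and degree. -/
def opSum {ι : Type*} (P : ι → Op 𝒢) : Op 𝒢 := fun n => Coeffs.sum fun i => P i n

/-- The product of operators, i.e. the extension to series of
`f Dⁱ · g Dʲ = ∑_{r ≥ 0} binom(i, r) f Dʳ(g) D^{i + j - r}`: the coefficient of `Dⁿ` is the sum of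
`binom(i, r) f_i Dʳ(g_j)` over all `i, j, r` with `i + j - r = n`. The sum is finite in every
degree when both factors are of the first type and when both are of the second type. -/
def opMul [GradedDerivation 𝒢] (P Q : Op 𝒢) : Op 𝒢 := fun n =>
  Coeffs.sum fun p : ℤ × ℕ =>
    Ring.choose p.1 p.2 • (P p.1 * (Coeffs.D^[p.2]) (Q (n + p.2 - p.1)))

infixl:70 " ⊛ " => opMul

/-- The positive part `∑_{i ≥ 0} fᵢ Dⁱ`. -/
def pos (P : Op 𝒢) : Op 𝒢 := fun i => if 0 ≤ i then P i else 0

/-- The negative part `∑_{i < 0} fᵢ Dⁱ`. -/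
def neg (P : Op 𝒢) : Op 𝒢 := fun i => if i < 0 then P i else 0

/-- The residue. -/
def res (P : Op 𝒢) : Coeffs 𝒢 := P (-1)

variable (𝒢) in
/-- Operators of the first type of order at most `d`. -/
def opMinusLE (d : ℤ) : Submodule k (Op 𝒢) where
  carrier := {P | ∀ i, d < i → P i = 0}
  zero_mem' := fun _ _ => rfl
  add_mem' := by
    intro P Q hP hQ i hi
    simp [hP i hi, hQ i hi]
  smul_mem' := by
    intro c P hP i hi
    simp [hP i hi]

variable (𝒢) in
/-- `𝒟⁻`: operators of the first type. -/
def opMinus : Submodule k (Op 𝒢) where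
  carrier := {P | ∃ d, P ∈ opMinusLE 𝒢 d}
  zero_mem' := ⟨0, Submodule.zero_mem _⟩
  add_mem' := by
    rintro P Q ⟨d, hP⟩ ⟨e, hQ⟩
    exact ⟨max d e, Submodule.add_mem _
      (fun i hi => hP i (lt_of_le_of_lt (le_max_left _ _) hi))
      (fun i hi => hQ i (lt_of_le_of_lt (le_max_right _ _) hi))⟩
  smul_mem' := by
    rintro c P ⟨d, hP⟩
    exact ⟨d, Submodule.smul_mem _ c hP⟩

variable (𝒢) in
/-- Operators of the second type all of whose homogeneous components have degree at least `d`,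
where `a Dⁱ` with `a ∈ 𝒢 n` is homogeneous of degree `i + n`. -/
def opPlusGE (d : ℤ) : Submodule k (Op 𝒢) where
  carrier := {P | ∀ (i : ℤ) (n : ℕ), i + n < d → Coeffs.comp n (P i) = 0}
  zero_mem' := fun i n _ => by simp [Coeffs.comp]
  add_mem' := by
    intro P Q hP hQ i n h
    have h1 := hP i n h
    have h2 := hQ i n h
    simp only [Coeffs.comp] at h1 h2 ⊢
    simp [h1, h2]
  smul_mem' := by
    intro c P hP i n h
    have h1 := hP i n h
    simp only [Coeffs.comp] at h1 ⊢
    simp [h1]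

variable (𝒢) in
/-- `𝒟⁺`: operators of the second type. -/
def opPlus : Submodule k (Op 𝒢) where
  carrier := {P | ∃ d, P ∈ opPlusGE 𝒢 d}
  zero_mem' := ⟨0, Submodule.zero_mem _⟩
  add_mem' := by
    rintro P Q ⟨d, hP⟩ ⟨e, hQ⟩
    exact ⟨min d e, Submodule.add_mem _
      (fun i n hi => hP i n (lt_of_lt_of_le hi (min_le_left _ _)))
      (fun i n hi => hQ i n (lt_of_lt_of_le hi (min_le_right _ _)))⟩
  smul_mem' := by
    rintro c P ⟨d, hP⟩
    exact ⟨d, Submodule.smul_mem _ c hP⟩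

/-! ### The algebra `𝔇 = 𝒟⁻ × 𝒟⁺`, the `R`-matrix and the quadratic bracket -/

variable (𝒢) in
/-- `𝔇 = 𝒟⁻ × 𝒟⁺`. -/
def frakD : Submodule k (Op 𝒢 × Op 𝒢) := (opMinus 𝒢).prod (opPlus 𝒢)

variable (𝒢) in
/-- The part of `𝔇` consisting of pairs of order at most `N` and of degree at least `m`; `𝔇` is
the union of these subspaces. -/
def frakDPart (N m : ℤ) : Submodule k (Op 𝒢 × Op 𝒢) := (opMinusLE 𝒢 N).prod (opPlusGE 𝒢 m)

/-- The transformation `R(X, X̂) = (X₊ - X₋ + 2 X̂₋, X̂₋ - X̂₊ + 2 X₊)`. -/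
def Rmat (X : Op 𝒢 × Op 𝒢) : Op 𝒢 × Op 𝒢 :=
  (pos X.1 - neg X.1 + (2 : k) • neg X.2, neg X.2 - pos X.2 + (2 : k) • pos X.1)

/-- The transformation `R*(X, X̂) = (X₋ - X₊ + 2 X̂₋, X̂₊ - X̂₋ + 2 X₊)`. -/
def RmatAdj (X : Op 𝒢 × Op 𝒢) : Op 𝒢 × Op 𝒢 :=
  (neg X.1 - pos X.1 + (2 : k) • neg X.2, pos X.2 - neg X.2 + (2 : k) • pos X.1)

/-- The anti-symmetric part `R_a = (R - R*) / 2`. -/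
def RmatSkew (X : Op 𝒢 × Op 𝒢) : Op 𝒢 × Op 𝒢 := (2⁻¹ : k) • (Rmat X - RmatAdj X)

variable [GradedDerivation 𝒢]

/-- The product of pairs. -/
def pairMul (X Y : Op 𝒢 × Op 𝒢) : Op 𝒢 × Op 𝒢 := (X.1 ⊛ Y.1, X.2 ⊛ Y.2)

/-- The commutator of pairs. -/
def pairComm (X Y : Op 𝒢 × Op 𝒢) : Op 𝒢 × Op 𝒢 := pairMul X Y - pairMul Y X

/-- The inner product `⟨X, Y⟩ = ∫ res(X Y) dx` of operators. -/
def opInner (X Y : Op 𝒢) : LocalFunctional 𝒢 := functional (res (X ⊛ Y))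

/-- The inner product `⟨(X, X̂), (Y, Ŷ)⟩ = ⟨X, Y⟩ + ⟨X̂, Ŷ⟩` on pairs. -/
def pairInner (X Y : Op 𝒢 × Op 𝒢) : LocalFunctional 𝒢 :=
  opInner X.1 Y.1 + opInner X.2 Y.2

/-- The modified Yang-Baxter equation
`[T X, T Y] - T([T X, Y] + [X, T Y]) = -[X, Y]` on `𝔇`. -/
def SatisfiesMYBE (T : Op 𝒢 × Op 𝒢 → Op 𝒢 × Op 𝒢) : Prop :=
  ∀ X ∈ frakD 𝒢, ∀ Y ∈ frakD 𝒢,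
    pairComm (T X) (T Y) - T (pairComm (T X) Y + pairComm X (T Y)) = -pairComm X Y

/-- The quadratic `R`-matrix bracket at the point `A`, on two cotangent vectors `X`, `Y`:
`(⟨[A, X], R(A Y + Y A)⟩ - ⟨[A, Y], R(A X + X A)⟩) / 4`. -/
def quadBracket (A X Y : Op 𝒢 × Op 𝒢) : LocalFunctional 𝒢 :=
  (4⁻¹ : k) • (pairInner (pairComm A X) (Rmat (pairMul A Y + pairMul Y A))
    - pairInner (pairComm A Y) (Rmat (pairMul A X + pairMul X A)))

/-- The quadratic Poisson tensor: `P_{(A, Â)}(X, X̂)` is the pair of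
`A (X A)₋ - (A X)₋ A - A (Â X̂)₋ + (X̂ Â)₋ A` and
`Â (X̂ Â)₊ - (Â X̂)₊ Â - Â (A X)₊ + (X A)₊ Â`. -/
def poissonTensor (A X : Op 𝒢 × Op 𝒢) : Op 𝒢 × Op 𝒢 :=
  (A.1 ⊛ neg (X.1 ⊛ A.1) - neg (A.1 ⊛ X.1) ⊛ A.1
      - A.1 ⊛ neg (A.2 ⊛ X.2) + neg (X.2 ⊛ A.2) ⊛ A.1,
    A.2 ⊛ pos (X.2 ⊛ A.2) - pos (A.2 ⊛ X.2) ⊛ A.2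
      - A.2 ⊛ pos (A.1 ⊛ X.1) + pos (X.1 ⊛ A.1) ⊛ A.2)

end GradedDifferentialAlgebra

/-! ### Differential functions

`J` is a set of dependent variables, `w : J → ℕ` assigns a degree to each of them, and the `s`-th
`x`-derivative of the variable `j` is the jet variable `(j, s)`, of degree `w j + s`. The jet
variables of degree zero are coordinates on a manifold `M`; a differential function is a series
whose homogeneous parts are polynomials in the jet variables of positive degree, with functions on
`M` as coefficients. -/

/-- A `k`-algebra `O` of functions of the coordinates `u_i`, `i ∈ I` (for instance polynomials, or
smooth functions on an open set, each depending on finitely many coordinates): it contains the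
coordinates, it is stable under the commuting partial derivatives, and every element has only
finitely many non-zero partial derivatives. -/
class CoordinateAlgebra (k : Type*) [Field k] (I : Type*) (O : Type*) [CommRing O]
    [Algebra k O] where
  coord : I → O
  pd : I → Derivation k O O
  pd_coord_self : ∀ i, pd i (coord i) = 1
  pd_coord_of_ne : ∀ i j, i ≠ j → pd i (coord j) = 0
  pd_comm : ∀ i j f, pd i (pd j f) = pd j (pd i f)
  pd_finite : ∀ f, {i | pd i f ≠ 0}.Finite

section DifferentialFunctions

/-- The degree of a jet variable. -/
def jetDeg {J : Type*} (w : J → ℕ) (p : J × ℕ) : ℕ := w p.1 + p.2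

/-- Indices of the jet variables of degree zero. -/
abbrev JetZero {J : Type*} (w : J → ℕ) : Type _ := {p : J × ℕ // jetDeg w p = 0}

/-- Indices of the jet variables of positive degree. -/
abbrev JetPos {J : Type*} (w : J → ℕ) : Type _ := {p : J × ℕ // jetDeg w p ≠ 0}

/-- Polynomials in the jet variables of positive degree with coefficients in `O`. -/
abbrev DiffPoly {J : Type*} (w : J → ℕ) (O : Type*) [CommRing O] : Type _ :=
  MvPolynomial (JetPos w) O

variable (k : Type*) [Field k] {J : Type*} (w : J → ℕ) (O : Type*) [CommRing O] [Algebra k O]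

/-- Differential polynomials that are homogeneous of degree `n`. -/
def jetGrading (n : ℕ) : Submodule k (DiffPoly w O) :=
  (MvPolynomial.weightedHomogeneousSubmodule O (fun p : JetPos w => jetDeg w p.1) n).restrictScalars
    k

instance : SetLike.GradedMonoid (jetGrading k w O) where
  one_mem := MvPolynomial.isWeightedHomogeneous_one _ _
  mul_mem _ _ _ _ h1 h2 := MvPolynomial.IsWeightedHomogeneous.mul h1 h2

/-- A derivation of `O`, applied to the coefficients of a polynomial. -/
def coeffDerFun {σ : Type*} {O : Type*} [CommRing O] {k : Type*} [Field k] [Algebra k O]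
    (δ : Derivation k O O) (b : MvPolynomial σ O) : MvPolynomial σ O :=
  ∑ n ∈ b.support, MvPolynomial.monomial n (δ (b.coeff n))

theorem coeff_coeffDerFun {σ : Type*} {O : Type*} [CommRing O] {k : Type*} [Field k]
    [Algebra k O] (δ : Derivation k O O) (b : MvPolynomial σ O) (m : σ →₀ ℕ) :
    (coeffDerFun δ b).coeff m = δ (b.coeff m) := by
  classical
  rw [coeffDerFun, MvPolynomial.coeff_sum]
  simp only [MvPolynomial.coeff_monomial]
  rw [Finset.sum_ite_eq' b.support m]
  split_ifs with h
  · rfl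
  · rw [MvPolynomial.notMem_support_iff.mp h, map_zero]

/-- The derivation of a polynomial ring over `O` that acts on coefficients by a derivation of `O`
and kills the variables. -/
def coeffDer {σ : Type*} {O : Type*} [CommRing O] {k : Type*} [Field k] [Algebra k O]
    (δ : Derivation k O O) : Derivation k (MvPolynomial σ O) (MvPolynomial σ O) :=
  Derivation.mk'
    { toFun := coeffDerFun δ
      map_add' := fun a b => by
        ext m
        simp only [coeff_coeffDerFun, MvPolynomial.coeff_add, map_add]
      map_smul' := fun r b => by
        ext m
        simp [coeff_coeffDerFun] }
    (by
      classical
      intro a b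
      ext m
      simp only [LinearMap.coe_mk, AddHom.coe_mk, smul_eq_mul, MvPolynomial.coeff_add,
        coeff_coeffDerFun, MvPolynomial.coeff_mul, map_sum, Derivation.leibniz,
        Finset.sum_add_distrib]
      congr 1
      exact (Finsupp.sum_antidiagonal_swap m fun p q => b.coeff q * δ (a.coeff p)))


variable [CoordinateAlgebra k (JetZero w) O]

/-- The jet variable `p` as a differential polynomial. -/
def jet (p : J × ℕ) : DiffPoly w O :=
  if h : jetDeg w p = 0 then MvPolynomial.C (CoordinateAlgebra.coord k (⟨p, h⟩ : JetZero w))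
  else MvPolynomial.X (⟨p, h⟩ : JetPos w)

/-- The partial derivative with respect to the jet variable `p`. -/
def jetPd (p : J × ℕ) : Derivation k (DiffPoly w O) (DiffPoly w O) :=
  if h : jetDeg w p = 0 then coeffDer (CoordinateAlgebra.pd (⟨p, h⟩ : JetZero w))
  else (MvPolynomial.pderiv (⟨p, h⟩ : JetPos w)).restrictScalars k

theorem jet_mem (p : J × ℕ) : jet k w O p ∈ jetGrading k w O (jetDeg w p) := by
  unfold jet
  split_ifs with h
  · rw [h]; exact MvPolynomial.isWeightedHomogeneous_C _ _
  · exact MvPolynomial.isWeightedHomogeneous_X O (fun p : JetPos w => jetDeg w p.1) ⟨p, h⟩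

theorem jetPd_mem (p : J × ℕ) (n : ℕ) (b : DiffPoly w O)
    (hb : b ∈ jetGrading k w O (n + jetDeg w p)) :
    jetPd k w O p b ∈ jetGrading k w O n := by
  unfold jetPd
  split_ifs with h
  · rw [h] at hb
    intro m hm
    refine hb (d := m) fun h0 => hm ?_
    change (coeffDerFun _ b).coeff m = 0
    rw [coeff_coeffDerFun, h0, map_zero]
  · exact MvPolynomial.IsWeightedHomogeneous.pderiv (i := (⟨p, h⟩ : JetPos w)) hb rfl

theorem jetPd_eq_zero (p : J × ℕ) (n : ℕ) (b : DiffPoly w O) (hb : b ∈ jetGrading k w O n)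
    (hn : n < jetDeg w p) : jetPd k w O p b = 0 := by
  have h : ¬ jetDeg w p = 0 := by omega
  simp only [jetPd, h, dite_false]
  change MvPolynomial.pderiv _ b = 0
  refine MvPolynomial.pderiv_eq_zero_of_notMem_vars fun hv => ?_
  obtain ⟨d, hd, hpd⟩ := (MvPolynomial.mem_vars_iff_mem_support _).mp hv
  have hw := hb (MvPolynomial.mem_support_iff.mp hd)
  have := Finsupp.le_weight_of_ne_zero' (fun p : JetPos w => jetDeg w p.1) (s := ⟨p, h⟩)
    (Finsupp.mem_support_iff.mp hpd)
  change jetDeg w p ≤ _ at this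
  omega

theorem jetPd_finite (b : DiffPoly w O) : {p | jetPd k w O p b ≠ 0}.Finite := by
  classical
  refine Set.Finite.subset (s := (⋃ m ∈ (b.support : Set (JetPos w →₀ ℕ)),
    Subtype.val '' {i : JetZero w | CoordinateAlgebra.pd (k := k) i (b.coeff m) ≠ 0}) ∪
    Subtype.val '' (b.vars : Set (JetPos w))) ?_ ?_
  · refine Set.Finite.union (Set.Finite.biUnion (Finset.finite_toSet _) fun m _ => ?_)
      ((Finset.finite_toSet _).image _)
    exact (CoordinateAlgebra.pd_finite _).image _
  · intro p hp
    by_cases h : jetDeg w p = 0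
    · left
      by_contra hcon
      apply hp
      simp only [jetPd, h, dite_true]
      change coeffDerFun _ b = 0
      refine Finset.sum_eq_zero fun m hm => ?_
      have : CoordinateAlgebra.pd (k := k) (⟨p, h⟩ : JetZero w) (b.coeff m) = 0 := by
        by_contra h0
        exact hcon (Set.mem_biUnion hm ⟨⟨p, h⟩, h0, rfl⟩)
      rw [this, map_zero]
    · right
      refine ⟨⟨p, h⟩, ?_, rfl⟩
      by_contra hv
      apply hp
      simp only [jetPd, h, dite_false]
      exact MvPolynomial.pderiv_eq_zero_of_notMem_vars hv

/-- The total derivative `∑ (j, s), u_j^(s+1) ∂/∂u_j^(s)` on differential polynomials. -/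
def totalDer : Derivation k (DiffPoly w O) (DiffPoly w O) :=
  have fin : ∀ c : J × ℕ → DiffPoly w O, ∀ b : DiffPoly w O,
      Function.HasFiniteSupport fun p => c p * jetPd k w O p b := fun c b =>
    (jetPd_finite k w O b).subset fun p hp h => hp (by simp [h])
  Derivation.mk'
    { toFun := fun b => ∑ᶠ p : J × ℕ, jet k w O (p.1, p.2 + 1) * jetPd k w O p b
      map_add' := fun a b => by
        simp only [map_add, mul_add]
        exact finsum_add_distrib (fin _ a) (fin _ b)
      map_smul' := fun r b => by
        simp only [Derivation.map_smul, RingHom.id_apply]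
        rw [smul_finsum' r (fin _ b)]
        exact finsum_congr fun p => by rw [mul_smul_comm] }
    (by
      intro a b
      simp only [LinearMap.coe_mk, AddHom.coe_mk, Derivation.leibniz, smul_eq_mul]
      rw [mul_finsum' _ _ (fin _ b), mul_finsum' _ _ (fin _ a), ← finsum_add_distrib]
      · exact finsum_congr fun p => by ring
      · exact (jetPd_finite k w O b).subset fun p hp h => hp (by simp [h])
      · exact (jetPd_finite k w O a).subset fun p hp h => hp (by simp [h]))

instance : GradedDerivation (jetGrading k w O) where
  der := totalDer k w O
  der_mem n b hb := by
    change (∑ᶠ p : J × ℕ, jet k w O (p.1, p.2 + 1) * jetPd k w O p b) ∈ _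
    refine finsum_induction (fun b => b ∈ jetGrading k w O (n + 1)) (Submodule.zero_mem _)
      (fun _ _ => Submodule.add_mem _) fun p => ?_
    by_cases h : n < jetDeg w p
    · rw [jetPd_eq_zero k w O p n b hb h, mul_zero]; exact Submodule.zero_mem _
    · obtain ⟨e, rfl⟩ := Nat.exists_eq_add_of_le' (not_lt.mp h)
      have h1 := SetLike.GradedMul.mul_mem (jet_mem k w O (p.1, p.2 + 1))
        (jetPd_mem k w O p e b hb)
      have h2 : jetDeg w (p.1, p.2 + 1) + e = e + jetDeg w p + 1 := by
        simp only [jetDeg]; omega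
      rwa [h2] at h1

/-- The algebra of differential functions. -/
abbrev DiffFun : Type _ := Coeffs (jetGrading k w O)

/-- The jet variable `p` as a differential function. -/
def jetFun (p : J × ℕ) : DiffFun k w O :=
  Coeffs.ofHomogeneous (jetDeg w p) (jet k w O p) (jet_mem k w O p)

/-- The partial derivative of a differential function with respect to the jet variable `p`. -/
def partialFun (p : J × ℕ) (f : DiffFun k w O) : DiffFun k w O :=
  Coeffs.ofComp (fun n => jetPd k w O p (Coeffs.comp (n + jetDeg w p) f)) fun n =>
    jetPd_mem k w O p n _ (f.2 _)

/-- The variational derivative `δf/δu_j = ∑_{s ≥ 0} (-D)^s (∂f/∂u_j^(s))`. -/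
def varDer (j : J) (f : DiffFun k w O) : DiffFun k w O :=
  Coeffs.sum fun s : ℕ => (-1 : ℤ) ^ s • (Coeffs.D^[s]) (partialFun k w O (j, s) f)

end DifferentialFunctions

/-! ### Functionals on `𝔇`

A general element of `𝔇` of order at most `N` and of degree at least `m` is
`(∑_{i ≤ N} w_i Dⁱ, ∑_{i ∈ ℤ} ŵ_i Dⁱ)`, where `w_i` has degree (at least) `0` and `ŵ_i` has degree
at least `max {0, m - i}`. -/

section Functionals

/-- Labels of the coefficients `w_i`, `i ≤ N`, and `ŵ_i`, `i ∈ ℤ`. -/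
abbrev CoordIndex (N : ℤ) : Type := {i : ℤ // i ≤ N} ⊕ ℤ

/-- The degrees of the coefficients: `0` for `w_i` and `max {0, m - i}` for `ŵ_i`. -/
def coordDeg (N m : ℤ) : CoordIndex N → ℕ := Sum.elim (fun _ => 0) fun i => (m - i).toNat

variable (k : Type*) [Field k] (N m : ℤ) (O : Type*) [CommRing O] [Algebra k O]
  [CoordinateAlgebra k (JetZero (coordDeg N m)) O]

/-- The generic point `(∑_{i ≤ N} w_i Dⁱ, ∑_{i ∈ ℤ} ŵ_i Dⁱ)`. -/
def genericPoint :
    Op (jetGrading k (coordDeg N m) O) × Op (jetGrading k (coordDeg N m) O) :=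
  (fun i => if h : i ≤ N then jetFun k (coordDeg N m) O (Sum.inl ⟨i, h⟩, 0) else 0,
    fun i => jetFun k (coordDeg N m) O (Sum.inr i, 0))

/-- The variational gradient
`(∑_{i ≤ N} D^{-i-1} δF/δw_i, ∑_{i ∈ ℤ} D^{-i-1} δF/δŵ_i)` of `F = ∫ f dx` at the generic
point. -/
def varGrad (f : DiffFun k (coordDeg N m) O) :
    Op (jetGrading k (coordDeg N m) O) × Op (jetGrading k (coordDeg N m) O) :=
  (opSum fun i : {i : ℤ // i ≤ N} =>
      opMonomial (-i.1 - 1) 1 ⊛ opMonomial 0 (varDer k (coordDeg N m) O (Sum.inl i) f),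
    opSum fun i : ℤ =>
      opMonomial (-i - 1) 1 ⊛ opMonomial 0 (varDer k (coordDeg N m) O (Sum.inr i) f))

/-- `F₀`: the local functionals whose variational gradient lies in `𝔇`. -/
def functionalsWithGrad : Set (LocalFunctional (jetGrading k (coordDeg N m) O)) :=
  {F | ∃ f, functional f = F ∧ varGrad k N m O f ∈ frakD (jetGrading k (coordDeg N m) O)}

end Functionals

end

end TwoBKP

/-!
The proof works in a larger algebra than `𝔇`. An operator is called admissible of the first or of
the second type (`opAdm`) if modulo any degree its orders are bounded above or below, respectively.
Admissible operators of either type form an associative algebra (`opMul_assoc`) on which `∫ res` is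
a trace (`functional_res_comm`), and the variational gradient of every functional is admissible,
also when it is not in `𝔇` (`grad`). So the identities of the theorem can be proved for pairs of
admissible operators; membership in `𝔇` is a separate matter.

**The algebraic identities.** Write `R = Q + S` with `Q` skew and `S` symmetric for the trace form.
Since `X ↦ X₊` and `X ↦ X₋` project to complementary subalgebras, `Q` and `S` satisfy the three
identities of `QuadraticRMatrix` (`quadraticRMatrix`). They contain the modified Yang-Baxter
equations for `R` and for `Q = R_a`. Twice the tensor is `2 P_A(X) = a_X A - A b_X` with `a_X =
Q(AX) + S(XA)` and `b_X = S(AX) + Q(XA)` (`admTensor_add_self`), and the identities also say that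
`(a_X, b_X)` is the value at `(AX, -XA)` of a solution of the modified Yang-Baxter equation on the
double of the algebra. By `QuadraticRMatrix.cyclic_quadTensorDeriv` the Schouten bracket of `P`
with itself therefore vanishes: the cyclic sum of `⟨X, dP_A(P_A Y) Z⟩` is zero for constant
covectors.

**The bracket of functionals.** The gradient represents the first variation, `d/dt F(A + tξ) =
⟨δF/δA, ξ⟩` for tangent vectors `ξ` (`functional_evol_tangentChar`); this is integration by parts
together with an inversion formula for operators with coefficients on the right
(`dualCoeff_gradOp`). The second variation is symmetric because evolutionary vector fields are
closed under commutators (`pairTrace_pairDer_grad`). Differentiating the bracket along `ξ` gives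
two second variations and the derivative of the tensor (`pairTrace_grad_bracketDensity`). In the
Jacobi sum the second variations cancel by symmetry and the rest is the Schouten bracket
(`cyclic_bracketDensity`).

**Closure of `F₀`.** Transposing the formula for the differential of `{F, G}` gives an element of
`𝔇` that has the same pairing with all tangent vectors as the gradient of `{F, G}`. Differential
functions are separated by functionals (`eq_zero_of_functional_mul_eq_zero`), because there are
infinitely many variables of degree zero; so the variational derivatives of `{F, G}` are the dual
coefficients of that element, and the gradient of `{F, G}` lies in `𝔇` (`grad_mem_admFrakD`).
-/

namespace TwoBKP

noncomputable section

section

open Filter Finset.HasAntidiagonal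

/-! ### The degree filtration of the completed algebra -/

namespace Coeffs

variable {k : Type*} [Field k] {B : Type*} [CommRing B] [Algebra k B]
  {𝒢 : ℕ → Submodule k B} [SetLike.GradedMonoid 𝒢]

theorem ext_comp {a b : Coeffs 𝒢} (h : ∀ n, comp n a = comp n b) : a = b :=
  Subtype.ext (PowerSeries.ext h)

@[simp] theorem comp_zero (n : ℕ) : comp n (0 : Coeffs 𝒢) = 0 := by simp [comp]
@[simp] theorem comp_add (n : ℕ) (a b : Coeffs 𝒢) : comp n (a + b) = comp n a + comp n b := by
  simp [comp]
@[simp] theorem comp_sub (n : ℕ) (a b : Coeffs 𝒢) : comp n (a - b) = comp n a - comp n b := by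
  simp [comp]
@[simp] theorem comp_smul (n : ℕ) (c : k) (a : Coeffs 𝒢) : comp n (c • a) = c • comp n a := by
  simp [comp]

theorem comp_mul (n : ℕ) (a b : Coeffs 𝒢) :
    comp n (a * b) = ∑ p ∈ antidiagonal n, comp p.1 a * comp p.2 b := by
  simp [comp, PowerSeries.coeff_mul]

theorem comp_finsetSum {ι : Type*} (n : ℕ) (s : Finset ι) (f : ι → Coeffs 𝒢) :
    comp n (∑ i ∈ s, f i) = ∑ i ∈ s, comp n (f i) := by
  simp [comp]

@[simp] theorem comp_ofComp (n : ℕ) (a : ℕ → B) (ha : ∀ n, a n ∈ 𝒢 n) :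
    comp n (ofComp a ha) = a n := by
  simp [comp, ofComp]

@[simp] theorem comp_sum {ι : Type*} (n : ℕ) (f : ι → Coeffs 𝒢) :
    comp n (sum f) = ∑ᶠ i, comp n (f i) := by
  simp [sum]

theorem comp_one_succ (n : ℕ) : comp (n + 1) (1 : Coeffs 𝒢) = 0 := by
  simp [comp, PowerSeries.coeff_one]

theorem comp_one_zero : comp 0 (1 : Coeffs 𝒢) = 1 := by
  simp [comp]

section Derivation
variable [GradedDerivation 𝒢]

@[simp] theorem comp_D_zero (a : Coeffs 𝒢) : comp 0 (D a) = 0 := by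
  simp [D]

@[simp] theorem comp_D_succ (n : ℕ) (a : Coeffs 𝒢) :
    comp (n + 1) (D a) = GradedDerivation.der 𝒢 (comp n a) := by
  simp [D]

theorem D_mul (a b : Coeffs 𝒢) : D (a * b) = a * D b + D a * b := by
  refine ext_comp fun n => ?_
  cases n with
  | zero => simp [comp_mul]
  | succ n =>
    rw [comp_D_succ, comp_mul, comp_add, comp_mul, comp_mul, Finset.Nat.sum_antidiagonal_succ',
      Finset.Nat.sum_antidiagonal_succ (f := fun p => comp p.1 (D a) * comp p.2 b)]
    simp only [map_sum, Derivation.leibniz, comp_D_succ, comp_D_zero, mul_zero, zero_mul, zero_add,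
      Finset.sum_add_distrib, smul_eq_mul]
    congr 1
    exact Finset.sum_congr rfl fun p _ => mul_comm _ _

end Derivation

variable (𝒢) in
/-- The elements whose homogeneous components of degree less than `n` vanish. -/
def fil (n : ℕ) : Submodule k (Coeffs 𝒢) where
  carrier := {a | ∀ l < n, comp l a = 0}
  zero_mem' := fun l _ => by simp
  add_mem' := fun {a b} ha hb l hl => by simp [ha l hl, hb l hl]
  smul_mem' := fun c a ha l hl => by simp [ha l hl]

theorem fil_zero (a : Coeffs 𝒢) : a ∈ fil 𝒢 0 := fun _ h => absurd h (Nat.not_lt_zero _)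

theorem fil_anti {m n : ℕ} (h : m ≤ n) : fil 𝒢 n ≤ fil 𝒢 m := fun _ ha l hl =>
  ha l (hl.trans_le h)

theorem eq_zero_of_fil {a : Coeffs 𝒢} (h : ∀ n, a ∈ fil 𝒢 n) : a = 0 :=
  ext_comp fun n => by rw [h (n + 1) n n.lt_succ_self, comp_zero]

theorem fil_mul {m n : ℕ} {a b : Coeffs 𝒢} (ha : a ∈ fil 𝒢 m) (hb : b ∈ fil 𝒢 n) :
    a * b ∈ fil 𝒢 (m + n) := by
  intro l hl
  rw [comp_mul]
  refine Finset.sum_eq_zero fun p hp => ?_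
  rw [mem_antidiagonal] at hp
  rcases lt_or_ge p.1 m with h | h
  · rw [ha _ h, zero_mul]
  · rw [hb _ (by omega), mul_zero]

theorem fil_mul_left {n : ℕ} (a : Coeffs 𝒢) {b : Coeffs 𝒢} (hb : b ∈ fil 𝒢 n) :
    a * b ∈ fil 𝒢 n := by
  simpa using fil_mul (fil_zero a) hb

theorem fil_mul_right {n : ℕ} {a : Coeffs 𝒢} (b : Coeffs 𝒢) (ha : a ∈ fil 𝒢 n) :
    a * b ∈ fil 𝒢 n := by
  simpa using fil_mul ha (fil_zero b)

theorem fil_zsmul {n : ℕ} {a : Coeffs 𝒢} (c : ℤ) (ha : a ∈ fil 𝒢 n) : c • a ∈ fil 𝒢 n :=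
  zsmul_mem ha c

theorem fil_sum {ι : Type*} {n : ℕ} {f : ι → Coeffs 𝒢} (h : ∀ i, f i ∈ fil 𝒢 n) :
    sum f ∈ fil 𝒢 n := by
  intro l hl
  rw [comp_sum]
  exact finsum_eq_zero_of_forall_eq_zero fun i => h i l hl

section Derivation
variable [GradedDerivation 𝒢]

theorem fil_D {n : ℕ} {a : Coeffs 𝒢} (h : a ∈ fil 𝒢 n) : D a ∈ fil 𝒢 (n + 1) := by
  intro l hl
  cases l with
  | zero => simp
  | succ l => rw [comp_D_succ, h l (by omega), map_zero]

theorem fil_D_iterate {n : ℕ} (r : ℕ) {a : Coeffs 𝒢} (h : a ∈ fil 𝒢 n) :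
    D^[r] a ∈ fil 𝒢 (n + r) := by
  induction r with
  | zero => exact h
  | succ r ih => rw [Function.iterate_succ_apply']; exact fil_D ih

end Derivation

/-! ### Families that are finite in every degree -/

/-- A family is locally finite if only finitely many members are non-zero in any given degree. -/
def LocFin {ι : Type*} (f : ι → Coeffs 𝒢) : Prop := ∀ n, ∀ᶠ i in cofinite, f i ∈ fil 𝒢 n

/-- Linear maps that are continuous for the filtration by degree. -/
def Cont {𝒢' : ℕ → Submodule k B} [SetLike.GradedMonoid 𝒢'] (L : Coeffs 𝒢 →ₗ[k] Coeffs 𝒢') :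
    Prop := ∀ n, ∃ m, ∀ a ∈ fil 𝒢 m, L a ∈ fil 𝒢' n

namespace LocFin

variable {ι κ : Type*} {f g : ι → Coeffs 𝒢}

theorem mono (hf : LocFin f) (h : ∀ n i, f i ∈ fil 𝒢 n → g i ∈ fil 𝒢 n) : LocFin g :=
  fun n => (hf n).mono fun i => h n i

theorem mul_left (a : ι → Coeffs 𝒢) (hf : LocFin f) : LocFin fun i => a i * f i :=
  hf.mono fun _ _ h => fil_mul_left _ h

theorem mul_right (a : ι → Coeffs 𝒢) (hf : LocFin f) : LocFin fun i => f i * a i :=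
  hf.mono fun _ _ h => fil_mul_right _ h

theorem D [GradedDerivation 𝒢] (hf : LocFin f) : LocFin fun i => Coeffs.D (f i) :=
  hf.mono fun n _ h => fil_anti (Nat.le_succ n) (fil_D h)

theorem comp_injective (hf : LocFin f) {e : κ → ι} (he : Function.Injective e) :
    LocFin fun i => f (e i) := fun n => he.tendsto_cofinite.eventually (hf n)

theorem hasFiniteSupport (hf : LocFin f) (n : ℕ) :
    Function.HasFiniteSupport fun i => comp n (f i) :=
  (hf (n + 1)).subset fun _ hi h => hi (h n n.lt_succ_self)

end LocFin

section Sum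

variable {ι κ : Type*} {f g : ι → Coeffs 𝒢}

theorem sum_congr (h : ∀ i, f i = g i) : sum f = sum g := by rw [funext h]

theorem sum_sub_finset_mem {n : ℕ} (s : Finset ι) (h : ∀ i ∉ s, f i ∈ fil 𝒢 n) :
    sum f - ∑ i ∈ s, f i ∈ fil 𝒢 n := by
  intro l hl
  rw [comp_sub, comp_sum, comp_finsetSum, finsum_eq_sum_of_support_subset, sub_self]
  intro i hi
  by_contra hs
  exact hi (h i hs l hl)

/-- The values of two sums agree if they agree, in any degree, along finite partial sums. -/
theorem map_sum {L : Coeffs 𝒢 →ₗ[k] Coeffs 𝒢} (hL : Cont L) (hf : LocFin f) :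
    L (sum f) = sum fun i => L (f i) := by
  rw [← sub_eq_zero]
  refine eq_zero_of_fil fun n => ?_
  obtain ⟨m, hm⟩ := hL n
  set s := (show {i | ¬ f i ∈ fil 𝒢 m}.Finite from hf m).toFinset
  have hs : ∀ i ∉ s, f i ∈ fil 𝒢 m := fun i hi => by simpa [s] using hi
  have h1 := hm _ (sum_sub_finset_mem s hs)
  have h2 := sum_sub_finset_mem (f := fun i => L (f i)) s fun i hi => hm _ (hs i hi)
  rw [map_sub, _root_.map_sum] at h1
  simpa using sub_mem h1 h2

theorem sum_add (hf : LocFin f) (hg : LocFin g) :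
    (sum fun i => f i + g i) = sum f + sum g := by
  refine ext_comp fun n => ?_
  simp only [comp_sum, comp_add]
  exact finsum_add_distrib (hf.hasFiniteSupport n) (hg.hasFiniteSupport n)

theorem sum_sub (hf : LocFin f) (hg : LocFin g) :
    (sum fun i => f i - g i) = sum f - sum g := by
  refine ext_comp fun n => ?_
  simp only [comp_sum, comp_sub]
  exact finsum_sub_distrib (hf.hasFiniteSupport n) (hg.hasFiniteSupport n)

theorem sum_zero : (sum fun _ : ι => (0 : Coeffs 𝒢)) = 0 :=
  ext_comp fun n => by simp

theorem sum_equiv (e : κ ≃ ι) : (sum fun i => f (e i)) = sum f := by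
  refine ext_comp fun n => ?_
  simp only [comp_sum]
  exact finsum_comp_equiv e (f := fun i => comp n (f i))

theorem sum_prod {F : ι × κ → Coeffs 𝒢} (hF : LocFin F) :
    sum F = sum fun i => sum fun j => F (i, j) := by
  refine ext_comp fun n => ?_
  simp only [comp_sum]
  exact finsum_curry _ (hF.hasFiniteSupport n)

theorem sum_prod' {F : ι × κ → Coeffs 𝒢} (hF : LocFin F) :
    sum F = sum fun j => sum fun i => F (i, j) := by
  rw [← sum_equiv (Equiv.prodComm κ ι), sum_prod (hF.comp_injective (Equiv.injective _))]
  rfl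

theorem sum_eq_single (i : ι) (h : ∀ j, j ≠ i → f j = 0) : sum f = f i := by
  refine ext_comp fun n => ?_
  rw [comp_sum]
  exact finsum_eq_single _ i fun j hj => by rw [h j hj, comp_zero]

theorem sum_eq_finset (s : Finset ι) (h : ∀ i ∉ s, f i = 0) : sum f = ∑ i ∈ s, f i := by
  refine sub_eq_zero.mp (eq_zero_of_fil fun n => sum_sub_finset_mem s fun i hi => ?_)
  rw [h i hi]; exact zero_mem _

/-- Summation over the range of an injection that carries the support. -/
theorem sum_injective {e : κ → ι} (he : Function.Injective e)
    (h : ∀ i, i ∉ Set.range e → f i = 0) : (sum fun i => f (e i)) = sum f := by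
  refine ext_comp fun n => ?_
  simp only [comp_sum]
  rw [← finsum_mem_range (f := fun i => comp n (f i)) he, finsum_mem_def]
  refine finsum_congr fun i => ?_
  by_cases hi : i ∈ Set.range e
  · simp [hi]
  · simp [hi, h i hi]

theorem sum_sumType {ι κ : Type*} {f : ι ⊕ κ → Coeffs 𝒢} (hf : LocFin f) :
    Coeffs.sum f = (Coeffs.sum fun i => f (Sum.inl i)) + Coeffs.sum fun i => f (Sum.inr i) := by
  let f1 : ι ⊕ κ → Coeffs 𝒢 := Sum.elim (fun i => f (Sum.inl i)) 0
  let f2 : ι ⊕ κ → Coeffs 𝒢 := Sum.elim 0 fun i => f (Sum.inr i)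
  have h1 : LocFin f1 := hf.mono fun n i h => by
    cases i
    · exact h
    · exact zero_mem (fil 𝒢 n)
  have h2 : LocFin f2 := hf.mono fun n i h => by
    cases i
    · exact zero_mem (fil 𝒢 n)
    · exact h
  have e1 : Coeffs.sum f1 = Coeffs.sum fun i => f (Sum.inl i) :=
    (sum_injective (f := f1) Sum.inl_injective fun i hi => by
      cases i
      · exact absurd ⟨_, rfl⟩ hi
      · rfl).symm
  have e2 : Coeffs.sum f2 = Coeffs.sum fun i => f (Sum.inr i) :=
    (sum_injective (f := f2) Sum.inr_injective fun i hi => by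
      cases i
      · rfl
      · exact absurd ⟨_, rfl⟩ hi).symm
  rw [← e1, ← e2, ← sum_add h1 h2]
  refine sum_congr fun i => ?_
  cases i <;> simp [f1, f2]

theorem LocFin.sum_fst {F : ι × κ → Coeffs 𝒢} (hF : LocFin F) :
    LocFin fun i => sum fun j => F (i, j) := fun n => by
  refine ((hF n).image Prod.fst).subset fun i hi => ?_
  by_contra hcon
  refine hi (fil_sum fun j => ?_)
  by_contra hj
  exact hcon ⟨(i, j), hj, rfl⟩

theorem LocFin.snd {F : ι × κ → Coeffs 𝒢} (hF : LocFin F) (i : ι) :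
    LocFin fun j => F (i, j) := hF.comp_injective (Prod.mk_right_injective i)

end Sum

theorem Cont.mulLeft (a : Coeffs 𝒢) : Cont (LinearMap.mulLeft k a) := fun n =>
  ⟨n, fun _ hb => fil_mul_left a hb⟩

theorem Cont.of_filtered {L : Coeffs 𝒢 →ₗ[k] Coeffs 𝒢}
    (h : ∀ n, ∀ a ∈ fil 𝒢 n, L a ∈ fil 𝒢 n) : Cont L := fun n => ⟨n, h n⟩

theorem Cont.D [GradedDerivation 𝒢] : Cont (Coeffs.D : Coeffs 𝒢 →ₗ[k] Coeffs 𝒢) := fun n =>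
  ⟨n, fun _ h => fil_anti (Nat.le_succ n) (fil_D h)⟩

section
variable {ι : Type*} {f : ι → Coeffs 𝒢}

theorem mul_sum (a : Coeffs 𝒢) (hf : LocFin f) : a * sum f = sum fun i => a * f i :=
  map_sum (L := LinearMap.mulLeft k a) (Cont.mulLeft a) hf

theorem sum_mul (a : Coeffs 𝒢) (hf : LocFin f) : sum f * a = sum fun i => f i * a := by
  rw [mul_comm, mul_sum a hf]
  exact sum_congr fun i => mul_comm _ _

theorem sum_smul (c : k) (hf : LocFin f) : (sum fun i => c • f i) = c • sum f :=
  (map_sum (L := c • LinearMap.id) (Cont.of_filtered fun _ _ h => Submodule.smul_mem _ c h) hf).symm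

theorem sum_zsmul (c : ℤ) (hf : LocFin f) : (sum fun i => c • f i) = c • sum f :=
  (map_sum (L := c • LinearMap.id) (Cont.of_filtered fun _ _ h => fil_zsmul c h) hf).symm

variable [GradedDerivation 𝒢]

theorem D_sum (hf : LocFin f) : D (sum f) = sum fun i => D (f i) := map_sum Cont.D hf

theorem D_iterate_eq_pow (r : ℕ) (a : Coeffs 𝒢) :
    D^[r] a = (D ^ r : Coeffs 𝒢 →ₗ[k] Coeffs 𝒢) a := (Module.End.pow_apply D r a).symm

theorem D_iterate_sum (r : ℕ) (hf : LocFin f) :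
    D^[r] (sum f) = sum fun i => D^[r] (f i) := by
  simp only [D_iterate_eq_pow]
  refine map_sum (Cont.of_filtered fun n a h => ?_) hf
  rw [← D_iterate_eq_pow]
  exact fil_anti (Nat.le_add_right n r) (fil_D_iterate r h)

theorem D_iterate_add (r : ℕ) (a b : Coeffs 𝒢) : D^[r] (a + b) = D^[r] a + D^[r] b := by
  simp [D_iterate_eq_pow]

theorem D_iterate_zero (r : ℕ) : D^[r] (0 : Coeffs 𝒢) = 0 := by
  simp

theorem D_iterate_zsmul (r : ℕ) (c : ℤ) (a : Coeffs 𝒢) : D^[r] (c • a) = c • D^[r] a := by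
  rw [D_iterate_eq_pow, D_iterate_eq_pow, map_zsmul]

theorem D_iterate_smul (r : ℕ) (c : k) (a : Coeffs 𝒢) : D^[r] (c • a) = c • D^[r] a := by
  simp [D_iterate_eq_pow]

theorem D_iterate_D (r : ℕ) (a : Coeffs 𝒢) : D^[r] (D a) = D (D^[r] a) := by
  rw [← Function.iterate_succ_apply, Function.iterate_succ_apply']

/-- The Leibniz rule for iterated derivatives. -/
theorem D_iterate_mul (r : ℕ) (a b : Coeffs 𝒢) :
    D^[r] (a * b) = ∑ p ∈ antidiagonal r, r.choose p.1 • (D^[p.1] a * D^[p.2] b) := by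
  induction r with
  | zero => simp
  | succ r ih =>
    rw [Function.iterate_succ_apply', ih, Finset.sum_antidiagonal_choose_succ_nsmul
      (fun i j => D^[i] a * D^[j] b), _root_.map_sum, ← Finset.sum_add_distrib]
    refine Finset.sum_congr rfl fun p hp => ?_
    rw [map_nsmul, D_mul, smul_add, Function.iterate_succ_apply', Function.iterate_succ_apply',
      Nat.choose_symm_of_eq_add (mem_antidiagonal.mp hp).symm]

end

end Coeffs

end

section

open Filter Finset.HasAntidiagonal

/-! ### Associative algebras of operators -/

section Operators

variable {k : Type*} [Field k] {B : Type*} [CommRing B] [Algebra k B]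
  {𝒢 : ℕ → Submodule k B} [SetLike.GradedMonoid 𝒢]

open Coeffs

/-- A double family over `ℕ × ℕ` may be summed along antidiagonals. -/
theorem Coeffs.sum_antidiagonal {G : ℕ → ℕ → Coeffs 𝒢} (hG : LocFin fun p : ℕ × ℕ => G p.1 p.2) :
    (Coeffs.sum fun s : ℕ => ∑ p ∈ antidiagonal s, G p.1 p.2)
      = Coeffs.sum fun p : ℕ × ℕ => G p.1 p.2 := by
  let e : ℕ × ℕ → ℕ × ℕ := fun p => (p.1 + p.2, p.1)
  have he : Function.Injective e := fun p q h => by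
    simp only [e, Prod.mk.injEq] at h; ext <;> omega
  let F : ℕ × ℕ → Coeffs 𝒢 := fun p => if p.2 ≤ p.1 then G p.2 (p.1 - p.2) else 0
  have hFe : ∀ p, F (e p) = G p.1 p.2 := fun p => by simp [F, e]
  have hF0 : ∀ p, p ∉ Set.range e → F p = 0 := fun p hp => by
    refine if_neg fun h => hp ⟨(p.2, p.1 - p.2), ?_⟩
    ext <;> simp only [e]
    omega
  have hF : LocFin F := fun n => by
    refine ((hG n).image e).subset fun p hp => ?_
    by_cases h : p ∈ Set.range e
    · obtain ⟨q, rfl⟩ := h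
      refine ⟨q, fun hq => hp ?_, rfl⟩
      change F (e q) ∈ fil 𝒢 n
      rw [hFe]
      exact hq
    · refine absurd ?_ hp
      change F p ∈ fil 𝒢 n
      rw [hF0 p h]
      exact zero_mem _
  have h1 := sum_injective he hF0
  simp only [hFe] at h1
  rw [h1, sum_prod hF]
  refine sum_congr fun s => ?_
  rw [sum_eq_finset (Finset.range (s + 1)), Finset.Nat.sum_antidiagonal_eq_sum_range_succ
    (fun i j => G i j)]
  · refine Finset.sum_congr rfl fun i hi => ?_
    simp only [F]
    rw [if_pos (by simpa [Nat.lt_succ_iff] using hi)]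
  · intro i hi
    simp only [F]
    rw [if_neg (by simpa using hi)]

variable (𝒢) in
/-- Operators that, up to terms of high degree, have only coefficients of bounded order: bounded
above for `ε = 1`, bounded below for `ε = -1`. They contain `𝒟⁻` and `𝒟⁺` respectively, and are
closed under multiplication. -/
def opAdm (ε : ℤˣ) : Submodule k (Op 𝒢) where
  carrier := {P | ∀ n, ∃ d : ℤ, ∀ i, d < ε * i → P i ∈ fil 𝒢 n}
  zero_mem' := fun n => ⟨0, fun i _ => zero_mem _⟩
  add_mem' := by
    intro P Q hP hQ n
    obtain ⟨d, hd⟩ := hP n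
    obtain ⟨e, he⟩ := hQ n
    exact ⟨max d e, fun i hi => add_mem (hd i ((le_max_left _ _).trans_lt hi))
      (he i ((le_max_right _ _).trans_lt hi))⟩
  smul_mem' := by
    intro c P hP n
    obtain ⟨d, hd⟩ := hP n
    exact ⟨d, fun i hi => Submodule.smul_mem _ c (hd i hi)⟩

theorem opMinus_le_opAdm : opMinus 𝒢 ≤ opAdm 𝒢 1 := by
  rintro P ⟨d, hd⟩ n
  refine ⟨d, fun i hi => ?_⟩
  rw [hd i (by simpa using hi)]
  exact zero_mem _

theorem mem_opPlusGE_iff {d : ℤ} {P : Op 𝒢} :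
    P ∈ opPlusGE 𝒢 d ↔ ∀ i, P i ∈ fil 𝒢 (d - i).toNat := by
  constructor
  · intro h i l hl
    exact h i l (by omega)
  · intro h i n hn
    exact h i n (by omega)

theorem opPlus_le_opAdm : opPlus 𝒢 ≤ opAdm 𝒢 (-1) := by
  rintro P ⟨d, hd⟩ n
  rw [mem_opPlusGE_iff] at hd
  refine ⟨n - d, fun i hi => fil_anti ?_ (hd i)⟩
  simp only [Units.val_neg, Units.val_one] at hi
  omega

theorem units_mul_cases (ε : ℤˣ) : (∀ i : ℤ, ε * i = i) ∨ (∀ i : ℤ, ε * i = -i) := by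
  rcases Int.units_eq_one_or ε with rfl | rfl <;> simp

/-- Families that depend on the coefficients of two operators in the way of the coefficient of `Dˡ`
in their product are finite in every degree. -/
theorem locFin_mul {ε : ℤˣ} {P Q : Op 𝒢} (hP : P ∈ opAdm 𝒢 ε) (hQ : Q ∈ opAdm 𝒢 ε) (l : ℤ)
    {F : ℤ × ℕ → Coeffs 𝒢} (h1 : ∀ n i r, P i ∈ fil 𝒢 n → F (i, r) ∈ fil 𝒢 n)
    (h2 : ∀ n (i : ℤ) (r : ℕ), Q (l + r - i) ∈ fil 𝒢 n → F (i, r) ∈ fil 𝒢 n)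
    (h3 : ∀ n i r, n + 1 ≤ r → F (i, r) ∈ fil 𝒢 n) : LocFin F := by
  intro n
  obtain ⟨d, hd⟩ := hP n
  obtain ⟨e, he⟩ := hQ n
  set M : ℤ := |d| + |e| + |l| + n with hM
  refine Set.Finite.subset ((Set.finite_Icc (-M) M).prod (Set.finite_Iic n)) ?_
  rintro ⟨i, r⟩ hF
  have a1 : ¬ n + 1 ≤ r := fun h => hF (h3 n i r h)
  have a2 : ¬ d < ε * i := fun h => hF (h1 n i r (hd i h))
  have a3 : ¬ e < ε * (l + r - i) := fun h => hF (h2 n i r (he _ h))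
  simp only [Set.mem_prod, Set.mem_Icc, Set.mem_Iic]
  have b1 := le_abs_self d
  have b2 := le_abs_self e
  have b3 := le_abs_self l
  have b4 := neg_abs_le l
  have b5 := abs_nonneg d
  have b6 := abs_nonneg e
  rcases units_mul_cases ε with h | h <;> rw [h] at a2 a3 <;> omega

/-- The analogue of `locFin_mul` for the coefficient of `Dˡ` in a product of three operators. -/
theorem locFin_mul_mul {ε : ℤˣ} {P Q R : Op 𝒢} (hP : P ∈ opAdm 𝒢 ε) (hQ : Q ∈ opAdm 𝒢 ε)
    (hR : R ∈ opAdm 𝒢 ε) (l : ℤ) {F : (ℤ × ℤ) × (ℕ × ℕ) → Coeffs 𝒢}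
    (h1 : ∀ n i j r t, P i ∈ fil 𝒢 n → F ((i, j), (r, t)) ∈ fil 𝒢 n)
    (h2 : ∀ n i j r t, Q j ∈ fil 𝒢 n → F ((i, j), (r, t)) ∈ fil 𝒢 n)
    (h3 : ∀ n (i j : ℤ) (r t : ℕ), R (l + r + t - i - j) ∈ fil 𝒢 n →
      F ((i, j), (r, t)) ∈ fil 𝒢 n)
    (h4 : ∀ n i j r t, n ≤ r → F ((i, j), (r, t)) ∈ fil 𝒢 n)
    (h5 : ∀ n i j r t, n ≤ t → F ((i, j), (r, t)) ∈ fil 𝒢 n) : LocFin F := by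
  intro n
  obtain ⟨d, hd⟩ := hP n
  obtain ⟨e, he⟩ := hQ n
  obtain ⟨f, hf⟩ := hR n
  set M : ℤ := |d| + |e| + |f| + |l| + 2 * n with hM
  refine Set.Finite.subset (((Set.finite_Icc (-M) M).prod (Set.finite_Icc (-M) M)).prod
    ((Set.finite_Iic n).prod (Set.finite_Iic n))) ?_
  rintro ⟨⟨i, j⟩, ⟨r, t⟩⟩ hF
  have a1 : ¬ n ≤ r := fun h => hF (h4 n i j r t h)
  have a0 : ¬ n ≤ t := fun h => hF (h5 n i j r t h)
  have a2 : ¬ d < ε * i := fun h => hF (h1 n i j r t (hd i h))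
  have a3 : ¬ e < ε * j := fun h => hF (h2 n i j r t (he _ h))
  have a4 : ¬ f < ε * (l + r + t - i - j) := fun h => hF (h3 n i j r t (hf _ h))
  simp only [Set.mem_prod, Set.mem_Icc, Set.mem_Iic]
  have b1 := le_abs_self d
  have b2 := le_abs_self e
  have b3 := le_abs_self l
  have b4 := neg_abs_le l
  have b5 := abs_nonneg d
  have b6 := abs_nonneg e
  have b7 := abs_nonneg f
  have b8 := le_abs_self f
  rcases units_mul_cases ε with h | h <;> rw [h] at a2 a3 a4 <;> omega

variable [GradedDerivation 𝒢]

theorem Coeffs.fil_D_iterate_of_mem {n : ℕ} (r : ℕ) {a : Coeffs 𝒢} (h : a ∈ fil 𝒢 n) :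
    D^[r] a ∈ fil 𝒢 n := fil_anti (Nat.le_add_right n r) (fil_D_iterate r h)

theorem Coeffs.fil_D_iterate_of_le {n r : ℕ} (a : Coeffs 𝒢) (h : n ≤ r) :
    D^[r] a ∈ fil 𝒢 n := fil_anti (by omega) (fil_D_iterate r (fil_zero a))

theorem locFin_opMul {ε : ℤˣ} {P Q : Op 𝒢} (hP : P ∈ opAdm 𝒢 ε) (hQ : Q ∈ opAdm 𝒢 ε) (l : ℤ) :
    LocFin fun p : ℤ × ℕ => Ring.choose p.1 p.2 • (P p.1 * (D^[p.2]) (Q (l + p.2 - p.1))) :=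
  locFin_mul hP hQ l (fun _ _ _ h => fil_zsmul _ (fil_mul_right _ h))
    (fun _ _ r h => fil_zsmul _ (fil_mul_left _ (fil_D_iterate_of_mem r h)))
    (fun _ _ _ h => fil_zsmul _ (fil_mul_left _ (fil_D_iterate_of_le _ (by omega))))

theorem opMul_mem_opAdm {ε : ℤˣ} {P Q : Op 𝒢} (hP : P ∈ opAdm 𝒢 ε) (hQ : Q ∈ opAdm 𝒢 ε) :
    P ⊛ Q ∈ opAdm 𝒢 ε := by
  intro n
  obtain ⟨d, hd⟩ := hP n
  obtain ⟨e, he⟩ := hQ n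
  -- Beyond this order one of the factors is of high degree, or at least `n` derivatives occur.
  refine ⟨d + e + n, fun l hl => fil_sum fun p => fil_zsmul _ ?_⟩
  obtain ⟨i, r⟩ := p
  dsimp only
  by_cases h1 : d < ε * i
  · exact fil_mul_right _ (hd i h1)
  by_cases h2 : e < ε * (l + r - i)
  · exact fil_mul_left _ (fil_D_iterate_of_mem r (he _ h2))
  refine fil_mul_left _ (fil_D_iterate_of_le _ ?_)
  rcases units_mul_cases ε with h | h <;> rw [h] at h1 h2 hl <;> omega

theorem opMul_mem_opMinusLE {d e : ℤ} {P Q : Op 𝒢} (hP : P ∈ opMinusLE 𝒢 d)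
    (hQ : Q ∈ opMinusLE 𝒢 e) : P ⊛ Q ∈ opMinusLE 𝒢 (d + e) := by
  intro l hl
  refine (sum_congr fun p => ?_).trans sum_zero
  by_cases h1 : d < p.1
  · rw [hP _ h1, zero_mul, zsmul_zero]
  · rw [hQ (l + p.2 - p.1) (by omega), D_iterate_zero, mul_zero, zsmul_zero]

theorem opMul_mem_opPlusGE {d e : ℤ} {P Q : Op 𝒢} (hP : P ∈ opPlusGE 𝒢 d)
    (hQ : Q ∈ opPlusGE 𝒢 e) : P ⊛ Q ∈ opPlusGE 𝒢 (d + e) := by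
  rw [mem_opPlusGE_iff] at *
  intro l
  refine fil_sum fun p => fil_zsmul _ (fil_anti ?_
    (fil_mul (hP p.1) (fil_D_iterate p.2 (hQ (l + p.2 - p.1)))))
  omega

theorem opMul_mem_opMinus {P Q : Op 𝒢} (hP : P ∈ opMinus 𝒢) (hQ : Q ∈ opMinus 𝒢) :
    P ⊛ Q ∈ opMinus 𝒢 := by
  obtain ⟨d, hd⟩ := hP
  obtain ⟨e, he⟩ := hQ
  exact ⟨d + e, opMul_mem_opMinusLE hd he⟩

theorem opMul_mem_opPlus {P Q : Op 𝒢} (hP : P ∈ opPlus 𝒢) (hQ : Q ∈ opPlus 𝒢) :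
    P ⊛ Q ∈ opPlus 𝒢 := by
  obtain ⟨d, hd⟩ := hP
  obtain ⟨e, he⟩ := hQ
  exact ⟨d + e, opMul_mem_opPlusGE hd he⟩

theorem opMul_add {ε : ℤˣ} {P Q R : Op 𝒢} (hP : P ∈ opAdm 𝒢 ε) (hQ : Q ∈ opAdm 𝒢 ε)
    (hR : R ∈ opAdm 𝒢 ε) : P ⊛ (Q + R) = P ⊛ Q + P ⊛ R := by
  funext l
  refine (sum_congr fun p => ?_).trans (sum_add (locFin_opMul hP hQ l) (locFin_opMul hP hR l))
  rw [Pi.add_apply, D_iterate_add, mul_add, zsmul_add]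

theorem add_opMul {ε : ℤˣ} {P Q R : Op 𝒢} (hP : P ∈ opAdm 𝒢 ε) (hQ : Q ∈ opAdm 𝒢 ε)
    (hR : R ∈ opAdm 𝒢 ε) : (P + Q) ⊛ R = P ⊛ R + Q ⊛ R := by
  funext l
  refine (sum_congr fun p => ?_).trans (sum_add (locFin_opMul hP hR l) (locFin_opMul hQ hR l))
  rw [Pi.add_apply, add_mul, zsmul_add]

theorem smul_opMul {ε : ℤˣ} {P Q : Op 𝒢} (c : k) (hP : P ∈ opAdm 𝒢 ε) (hQ : Q ∈ opAdm 𝒢 ε) :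
    (c • P) ⊛ Q = c • (P ⊛ Q) := by
  funext l
  refine (sum_congr fun p => ?_).trans (sum_smul c (locFin_opMul hP hQ l))
  rw [Pi.smul_apply, smul_mul_assoc, smul_comm]

theorem zero_opMul (P : Op 𝒢) : 0 ⊛ P = 0 := by
  funext l
  exact (sum_congr fun p => by simp).trans sum_zero

theorem opMul_zero (P : Op 𝒢) : P ⊛ 0 = 0 := by
  funext l
  exact (sum_congr fun p => by simp).trans sum_zero

/-- The Leibniz rule and the Chu-Vandermonde identity: the two ways of bracketing
`Dⁱ · b Dʲ · c` agree, with `c m` in place of the coefficient `c` of the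
monomial `c D^{l+m-i-j}`. -/
theorem sum_choose_leibniz (i j : ℤ) (b : Coeffs 𝒢) (c : ℕ → Coeffs 𝒢) :
    (Coeffs.sum fun p : ℕ × ℕ => Ring.choose i p.1 • Ring.choose j p.2 •
        D^[p.1] (b * D^[p.2] (c (p.1 + p.2))))
      = Coeffs.sum fun p : ℕ × ℕ => Ring.choose i p.1 • Ring.choose (i + j - p.1) p.2 •
        (D^[p.1] b * D^[p.2] (c (p.1 + p.2))) := by
  -- The common refinement of both sides, indexed by `(q, (r, u))`.
  let G : ℕ → ℕ → ℕ → Coeffs 𝒢 := fun q r u =>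
    (Ring.choose i r * Ring.choose (i - r) u * Ring.choose j q) •
      (D^[r] b * D^[u + q] (c (r + u + q)))
  have hG : ∀ n q r u, n ≤ q ∨ n ≤ r ∨ n ≤ u → G q r u ∈ fil 𝒢 n := by
    intro n q r u h
    refine fil_zsmul _ (fil_anti ?_ (fil_mul (fil_D_iterate r (fil_zero b))
      (fil_D_iterate (u + q) (fil_zero _))))
    omega
  have hG3 : ∀ {e : ℕ × ℕ × ℕ → ℕ × ℕ × ℕ}, Function.Injective e →
      LocFin fun p : ℕ × ℕ × ℕ => G (e p).1 (e p).2.1 (e p).2.2 := by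
    intro e he n
    refine ((((Set.finite_Iio n).prod ((Set.finite_Iio n).prod (Set.finite_Iio n)))).preimage
      he.injOn).subset fun p hp => ?_
    by_contra hcon
    refine hp (hG n _ _ _ ?_)
    simp only [Set.mem_preimage, Set.mem_prod, Set.mem_Iio, not_and_or, not_lt] at hcon
    tauto
  have hid := hG3 (e := id) Function.injective_id
  have hL : LocFin fun p : ℕ × ℕ => Ring.choose i p.1 • Ring.choose j p.2 •
        D^[p.1] (b * D^[p.2] (c (p.1 + p.2))) := fun n => by
    refine ((Set.finite_Iio n).prod (Set.finite_Iio n)).subset fun p hp => ?_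
    by_contra hcon
    simp only [Set.mem_prod, Set.mem_Iio, not_and_or, not_lt] at hcon
    refine hp (fil_zsmul _ (fil_zsmul _ ?_))
    rcases hcon with h | h
    · exact fil_D_iterate_of_le _ h
    · exact fil_D_iterate_of_mem _ (fil_mul_left _ (fil_D_iterate_of_le _ h))
  have hR : LocFin fun p : ℕ × ℕ => Ring.choose i p.1 • Ring.choose (i + j - p.1) p.2 •
        (D^[p.1] b * D^[p.2] (c (p.1 + p.2))) := fun n => by
    refine ((Set.finite_Iio n).prod (Set.finite_Iio n)).subset fun p hp => ?_
    by_contra hcon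
    simp only [Set.mem_prod, Set.mem_Iio, not_and_or, not_lt] at hcon
    refine hp (fil_zsmul _ (fil_zsmul _ ?_))
    rcases hcon with h | h
    · exact fil_mul_right _ (fil_D_iterate_of_le _ h)
    · exact fil_mul_left _ (fil_D_iterate_of_le _ h)
  trans Coeffs.sum fun p : ℕ × ℕ × ℕ => G p.1 p.2.1 p.2.2
  · rw [sum_prod' hL, sum_prod (F := fun p : ℕ × ℕ × ℕ => G p.1 p.2.1 p.2.2) hid]
    refine sum_congr fun q => ?_
    rw [← sum_antidiagonal (G := fun r u => G q r u) (hid.snd q)]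
    refine sum_congr fun s => ?_
    dsimp only
    rw [D_iterate_mul, ← Finset.sum_zsmul, ← Finset.sum_zsmul]
    refine Finset.sum_congr rfl fun p hp => ?_
    rw [mem_antidiagonal] at hp
    subst hp
    have h1 := Ring.choose_smul_choose i (Nat.le_add_right p.1 p.2)
    rw [Nat.add_sub_cancel_left] at h1
    simp only [G]
    rw [← h1, ← Function.iterate_add_apply, ← natCast_zsmul, smul_smul, smul_smul, nsmul_eq_mul]
    congr 1
    ring
  · let e : ℕ × ℕ × ℕ ≃ ℕ × ℕ × ℕ :=
      ⟨fun p => (p.2.2, p.1, p.2.1), fun p => (p.2.1, p.2.2, p.1), fun _ => rfl, fun _ => rfl⟩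
    have he := hG3 e.injective
    rw [sum_prod hR, ← sum_equiv e, sum_prod he]
    refine sum_congr fun r => ?_
    rw [show (fun x : ℕ × ℕ => G (e (r, x)).1 (e (r, x)).2.1 (e (r, x)).2.2)
      = fun x : ℕ × ℕ => G x.2 r x.1 from rfl,
      ← sum_antidiagonal (G := fun u q => G q r u) (he.snd r)]
    refine sum_congr fun t => ?_
    dsimp only
    rw [show i + j - (r : ℤ) = (i - r) + j by ring, Ring.add_choose_eq t (Commute.all _ _),
      smul_smul, Finset.mul_sum]
    refine Eq.trans ?_ Finset.sum_smul.symm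
    refine Finset.sum_congr rfl fun p hp => ?_
    rw [mem_antidiagonal] at hp
    subst hp
    simp only [G]
    rw [← mul_assoc, add_assoc]
    rfl

/-- Both triple products are sums over the orders `i`, `j` of the first two factors and two numbers
of derivatives; for fixed `i` and `j` they agree by `sum_choose_leibniz`. -/
theorem opMul_assoc {ε : ℤˣ} {P Q R : Op 𝒢} (hP : P ∈ opAdm 𝒢 ε) (hQ : Q ∈ opAdm 𝒢 ε)
    (hR : R ∈ opAdm 𝒢 ε) : (P ⊛ Q) ⊛ R = P ⊛ (Q ⊛ R) := by
  funext l
  let T : (ℤ × ℤ) × (ℕ × ℕ) → Coeffs 𝒢 := fun x =>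
    P x.1.1 * (Ring.choose x.1.1 x.2.1 • Ring.choose (x.1.1 + x.1.2 - x.2.1) x.2.2 •
      (D^[x.2.1] (Q x.1.2) * D^[x.2.2] (R (l + (x.2.1 + x.2.2 : ℕ) - x.1.1 - x.1.2))))
  let T' : (ℤ × ℤ) × (ℕ × ℕ) → Coeffs 𝒢 := fun x =>
    P x.1.1 * (Ring.choose x.1.1 x.2.1 • Ring.choose x.1.2 x.2.2 •
      D^[x.2.1] (Q x.1.2 * D^[x.2.2] (R (l + (x.2.1 + x.2.2 : ℕ) - x.1.1 - x.1.2))))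
  have hT : LocFin T := by
    refine locFin_mul_mul hP hQ hR l ?_ ?_ ?_ ?_ ?_
    · exact fun n i j r t h => fil_mul_right _ h
    · exact fun n i j r t h => fil_mul_left _ (fil_zsmul _ (fil_zsmul _
        (fil_mul_right _ (fil_D_iterate_of_mem r h))))
    · intro n i j r t h
      refine fil_mul_left _ (fil_zsmul _ (fil_zsmul _
        (fil_mul_left _ (fil_D_iterate_of_mem t ?_))))
      simpa [add_assoc] using h
    · exact fun n i j r t h => fil_mul_left _ (fil_zsmul _ (fil_zsmul _
        (fil_mul_right _ (fil_D_iterate_of_le _ h))))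
    · exact fun n i j r t h => fil_mul_left _ (fil_zsmul _ (fil_zsmul _
        (fil_mul_left _ (fil_D_iterate_of_le _ h))))
  have hT' : LocFin T' := by
    refine locFin_mul_mul hP hQ hR l ?_ ?_ ?_ ?_ ?_
    · exact fun n i j r t h => fil_mul_right _ h
    · exact fun n i j r t h => fil_mul_left _ (fil_zsmul _ (fil_zsmul _
        (fil_D_iterate_of_mem r (fil_mul_right _ h))))
    · intro n i j r t h
      refine fil_mul_left _ (fil_zsmul _ (fil_zsmul _
        (fil_D_iterate_of_mem r (fil_mul_left _ (fil_D_iterate_of_mem t ?_)))))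
      simpa [add_assoc] using h
    · exact fun n i j r t h => fil_mul_left _ (fil_zsmul _ (fil_zsmul _
        (fil_D_iterate_of_le _ h)))
    · exact fun n i j r t h => fil_mul_left _ (fil_zsmul _ (fil_zsmul _
        (fil_D_iterate_of_mem r (fil_mul_left _ (fil_D_iterate_of_le _ h)))))
  have hTT' : Coeffs.sum T = Coeffs.sum T' := by
    rw [sum_prod hT, sum_prod hT']
    refine sum_congr fun x => ?_
    have h := sum_choose_leibniz x.1 x.2 (Q x.2)
      (fun m => R (l + (m : ℕ) - x.1 - x.2))
    simp only [T, T']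
    rw [← mul_sum, ← mul_sum, h]
    all_goals
      intro n
      refine ((Set.finite_Iio n).prod (Set.finite_Iio n)).subset fun p hp => ?_
      by_contra hcon
      simp only [Set.mem_prod, Set.mem_Iio, not_and_or, not_lt] at hcon
      refine hp (fil_zsmul _ (fil_zsmul _ ?_))
      rcases hcon with h | h
    · exact fil_D_iterate_of_le _ h
    · exact fil_D_iterate_of_mem _ (fil_mul_left _ (fil_D_iterate_of_le _ h))
    · exact fil_mul_right _ (fil_D_iterate_of_le _ h)
    · exact fil_mul_left _ (fil_D_iterate_of_le _ h)
  trans Coeffs.sum T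
  · let e : (ℤ × ℤ) × (ℕ × ℕ) ≃ (ℤ × ℕ) × (ℤ × ℕ) :=
      { toFun := fun x => ((x.1.1 + x.1.2 - x.2.1, x.2.2), (x.1.1, x.2.1))
        invFun := fun y => ((y.2.1, y.1.1 + y.2.2 - y.2.1), (y.2.2, y.1.2))
        left_inv := fun x => by ext <;> simp
        right_inv := fun y => by ext <;> simp }
    rw [← sum_equiv e.symm (f := T), sum_prod (hT.comp_injective e.symm.injective)]
    refine sum_congr fun p => ?_
    obtain ⟨a, t⟩ := p
    change Ring.choose a t • (Coeffs.sum (fun q : ℤ × ℕ => _) * _) = _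
    rw [sum_mul _ (locFin_opMul hP hQ a), ← sum_zsmul _ ((locFin_opMul hP hQ a).mul_right _)]
    refine sum_congr fun q => ?_
    obtain ⟨i, r⟩ := q
    simp only [T, e, Equiv.coe_fn_symm_mk]
    rw [show i + (a + (r : ℤ) - i) - r = a by ring,
      show l + ((r + t : ℕ) : ℤ) - i - (a + r - i) = l + t - a by push_cast; ring]
    simp only [smul_mul_assoc, mul_smul_comm, mul_assoc]
    rw [smul_comm]
  · rw [hTT']
    let e : (ℤ × ℤ) × (ℕ × ℕ) ≃ (ℤ × ℕ) × (ℤ × ℕ) := Equiv.prodProdProdComm ℤ ℤ ℕ ℕ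
    rw [← sum_equiv e.symm (f := T'), sum_prod (hT'.comp_injective e.symm.injective)]
    refine sum_congr fun p => ?_
    obtain ⟨i, s⟩ := p
    change _ = Ring.choose i s • (P i * D^[s] (Coeffs.sum (fun q : ℤ × ℕ => _)))
    have h0 := locFin_opMul hQ hR (l + s - i)
    have h1 := h0.mono (g := fun q : ℤ × ℕ => D^[s] (Ring.choose q.1 q.2 •
      (Q q.1 * (D^[q.2]) (R (l + s - i + q.2 - q.1))))) fun _ _ h => fil_D_iterate_of_mem s h
    rw [D_iterate_sum s h0, mul_sum _ h1, ← sum_zsmul _ (h1.mul_left _)]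
    refine sum_congr fun q => ?_
    obtain ⟨j, t⟩ := q
    simp only [T', e, Equiv.prodProdProdComm_symm, Equiv.prodProdProdComm_apply]
    rw [show l + ((s + t : ℕ) : ℤ) - i - j = l + s - i + t - j by push_cast; ring,
      D_iterate_zsmul, mul_smul_comm]

end Operators

end

section

/-! ### Quadratic brackets of `R`-matrices on associative algebras with a trace -/

section AbstractBracket

variable {𝔤 V : Type*} [NonUnitalRing 𝔤] [AddCommGroup V]

theorem nonUnital_lie_skew (x y : 𝔤) : ⁅x, y⁆ = -⁅y, x⁆ := by
  simp only [Ring.lie_def, neg_sub]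

theorem nonUnital_add_lie (x y z : 𝔤) : ⁅x + y, z⁆ = ⁅x, z⁆ + ⁅y, z⁆ := by
  simp only [Ring.lie_def]
  noncomm_ring

theorem nonUnital_lie_add (x y z : 𝔤) : ⁅x, y + z⁆ = ⁅x, y⁆ + ⁅x, z⁆ := by
  simp only [Ring.lie_def]
  noncomm_ring

/-- A trace form `τ` on an associative algebra together with the skew part `Q` and the symmetric
part `S` of an `R`-matrix such that both `Q` and `Q + S` satisfy the modified Yang-Baxter equation.
The conditions `lie_S_S` and `lie_Q_S` are the parts of the equation for `Q + S` of either parity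
under `S ↦ -S`; they also say that `(x, y) ↦ (Q x - S y, S x - Q y)` satisfies the modified
Yang-Baxter equation on `𝔤 × 𝔤`. -/
structure QuadraticRMatrix (τ : 𝔤 →+ V) (Q S : 𝔤 →+ 𝔤) : Prop where
  trace_comm : ∀ x y, τ (x * y) = τ (y * x)
  skew : ∀ x y, τ (Q x * y) = -τ (x * Q y)
  symm : ∀ x y, τ (S x * y) = τ (x * S y)
  lie_Q_Q : ∀ x y, ⁅Q x, Q y⁆ = Q (⁅Q x, y⁆ + ⁅x, Q y⁆) - ⁅x, y⁆
  lie_S_S : ∀ x y, ⁅S x, S y⁆ = S (⁅Q x, y⁆ + ⁅x, Q y⁆)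
  lie_Q_S : ∀ x y, ⁅Q x, S y⁆ = Q ⁅x, S y⁆ + S ⁅S x, y⁆

/-- Twice the quadratic Poisson tensor at `A`, namely `a A - A b` with `a = Q(AX) + S(XA)` and
`b = S(AX) + Q(XA)`. -/
def quadTensor (Q S : 𝔤 →+ 𝔤) (A X : 𝔤) : 𝔤 :=
  (Q (A * X) + S (X * A)) * A - A * (S (A * X) + Q (X * A))

/-- The derivative of `quadTensor Q S A X` with respect to `A` in the direction `ξ`. -/
def quadTensorDeriv (Q S : 𝔤 →+ 𝔤) (A ξ X : 𝔤) : 𝔤 :=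
  (Q (A * X) + S (X * A)) * ξ - ξ * (S (A * X) + Q (X * A))
    + ((Q (ξ * X) + S (X * ξ)) * A - A * (S (ξ * X) + Q (X * ξ)))

theorem map_quadTensor {Q S δ : 𝔤 →+ 𝔤} (hδ : ∀ x y, δ (x * y) = x * δ y + δ x * y)
    (hQ : ∀ x, δ (Q x) = Q (δ x)) (hS : ∀ x, δ (S x) = S (δ x)) (A X : 𝔤) :
    δ (quadTensor Q S A X) = quadTensorDeriv Q S A (δ A) X + quadTensor Q S A (δ X) := by
  simp only [quadTensor, quadTensorDeriv, map_add, map_sub, hδ, hQ, hS, mul_add, add_mul]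
  abel

namespace QuadraticRMatrix

variable {τ : 𝔤 →+ V} {Q S : 𝔤 →+ 𝔤} (h : QuadraticRMatrix τ Q S)

include h

theorem lie_add (x u x' u' : 𝔤) :
    ⁅Q x + S u, Q x' + S u'⁆ = Q (⁅Q x + S u, x'⁆ + ⁅x, Q x' + S u'⁆)
      + S (⁅S x + Q u, u'⁆ + ⁅u, S x' + Q u'⁆) - ⁅x, x'⁆ := by
  have h1 := h.lie_Q_Q x x'
  have h2 := h.lie_S_S u u'
  have h3 := h.lie_Q_S x u'
  have h4 := h.lie_Q_S x' u
  rw [nonUnital_lie_skew (Q x') (S u), nonUnital_lie_skew x' (S u), nonUnital_lie_skew (S x') u,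
    map_neg, map_neg] at h4
  simp only [nonUnital_add_lie, nonUnital_lie_add, map_add] at *
  rw [h1, h2, h3, neg_eq_iff_eq_neg.mp h4]
  abel

/-- The sum of the skew and the symmetric part satisfies the modified Yang-Baxter equation. -/
theorem lie_Q_add_S (x y : 𝔤) :
    ⁅Q x + S x, Q y + S y⁆ - (Q (⁅Q x + S x, y⁆ + ⁅x, Q y + S y⁆)
      + S (⁅Q x + S x, y⁆ + ⁅x, Q y + S y⁆)) = -⁅x, y⁆ := by
  rw [h.lie_add, add_comm (S x), add_comm (S y)]
  abel

theorem trace_lie (x y z : 𝔤) : τ (x * ⁅y, z⁆) = τ (z * ⁅x, y⁆) := by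
  simp only [Ring.lie_def, mul_sub, map_sub]
  rw [← mul_assoc x y z, h.trace_comm (x * y) z, h.trace_comm x (z * y), mul_assoc z y x]

theorem trace_quadTensorDeriv (A ξ X Z : 𝔤) :
    τ (X * quadTensorDeriv Q S A ξ Z)
      = τ (X * ((Q (A * Z) + S (Z * A)) * ξ - ξ * (S (A * Z) + Q (Z * A))))
        - τ (Z * ((Q (A * X) + S (X * A)) * ξ - ξ * (S (A * X) + Q (X * A)))) := by
  have e1 : ∀ a, τ (X * (a * A)) = τ (A * X * a) := fun a => by
    rw [← mul_assoc, h.trace_comm, mul_assoc]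
  have e2 : ∀ a, τ (X * (A * a)) = τ (X * A * a) := fun a => by rw [mul_assoc]
  have e3 : ∀ a, τ (Z * (a * ξ)) = τ (a * (ξ * Z)) := fun a => by
    rw [h.trace_comm, mul_assoc]
  have e4 : ∀ a, τ (Z * (ξ * a)) = τ (a * (Z * ξ)) := fun a => by
    rw [← mul_assoc, h.trace_comm]
  simp only [quadTensorDeriv, mul_add, mul_sub, add_mul, map_add, map_sub, e1, e2, e3, e4,
    h.skew, h.symm]
  abel

theorem trace_quadTensor (A X Z : 𝔤) :
    τ (X * quadTensor Q S A Z) = -τ (Z * quadTensor Q S A X) := by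
  have e1 : ∀ a, τ (X * (a * A)) = τ (A * X * a) := fun a => by
    rw [← mul_assoc, h.trace_comm, mul_assoc]
  have e2 : ∀ a, τ (X * (A * a)) = τ (X * A * a) := fun a => by rw [mul_assoc]
  have e3 : ∀ a, τ (Z * (a * A)) = τ (a * (A * Z)) := fun a => by
    rw [h.trace_comm, mul_assoc]
  have e4 : ∀ a, τ (Z * (A * a)) = τ (a * (Z * A)) := fun a => by
    rw [← mul_assoc, h.trace_comm]
  simp only [quadTensor, mul_add, mul_sub, add_mul, map_add, map_sub, e1, e2, e3, e4,
    h.skew, h.symm]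
  abel

/-- The tensor represents the bracket
`⟨[A, X], R(A Y + Y A)⟩ - ⟨[A, Y], R(A X + X A)⟩` with `R = Q + S`. -/
theorem trace_lie_quadratic (A X Y : 𝔤) :
    τ (⁅A, X⁆ * (Q (A * Y + Y * A) + S (A * Y + Y * A)))
      - τ (⁅A, Y⁆ * (Q (A * X + X * A) + S (A * X + X * A)))
      = τ (X * quadTensor Q S A Y) + τ (X * quadTensor Q S A Y) := by
  have e1 : ∀ a, τ (X * (a * A)) = τ (A * X * a) := fun a => by
    rw [← mul_assoc, h.trace_comm, mul_assoc]
  have e2 : ∀ a, τ (X * (A * a)) = τ (X * A * a) := fun a => by rw [mul_assoc]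
  have hQ : ∀ x y, τ (x * Q y) = -τ (y * Q x) := fun x y => by
    rw [← h.skew, h.trace_comm]
  have hS : ∀ x y, τ (x * S y) = τ (y * S x) := fun x y => by rw [← h.symm, h.trace_comm]
  simp only [quadTensor, Ring.lie_def, mul_add, mul_sub, sub_mul, map_add, map_sub, e1, e2]
  rw [hQ (A * Y) (A * X), hQ (A * Y) (X * A), hQ (Y * A) (A * X), hQ (Y * A) (X * A),
    hS (A * Y) (A * X), hS (A * Y) (X * A), hS (Y * A) (A * X), hS (Y * A) (X * A)]
  abel

/-- The Schouten bracket of the quadratic tensor vanishes. With `a` and `b` the left and right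
factors of the tensor, the cyclic sum is that of `τ(AX [a_Z, a_Y]) - τ(XA [b_Z, b_Y])`; by the
modified Yang-Baxter equation it equals minus `τ(AX [AZ, AY]) - τ(XA [ZA, YA])`, which is zero
because `τ` is a trace. -/
theorem cyclic_quadTensorDeriv (A X Y Z : 𝔤) :
    τ (X * quadTensorDeriv Q S A (quadTensor Q S A Y) Z)
      + τ (Y * quadTensorDeriv Q S A (quadTensor Q S A Z) X)
      + τ (Z * quadTensorDeriv Q S A (quadTensor Q S A X) Y) = 0 := by
  let a : 𝔤 → 𝔤 := fun X => Q (A * X) + S (X * A)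
  let b : 𝔤 → 𝔤 := fun X => S (A * X) + Q (X * A)
  have hT : ∀ X, quadTensor Q S A X = a X * A - A * b X := fun _ => rfl
  have hD : ∀ ξ X Z, τ (X * quadTensorDeriv Q S A ξ Z)
      = τ (X * (a Z * ξ - ξ * b Z)) - τ (Z * (a X * ξ - ξ * b X)) :=
    fun ξ X Z => h.trace_quadTensorDeriv A ξ X Z
  let φ : 𝔤 → 𝔤 → 𝔤 → V := fun X Y Z => τ (A * X * ⁅a Z, a Y⁆) - τ (X * A * ⁅b Z, b Y⁆)
  have hφ : ∀ X Y Z, τ (X * (a Z * (a Y * A - A * b Y) - (a Y * A - A * b Y) * b Z))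
      - τ (X * (a Y * (a Z * A - A * b Z) - (a Z * A - A * b Z) * b Y)) = φ X Y Z := by
    intro X Y Z
    have e1 : ∀ c, τ (X * (c * A)) = τ (A * X * c) := fun c => by
      rw [← mul_assoc, h.trace_comm, mul_assoc]
    have e2 : ∀ c, τ (X * A * c) = τ (X * (A * c)) := fun c => by rw [mul_assoc]
    simp only [φ]
    rw [← e1, e2, ← map_sub, ← map_sub, Ring.lie_def, Ring.lie_def]
    refine congrArg τ ?_
    noncomm_ring
  have hsum : φ X Y Z + φ Y Z X + φ Z X Y = 0 := by
    have ha : ∀ Y Z, ⁅a Z, a Y⁆ = Q (⁅a Z, A * Y⁆ + ⁅A * Z, a Y⁆)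
        + S (⁅b Z, Y * A⁆ + ⁅Z * A, b Y⁆) - ⁅A * Z, A * Y⁆ :=
      fun Y Z => h.lie_add (A * Z) (Z * A) (A * Y) (Y * A)
    have hb : ∀ Y Z, ⁅b Z, b Y⁆ = Q (⁅b Z, Y * A⁆ + ⁅Z * A, b Y⁆)
        + S (⁅a Z, A * Y⁆ + ⁅A * Z, a Y⁆) - ⁅Z * A, Y * A⁆ := fun Y Z => by
      have := h.lie_add (Z * A) (A * Z) (Y * A) (A * Y)
      simp only [add_comm (Q (Z * A)), add_comm (Q (Y * A)), add_comm (S (Z * A)),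
        add_comm (S (Y * A))] at this
      exact this
    have hcub : τ (A * X * ⁅A * Z, A * Y⁆) = τ (X * A * ⁅Z * A, Y * A⁆) := by
      simp only [Ring.lie_def, mul_sub, map_sub]
      congr 1
      · rw [show A * X * (A * Z * (A * Y)) = A * (X * (A * (Z * (A * Y)))) by
          simp only [mul_assoc], h.trace_comm]
        simp only [mul_assoc]
      · rw [show A * X * (A * Y * (A * Z)) = A * (X * (A * (Y * (A * Z)))) by
          simp only [mul_assoc], h.trace_comm]
        simp only [mul_assoc]
    have e : ∀ W1 W2, τ (A * X * (Q W1 + S W2)) - τ (X * A * (Q W2 + S W1))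
        = τ (b X * W2) - τ (a X * W1) := fun W1 W2 => by
      simp only [a, b, mul_add, add_mul, map_add, h.skew, h.symm]
      abel
    have key : φ X Y Z = τ (b X * (⁅b Z, Y * A⁆ + ⁅Z * A, b Y⁆))
        - τ (a X * (⁅a Z, A * Y⁆ + ⁅A * Z, a Y⁆)) := by
      simp only [φ]
      rw [ha, hb, mul_sub, mul_sub, map_sub, map_sub, hcub, sub_sub_sub_cancel_right, e]
    rw [key]
    simp only [φ, mul_add, map_add]
    rw [h.trace_lie (b X) (b Z), h.trace_lie (a X) (a Z), ← h.trace_lie (Z * A) (b Y) (b X),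
      ← h.trace_lie (A * Z) (a Y) (a X)]
    rw [nonUnital_lie_skew (b X) (b Z), nonUnital_lie_skew (a X) (a Z),
      nonUnital_lie_skew (b Y) (b X), nonUnital_lie_skew (a Y) (a X)]
    simp only [mul_neg, map_neg]
    abel
  rw [hD, hD, hD, hT, hT, hT, ← hsum, ← hφ X Y Z, ← hφ Y Z X, ← hφ Z X Y]
  abel

end QuadraticRMatrix

end AbstractBracket

end

section

open Filter Finset.HasAntidiagonal

variable {k : Type*} [Field k] {B : Type*} [CommRing B] [Algebra k B]
  {𝒢 : ℕ → Submodule k B} [SetLike.GradedMonoid 𝒢]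

/-! ### The trace form on operators -/

section Trace

variable [GradedDerivation 𝒢]

open Coeffs

variable (𝒢) in
/-- `f ↦ ∫ f dx` as a linear map. -/
def functionalₗ : Coeffs 𝒢 →ₗ[k] LocalFunctional 𝒢 :=
  Submodule.mkQ (LinearMap.range (Coeffs.D (𝒢 := 𝒢)) ⊔ Submodule.span k {(1 : Coeffs 𝒢)})

theorem functional_eq_iff {f g : Coeffs 𝒢} : functional f = functional g ↔
    ∃ a : Coeffs 𝒢, ∃ c : k, f - g = D a + c • 1 := by
  refine (Submodule.Quotient.eq _).trans ?_
  rw [Submodule.mem_sup]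
  constructor
  · rintro ⟨_, ⟨a, rfl⟩, y, hy, h⟩
    obtain ⟨c, rfl⟩ := Submodule.mem_span_singleton.mp hy
    exact ⟨a, c, h.symm⟩
  · rintro ⟨a, c, h⟩
    exact ⟨_, ⟨a, rfl⟩, _, Submodule.mem_span_singleton.mpr ⟨c, rfl⟩, h.symm⟩

theorem functional_add (f g : Coeffs 𝒢) : functional (f + g) = functional f + functional g :=
  (functionalₗ 𝒢).map_add f g

theorem functional_sub (f g : Coeffs 𝒢) : functional (f - g) = functional f - functional g :=
  (functionalₗ 𝒢).map_sub f g

theorem functional_eq_of_sub_eq_D {f g : Coeffs 𝒢} (a : Coeffs 𝒢) (h : f - g = D a) :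
    functional f = functional g :=
  functional_eq_iff.mpr ⟨a, 0, by rw [h, zero_smul, add_zero]⟩

/-- The bilinear expression with `D (byParts r a b) = a Dʳ b - (-1)ʳ (Dʳ a) b`. -/
def byParts : ℕ → Coeffs 𝒢 → Coeffs 𝒢 → Coeffs 𝒢
  | 0, _, _ => 0
  | r + 1, a, b => a * D^[r] b - byParts r (D a) b

theorem D_byParts (r : ℕ) (a b : Coeffs 𝒢) :
    D (byParts r a b) = a * D^[r] b - (-1 : ℤ) ^ r • (D^[r] a * b) := by
  induction r generalizing a with
  | zero => simp [byParts]
  | succ r ih =>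
    rw [byParts, map_sub, D_mul, ih, Function.iterate_succ_apply' D r b,
      Function.iterate_succ_apply D r a, pow_succ, mul_neg_one, neg_smul]
    abel

theorem byParts_fil {m n : ℕ} (r : ℕ) {a b : Coeffs 𝒢} (ha : a ∈ fil 𝒢 m) (hb : b ∈ fil 𝒢 n) :
    byParts r a b ∈ fil 𝒢 (m + n + r - 1) := by
  induction r generalizing a m with
  | zero => exact zero_mem _
  | succ r ih =>
    refine sub_mem (fil_anti ?_ (fil_mul ha (fil_D_iterate r hb)))
      (fil_anti ?_ (ih (fil_D ha))) <;> omega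

theorem choose_reflect (i : ℤ) (r : ℕ) :
    Ring.choose (-1 + r - i) r = (-1 : ℤ) ^ r * Ring.choose i r := by
  have h := Ring.choose_neg (i + 1 - r) r
  rw [show -(i + 1 - (r : ℤ)) = -1 + r - i by ring, show i + 1 - (r : ℤ) + r - 1 = i by ring] at h
  rw [h, Int.negOnePow_def]
  simp [Units.smul_def]

/-- The residue of a commutator is a total derivative: integrate by parts term by term, and use
`binom(r - 1 - i, r) = (-1)ʳ binom(i, r)`. -/
theorem functional_res_comm {ε : ℤˣ} {P Q : Op 𝒢} (hP : P ∈ opAdm 𝒢 ε) (hQ : Q ∈ opAdm 𝒢 ε) :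
    functional (res (P ⊛ Q)) = functional (res (Q ⊛ P)) := by
  let K : ℤ × ℕ → Coeffs 𝒢 := fun p =>
    Ring.choose p.1 p.2 • byParts p.2 (P p.1) (Q (-1 + p.2 - p.1))
  have hK : LocFin K := by
    refine locFin_mul hP hQ (-1) (fun n i r h => ?_) (fun n i r h => ?_) fun n i r h => ?_
    all_goals
      refine fil_zsmul _ ?_
      rcases Nat.eq_zero_or_pos r with rfl | h0
      · exact zero_mem _
    · exact fil_anti (by omega) (byParts_fil r h (fil_zero _))
    · exact fil_anti (by omega) (byParts_fil r (fil_zero _) h)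
    · exact fil_anti (by omega) (byParts_fil r (fil_zero _) (fil_zero _))
  refine functional_eq_of_sub_eq_D (Coeffs.sum K) ?_
  -- The involution that exchanges the orders `i` and `-1 + r - i` of the two factors.
  let e : ℤ × ℕ ≃ ℤ × ℕ :=
    { toFun := fun p => (-1 + p.2 - p.1, p.2)
      invFun := fun p => (-1 + p.2 - p.1, p.2)
      left_inv := fun p => by ext <;> simp
      right_inv := fun p => by ext <;> simp }
  have h2 := locFin_opMul hQ hP (-1)
  have e2 : res (Q ⊛ P) = Coeffs.sum _ := (sum_equiv e).symm
  rw [D_sum hK, e2]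
  refine (sum_sub (locFin_opMul hP hQ (-1)) (h2.comp_injective e.injective)).symm.trans ?_
  refine sum_congr fun p => ?_
  obtain ⟨i, r⟩ := p
  simp only [K, e, Equiv.coe_fn_mk]
  rw [map_zsmul, D_byParts, choose_reflect, show (-1 : ℤ) + r - (-1 + r - i) = i by ring,
    mul_comm ((-1 : ℤ) ^ r), mul_smul, zsmul_sub, mul_comm (Q _)]

end Trace

/-! ### Positive and negative parts -/

section Parts

open Coeffs

theorem pos_add_neg (P : Op 𝒢) : pos P + neg P = P := by
  funext i
  by_cases h : 0 ≤ i
  · simp [pos, neg, h]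
  · simp [pos, neg, h, not_le.mp h]

theorem pos_pos (P : Op 𝒢) : pos (pos P) = pos P := by
  funext i
  by_cases h : 0 ≤ i <;> simp [pos, h]

theorem neg_neg' (P : Op 𝒢) : neg (neg P) = neg P := by
  funext i
  by_cases h : i < 0 <;> simp [neg, h]

theorem pos_neg (P : Op 𝒢) : pos (neg P) = 0 := by
  funext i
  by_cases h : 0 ≤ i <;> simp [pos, neg, h]

variable (𝒢) in
/-- The projection to the positive part as a linear map. -/
def posₗ : Op 𝒢 →ₗ[k] Op 𝒢 where
  toFun := pos
  map_add' P Q := by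
    funext i
    by_cases h : 0 ≤ i <;> simp [pos, h]
  map_smul' c P := by
    funext i
    by_cases h : 0 ≤ i <;> simp [pos, h]

variable (𝒢) in
/-- The projection to the negative part as a linear map. -/
def negₗ : Op 𝒢 →ₗ[k] Op 𝒢 where
  toFun := neg
  map_add' P Q := by
    funext i
    by_cases h : i < 0 <;> simp [neg, h]
  map_smul' c P := by
    funext i
    by_cases h : i < 0 <;> simp [neg, h]

theorem pos_mem_opAdm {ε : ℤˣ} {P : Op 𝒢} (h : P ∈ opAdm 𝒢 ε) : pos P ∈ opAdm 𝒢 ε := by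
  intro n
  obtain ⟨d, hd⟩ := h n
  refine ⟨d, fun i hi => ?_⟩
  unfold pos
  split_ifs
  exacts [hd i hi, zero_mem _]

theorem neg_mem_opAdm {ε : ℤˣ} {P : Op 𝒢} (h : P ∈ opAdm 𝒢 ε) : neg P ∈ opAdm 𝒢 ε := by
  intro n
  obtain ⟨d, hd⟩ := h n
  refine ⟨d, fun i hi => ?_⟩
  unfold neg
  split_ifs
  exacts [hd i hi, zero_mem _]

theorem pos_mem_opAdm_neg_one (P : Op 𝒢) : pos P ∈ opAdm 𝒢 (-1) := by
  refine fun n => ⟨0, fun i hi => ?_⟩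
  simp only [Units.val_neg, Units.val_one] at hi
  rw [pos, if_neg (by omega)]
  exact zero_mem _

theorem neg_mem_opAdm_one (P : Op 𝒢) : neg P ∈ opAdm 𝒢 1 := by
  refine fun n => ⟨0, fun i hi => ?_⟩
  simp only [Units.val_one] at hi
  rw [neg, if_neg (by omega)]
  exact zero_mem _

theorem pos_mem_opMinusLE {d : ℤ} {P : Op 𝒢} (h : P ∈ opMinusLE 𝒢 d) : pos P ∈ opMinusLE 𝒢 d := by
  intro i hi
  simp [pos, h i hi]

theorem neg_mem_opPlusGE {d : ℤ} {P : Op 𝒢} (h : P ∈ opPlusGE 𝒢 d) : neg P ∈ opPlusGE 𝒢 d := by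
  rw [mem_opPlusGE_iff] at *
  intro i
  unfold neg
  split_ifs
  exacts [h i, zero_mem _]

theorem neg_mem_opMinusLE_neg_one (P : Op 𝒢) : neg P ∈ opMinusLE 𝒢 (-1) := by
  intro i hi
  rw [neg, if_neg (by omega)]

theorem pos_mem_opPlusGE_zero (P : Op 𝒢) : pos P ∈ opPlusGE 𝒢 0 := by
  rw [mem_opPlusGE_iff]
  intro i
  unfold pos
  split_ifs with h
  · rw [show (0 - i).toNat = 0 by omega]; exact fil_zero _
  · exact zero_mem _

variable [GradedDerivation 𝒢]

/-- Positive parts, i.e. differential operators, are closed under multiplication. -/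
theorem neg_pos_opMul_pos (P Q : Op 𝒢) : neg (pos P ⊛ pos Q) = 0 := by
  funext l
  unfold neg
  split_ifs with hl
  · refine (sum_congr fun p => ?_).trans sum_zero
    obtain ⟨i, r⟩ := p
    dsimp only
    by_cases hi : 0 ≤ i
    · by_cases hj : 0 ≤ l + r - i
      · lift i to ℕ using hi
        rw [Ring.choose_natCast, Nat.choose_eq_zero_of_lt (by omega), Nat.cast_zero, zero_zsmul]
      · rw [show pos Q (l + r - i) = 0 from if_neg hj, D_iterate_zero, mul_zero, zsmul_zero]
    · rw [show pos P i = 0 from if_neg hi, zero_mul, zsmul_zero]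
  · rfl

theorem pos_neg_opMul_neg (P Q : Op 𝒢) : pos (neg P ⊛ neg Q) = 0 := by
  funext l
  unfold pos
  split_ifs with hl
  · exact opMul_mem_opMinusLE (neg_mem_opMinusLE_neg_one P) (neg_mem_opMinusLE_neg_one Q) l
      (by omega)
  · rfl

theorem res_pos_opMul_pos (P Q : Op 𝒢) : res (pos P ⊛ pos Q) = 0 := by
  have h := congrFun (neg_pos_opMul_pos P Q) (-1)
  rwa [neg, if_pos (by norm_num)] at h

theorem res_neg_opMul_neg (P Q : Op 𝒢) : res (neg P ⊛ neg Q) = 0 :=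
  opMul_mem_opMinusLE (neg_mem_opMinusLE_neg_one P) (neg_mem_opMinusLE_neg_one Q) (-1)
    (by norm_num)

end Parts

/-! ### The algebra of pairs and its `R`-matrix -/

section Pairs

open Coeffs

namespace opAdm

variable {ε : ℤˣ}

variable (𝒢 ε) in
/-- The projection of admissible operators to the positive part. -/
def posPart : opAdm 𝒢 ε →ₗ[k] opAdm 𝒢 ε :=
  (posₗ 𝒢).restrict fun _ => pos_mem_opAdm

variable (𝒢 ε) in
/-- The projection of admissible operators to the negative part. -/
def negPart : opAdm 𝒢 ε →ₗ[k] opAdm 𝒢 ε :=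
  (negₗ 𝒢).restrict fun _ => neg_mem_opAdm

variable (𝒢) in
/-- `X ↦ X₊`, from operators of the first type to operators of the second type. -/
def toPlus : opAdm 𝒢 1 →ₗ[k] opAdm 𝒢 (-1) :=
  ((posₗ 𝒢).comp (opAdm 𝒢 1).subtype).codRestrict _ fun P => pos_mem_opAdm_neg_one P.1

variable (𝒢) in
/-- `X̂ ↦ X̂₋`, from operators of the second type to operators of the first type. -/
def toMinus : opAdm 𝒢 (-1) →ₗ[k] opAdm 𝒢 1 :=
  ((negₗ 𝒢).comp (opAdm 𝒢 (-1)).subtype).codRestrict _ fun P => neg_mem_opAdm_one P.1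

theorem eq_posPart_add_negPart (x : opAdm 𝒢 ε) : x = posPart 𝒢 ε x + negPart 𝒢 ε x :=
  Subtype.ext (pos_add_neg x.1).symm

theorem negPart_toMinus (x : opAdm 𝒢 (-1)) : negPart 𝒢 1 (toMinus 𝒢 x) = toMinus 𝒢 x :=
  Subtype.ext (neg_neg' x.1)

theorem posPart_toPlus (x : opAdm 𝒢 1) : posPart 𝒢 (-1) (toPlus 𝒢 x) = toPlus 𝒢 x :=
  Subtype.ext (pos_pos x.1)

theorem toPlus_negPart (x : opAdm 𝒢 1) : toPlus 𝒢 (negPart 𝒢 1 x) = 0 :=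
  Subtype.ext (pos_neg x.1)

end opAdm

variable [GradedDerivation 𝒢]

/-- Admissible operators form an associative algebra. Its unit is not needed. -/
instance (ε : ℤˣ) : NonUnitalRing (opAdm 𝒢 ε) :=
  { (inferInstance : AddCommGroup (opAdm 𝒢 ε)) with
    mul := fun P Q => ⟨P.1 ⊛ Q.1, opMul_mem_opAdm P.2 Q.2⟩
    left_distrib := fun P Q R => Subtype.ext (opMul_add P.2 Q.2 R.2)
    right_distrib := fun P Q R => Subtype.ext (add_opMul P.2 Q.2 R.2)
    zero_mul := fun P => Subtype.ext (zero_opMul P.1)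
    mul_zero := fun P => Subtype.ext (opMul_zero P.1)
    mul_assoc := fun P Q R => Subtype.ext (opMul_assoc P.2 Q.2 R.2) }

namespace opAdm

variable {ε : ℤˣ}

theorem negPart_eq_sub (x : opAdm 𝒢 ε) : negPart 𝒢 ε x = x - posPart 𝒢 ε x :=
  eq_sub_of_add_eq' (eq_posPart_add_negPart x).symm

theorem posPart_mul_posPart (x y : opAdm 𝒢 ε) :
    posPart 𝒢 ε (posPart 𝒢 ε x * posPart 𝒢 ε y) = posPart 𝒢 ε x * posPart 𝒢 ε y := by
  refine Subtype.ext ?_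
  have := pos_add_neg (pos x.1 ⊛ pos y.1)
  rw [neg_pos_opMul_pos, add_zero] at this
  exact this

theorem posPart_negPart_mul_negPart (x y : opAdm 𝒢 ε) :
    posPart 𝒢 ε (negPart 𝒢 ε x * negPart 𝒢 ε y) = 0 :=
  Subtype.ext (pos_neg_opMul_neg x.1 y.1)

theorem toMinus_posPart_mul_posPart (x y : opAdm 𝒢 (-1)) :
    toMinus 𝒢 (posPart 𝒢 (-1) x * posPart 𝒢 (-1) y) = 0 :=
  Subtype.ext (neg_pos_opMul_pos x.1 y.1)

theorem toPlus_negPart_mul_negPart (x y : opAdm 𝒢 1) :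
    toPlus 𝒢 (negPart 𝒢 1 x * negPart 𝒢 1 y) = 0 :=
  Subtype.ext (pos_neg_opMul_neg x.1 y.1)

theorem toMinus_negPart_mul_negPart (x y : opAdm 𝒢 (-1)) :
    toMinus 𝒢 (negPart 𝒢 (-1) x * negPart 𝒢 (-1) y) = toMinus 𝒢 x * toMinus 𝒢 y := by
  refine Subtype.ext ?_
  have := pos_add_neg (neg x.1 ⊛ neg y.1)
  rw [pos_neg_opMul_neg, zero_add] at this
  exact this

theorem toPlus_posPart_mul_posPart (x y : opAdm 𝒢 1) :
    toPlus 𝒢 (posPart 𝒢 1 x * posPart 𝒢 1 y) = toPlus 𝒢 x * toPlus 𝒢 y := by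
  refine Subtype.ext ?_
  have := pos_add_neg (pos x.1 ⊛ pos y.1)
  rw [neg_pos_opMul_pos, add_zero] at this
  exact this

theorem toMinus_toPlus_mul (x : opAdm 𝒢 1) (y : opAdm 𝒢 (-1)) :
    toMinus 𝒢 (toPlus 𝒢 x * y) = negPart 𝒢 1 (posPart 𝒢 1 x * toMinus 𝒢 y) := by
  have h : toMinus 𝒢 (toPlus 𝒢 x * posPart 𝒢 (-1) y) = 0 :=
    Subtype.ext (neg_pos_opMul_pos x.1 y.1)
  conv_lhs => rw [eq_posPart_add_negPart y, mul_add, map_add, h, zero_add]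
  rfl

theorem toMinus_mul_toPlus (x : opAdm 𝒢 1) (y : opAdm 𝒢 (-1)) :
    toMinus 𝒢 (y * toPlus 𝒢 x) = negPart 𝒢 1 (toMinus 𝒢 y * posPart 𝒢 1 x) := by
  have h : toMinus 𝒢 (posPart 𝒢 (-1) y * toPlus 𝒢 x) = 0 :=
    Subtype.ext (neg_pos_opMul_pos y.1 x.1)
  conv_lhs => rw [eq_posPart_add_negPart y, add_mul, map_add, h, zero_add]
  rfl

theorem toPlus_toMinus_mul (x : opAdm 𝒢 (-1)) (y : opAdm 𝒢 1) :
    toPlus 𝒢 (toMinus 𝒢 x * y) = posPart 𝒢 (-1) (negPart 𝒢 (-1) x * toPlus 𝒢 y) := by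
  have h : toPlus 𝒢 (toMinus 𝒢 x * negPart 𝒢 1 y) = 0 :=
    Subtype.ext (pos_neg_opMul_neg x.1 y.1)
  conv_lhs => rw [eq_posPart_add_negPart y, mul_add, map_add, h, add_zero]
  rfl

theorem toPlus_mul_toMinus (x : opAdm 𝒢 (-1)) (y : opAdm 𝒢 1) :
    toPlus 𝒢 (y * toMinus 𝒢 x) = posPart 𝒢 (-1) (toPlus 𝒢 y * negPart 𝒢 (-1) x) := by
  have h : toPlus 𝒢 (negPart 𝒢 1 y * toMinus 𝒢 x) = 0 :=
    Subtype.ext (pos_neg_opMul_neg y.1 x.1)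
  conv_lhs => rw [eq_posPart_add_negPart y, add_mul, map_add, h, add_zero]
  rfl

variable (𝒢 ε) in
/-- The involution `X ↦ X₊ - X₋`. -/
def sgn : opAdm 𝒢 ε →ₗ[k] opAdm 𝒢 ε := posPart 𝒢 ε - negPart 𝒢 ε

theorem sgn_apply (x : opAdm 𝒢 ε) : sgn 𝒢 ε x = posPart 𝒢 ε x - negPart 𝒢 ε x := rfl

theorem sgn_eq (x : opAdm 𝒢 ε) : sgn 𝒢 ε x = posPart 𝒢 ε x + posPart 𝒢 ε x - x := by
  rw [sgn_apply, negPart_eq_sub]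
  abel

/-- The modified Yang-Baxter equation for the decomposition into the subalgebras of positive and of
negative operators. -/
theorem lie_sgn (x y : opAdm 𝒢 ε) :
    ⁅sgn 𝒢 ε x, sgn 𝒢 ε y⁆ = sgn 𝒢 ε (⁅sgn 𝒢 ε x, y⁆ + ⁅x, sgn 𝒢 ε y⁆) - ⁅x, y⁆ := by
  have h1 := posPart_mul_posPart x y
  have h2 := posPart_mul_posPart y x
  have h3 := posPart_negPart_mul_negPart x y
  have h4 := posPart_negPart_mul_negPart y x
  have hx := eq_posPart_add_negPart x
  have hy := eq_posPart_add_negPart y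
  rw [sgn_apply x, sgn_apply y]
  generalize posPart 𝒢 ε x = a at *
  generalize negPart 𝒢 ε x = b at *
  generalize posPart 𝒢 ε y = c at *
  generalize negPart 𝒢 ε y = d at *
  subst hx hy
  simp only [sgn_eq, Ring.lie_def, add_mul, mul_add, sub_mul, mul_sub, map_add, map_sub, h1, h2, h3,
    h4]
  abel

/-- `X̂ ↦ 2 X̂₋` is a homomorphism from the Lie bracket defined by `X̂ ↦ X̂₋ - X̂₊` on operators
of the second type to the commutator of operators of the first type. -/
theorem lie_toMinus (x y : opAdm 𝒢 (-1)) :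
    ⁅toMinus 𝒢 x + toMinus 𝒢 x, toMinus 𝒢 y + toMinus 𝒢 y⁆
      = toMinus 𝒢 (⁅-sgn 𝒢 (-1) x, y⁆ + ⁅x, -sgn 𝒢 (-1) y⁆)
        + toMinus 𝒢 (⁅-sgn 𝒢 (-1) x, y⁆ + ⁅x, -sgn 𝒢 (-1) y⁆) := by
  have h1 := toMinus_posPart_mul_posPart x y
  have h2 := toMinus_posPart_mul_posPart y x
  have h3 := toMinus_negPart_mul_negPart x y
  have h4 := toMinus_negPart_mul_negPart y x
  have hx := eq_posPart_add_negPart x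
  have hy := eq_posPart_add_negPart y
  simp only [Ring.lie_def, add_mul, mul_add, ← h3, ← h4]
  rw [sgn_apply x, sgn_apply y]
  clear h3 h4
  generalize posPart 𝒢 _ x = a at *
  generalize negPart 𝒢 _ x = b at *
  generalize posPart 𝒢 _ y = c at *
  generalize negPart 𝒢 _ y = d at *
  subst hx hy
  simp only [add_mul, mul_add, sub_mul, mul_sub, neg_sub, map_add, map_sub, h1, h2]
  abel

/-- `X ↦ 2 X₊` is a homomorphism from the Lie bracket defined by `X ↦ X₊ - X₋` on operators of the
first type to the commutator of operators of the second type. -/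
theorem lie_toPlus (x y : opAdm 𝒢 1) :
    ⁅toPlus 𝒢 x + toPlus 𝒢 x, toPlus 𝒢 y + toPlus 𝒢 y⁆
      = toPlus 𝒢 (⁅sgn 𝒢 1 x, y⁆ + ⁅x, sgn 𝒢 1 y⁆)
        + toPlus 𝒢 (⁅sgn 𝒢 1 x, y⁆ + ⁅x, sgn 𝒢 1 y⁆) := by
  have h1 := toPlus_negPart_mul_negPart x y
  have h2 := toPlus_negPart_mul_negPart y x
  have h3 := toPlus_posPart_mul_posPart x y
  have h4 := toPlus_posPart_mul_posPart y x
  have hx := eq_posPart_add_negPart x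
  have hy := eq_posPart_add_negPart y
  simp only [Ring.lie_def, add_mul, mul_add, ← h3, ← h4]
  rw [sgn_apply x, sgn_apply y]
  clear h3 h4
  generalize posPart 𝒢 _ x = a at *
  generalize negPart 𝒢 _ x = b at *
  generalize posPart 𝒢 _ y = c at *
  generalize negPart 𝒢 _ y = d at *
  subst hx hy
  simp only [add_mul, mul_add, sub_mul, mul_sub, map_add, map_sub, h1, h2]
  abel

theorem lie_sgn_toMinus (x : opAdm 𝒢 1) (y : opAdm 𝒢 (-1)) :
    ⁅sgn 𝒢 1 x, toMinus 𝒢 y + toMinus 𝒢 y⁆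
      = sgn 𝒢 1 ⁅x, toMinus 𝒢 y + toMinus 𝒢 y⁆
        + (toMinus 𝒢 ⁅toPlus 𝒢 x + toPlus 𝒢 x, y⁆ + toMinus 𝒢 ⁅toPlus 𝒢 x + toPlus 𝒢 x, y⁆) := by
  have h1 := toMinus_toPlus_mul x y
  have h2 := toMinus_mul_toPlus x y
  have h3 := posPart_negPart_mul_negPart x (toMinus 𝒢 y)
  have h4 := posPart_negPart_mul_negPart (toMinus 𝒢 y) x
  have hx := eq_posPart_add_negPart x
  rw [negPart_toMinus] at h3 h4
  simp only [Ring.lie_def, add_mul, mul_add, map_add, map_sub, h1, h2,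
    sgn_eq (_ * _), negPart_eq_sub (_ * _)]
  rw [sgn_apply x]
  clear h1 h2
  generalize toMinus 𝒢 y = c at *
  generalize posPart 𝒢 1 x = a at *
  generalize negPart 𝒢 1 x = b at *
  subst hx
  simp only [add_mul, mul_add, sub_mul, mul_sub, map_add, h3, h4]
  abel

theorem lie_sgn_toPlus (x : opAdm 𝒢 (-1)) (y : opAdm 𝒢 1) :
    ⁅-sgn 𝒢 (-1) x, toPlus 𝒢 y + toPlus 𝒢 y⁆
      = -sgn 𝒢 (-1) ⁅x, toPlus 𝒢 y + toPlus 𝒢 y⁆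
        + (toPlus 𝒢 ⁅toMinus 𝒢 x + toMinus 𝒢 x, y⁆ + toPlus 𝒢 ⁅toMinus 𝒢 x + toMinus 𝒢 x, y⁆) := by
  have h1 := toPlus_toMinus_mul x y
  have h2 := toPlus_mul_toMinus x y
  have h3 := posPart_mul_posPart x (toPlus 𝒢 y)
  have h4 := posPart_mul_posPart (toPlus 𝒢 y) x
  have hx := eq_posPart_add_negPart x
  rw [posPart_toPlus] at h3 h4
  simp only [Ring.lie_def, add_mul, mul_add, map_add, map_sub, h1, h2, sgn_eq (_ * _)]
  rw [sgn_apply x]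
  clear h1 h2
  generalize toPlus 𝒢 y = c at *
  generalize posPart 𝒢 (-1) x = a at *
  generalize negPart 𝒢 (-1) x = b at *
  subst hx
  simp only [add_mul, mul_add, neg_mul, mul_neg, sub_mul, mul_sub, map_add, h3, h4]
  abel

variable (𝒢 ε) in
/-- The trace `P ↦ ∫ res P dx`. -/
def trace : opAdm 𝒢 ε →ₗ[k] LocalFunctional 𝒢 :=
  (functionalₗ 𝒢).comp ((LinearMap.proj (-1 : ℤ)).comp (opAdm 𝒢 ε).subtype)

theorem trace_comm (x y : opAdm 𝒢 ε) : trace 𝒢 ε (x * y) = trace 𝒢 ε (y * x) :=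
  functional_res_comm x.2 y.2

theorem trace_posPart_mul_posPart (x y : opAdm 𝒢 ε) :
    trace 𝒢 ε (posPart 𝒢 ε x * posPart 𝒢 ε y) = 0 := by
  change functionalₗ 𝒢 (res (pos x.1 ⊛ pos y.1)) = 0
  rw [res_pos_opMul_pos, map_zero]

theorem trace_negPart_mul_negPart (x y : opAdm 𝒢 ε) :
    trace 𝒢 ε (negPart 𝒢 ε x * negPart 𝒢 ε y) = 0 := by
  change functionalₗ 𝒢 (res (neg x.1 ⊛ neg y.1)) = 0
  rw [res_neg_opMul_neg, map_zero]

theorem trace_sgn_mul (x y : opAdm 𝒢 ε) :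
    trace 𝒢 ε (sgn 𝒢 ε x * y) = -trace 𝒢 ε (x * sgn 𝒢 ε y) := by
  have h1 := trace_posPart_mul_posPart x y
  have h2 := trace_negPart_mul_negPart x y
  have hx := eq_posPart_add_negPart x
  have hy := eq_posPart_add_negPart y
  rw [sgn_apply x, sgn_apply y]
  generalize posPart 𝒢 ε x = a at *
  generalize negPart 𝒢 ε x = b at *
  generalize posPart 𝒢 ε y = c at *
  generalize negPart 𝒢 ε y = d at *
  subst hx hy
  simp only [add_mul, mul_add, sub_mul, mul_sub, map_add, map_sub, h1, h2]
  abel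

theorem trace_toMinus_mul (x : opAdm 𝒢 (-1)) (y : opAdm 𝒢 1) :
    trace 𝒢 1 (toMinus 𝒢 x * y) = trace 𝒢 (-1) (x * toPlus 𝒢 y) := by
  have h1 : trace 𝒢 1 (toMinus 𝒢 x * negPart 𝒢 1 y) = 0 := by
    rw [← negPart_toMinus, trace_negPart_mul_negPart]
  have h2 : trace 𝒢 (-1) (posPart 𝒢 (-1) x * toPlus 𝒢 y) = 0 := by
    rw [← posPart_toPlus, trace_posPart_mul_posPart]
  conv_lhs => rw [eq_posPart_add_negPart y, mul_add, map_add, h1, add_zero]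
  conv_rhs => rw [eq_posPart_add_negPart x, add_mul, map_add, h2, zero_add]
  rfl

end opAdm

open opAdm

variable (𝒢) in
/-- Pairs of admissible operators of the first and of the second type. This algebra contains `𝔇`. -/
abbrev AdmPair : Type _ := opAdm 𝒢 1 × opAdm 𝒢 (-1)

variable (𝒢) in
/-- The trace `(X, X̂) ↦ ∫ res X dx + ∫ res X̂ dx`. -/
def pairTrace : AdmPair 𝒢 →ₗ[k] LocalFunctional 𝒢 := (trace 𝒢 1).coprod (trace 𝒢 (-1))

variable (𝒢) in
/-- The skew part `(X, X̂) ↦ (X₊ - X₋, X̂₋ - X̂₊)` of the `R`-matrix. -/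
def rSkew : AdmPair 𝒢 →ₗ[k] AdmPair 𝒢 := (sgn 𝒢 1).prodMap (-sgn 𝒢 (-1))

variable (𝒢) in
/-- The symmetric part `(X, X̂) ↦ (2 X̂₋, 2 X₊)` of the `R`-matrix. -/
def rSymm : AdmPair 𝒢 →ₗ[k] AdmPair 𝒢 :=
  ((toMinus 𝒢 + toMinus 𝒢).comp (LinearMap.snd k _ _)).prod
    ((toPlus 𝒢 + toPlus 𝒢).comp (LinearMap.fst k _ _))

variable (𝒢) in
theorem quadraticRMatrix : QuadraticRMatrix (pairTrace 𝒢).toAddMonoidHom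
    (rSkew 𝒢).toAddMonoidHom (rSymm 𝒢).toAddMonoidHom where
  trace_comm x y := congrArg₂ (· + ·) (opAdm.trace_comm x.1 y.1) (opAdm.trace_comm x.2 y.2)
  skew x y := by
    change trace 𝒢 1 (sgn 𝒢 1 x.1 * y.1) + trace 𝒢 (-1) (-sgn 𝒢 (-1) x.2 * y.2)
      = -(trace 𝒢 1 (x.1 * sgn 𝒢 1 y.1) + trace 𝒢 (-1) (x.2 * -sgn 𝒢 (-1) y.2))
    rw [neg_mul, mul_neg, map_neg, map_neg, trace_sgn_mul, trace_sgn_mul]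
    abel
  symm x y := by
    change trace 𝒢 1 ((toMinus 𝒢 x.2 + toMinus 𝒢 x.2) * y.1)
        + trace 𝒢 (-1) ((toPlus 𝒢 x.1 + toPlus 𝒢 x.1) * y.2)
      = trace 𝒢 1 (x.1 * (toMinus 𝒢 y.2 + toMinus 𝒢 y.2))
        + trace 𝒢 (-1) (x.2 * (toPlus 𝒢 y.1 + toPlus 𝒢 y.1))
    rw [opAdm.trace_comm (_ + _) y.2, opAdm.trace_comm x.1, mul_add, add_mul, add_mul, mul_add,
      map_add, map_add, map_add, map_add, trace_toMinus_mul, trace_toMinus_mul]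
    abel
  lie_Q_Q x y := by
    refine Prod.ext (lie_sgn x.1 y.1) ?_
    change ⁅-sgn 𝒢 (-1) x.2, -sgn 𝒢 (-1) y.2⁆
      = -sgn 𝒢 (-1) (⁅-sgn 𝒢 (-1) x.2, y.2⁆ + ⁅x.2, -sgn 𝒢 (-1) y.2⁆) - ⁅x.2, y.2⁆
    have := lie_sgn x.2 y.2
    simp only [Ring.lie_def, neg_mul, mul_neg, neg_neg, map_add, map_sub, map_neg] at this ⊢
    rw [this]
    abel
  lie_S_S x y := Prod.ext (lie_toMinus x.2 y.2) (lie_toPlus x.1 y.1)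
  lie_Q_S x y := Prod.ext (lie_sgn_toMinus x.1 y.2) (lie_sgn_toPlus x.2 y.1)

end Pairs

end

section

open Coeffs opAdm

variable {k : Type*} [Field k] {B : Type*} [CommRing B] [Algebra k B]
  {𝒢 : ℕ → Submodule k B} [SetLike.GradedMonoid 𝒢]

/-! ### The algebra `𝔇` inside the algebra of admissible pairs -/

section Lift

variable (𝒢) in
/-- The inclusion of admissible pairs into all pairs of formal operators. -/
def pairVal : AdmPair 𝒢 →ₗ[k] Op 𝒢 × Op 𝒢 where
  toFun x := (x.1.1, x.2.1)
  map_add' _ _ := rfl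
  map_smul' _ _ := rfl

theorem AdmPair.ext_val {x y : AdmPair 𝒢} (h1 : x.1.1 = y.1.1) (h2 : x.2.1 = y.2.1) : x = y :=
  Prod.ext (Subtype.ext h1) (Subtype.ext h2)

variable (𝒢) in
/-- The elements of `𝔇`, as admissible pairs. -/
def admFrakD : Submodule k (AdmPair 𝒢) := (frakD 𝒢).comap (pairVal 𝒢)

variable (𝒢) in
/-- The elements of `𝔇` of order at most `N` and of degree at least `m`, as admissible pairs. -/
def admPart (N m : ℤ) : Submodule k (AdmPair 𝒢) := (frakDPart 𝒢 N m).comap (pairVal 𝒢)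

theorem mem_admFrakD {x : AdmPair 𝒢} :
    x ∈ admFrakD 𝒢 ↔ x.1.1 ∈ opMinus 𝒢 ∧ x.2.1 ∈ opPlus 𝒢 := Iff.rfl

theorem mem_admPart {N m : ℤ} {x : AdmPair 𝒢} :
    x ∈ admPart 𝒢 N m ↔ x.1.1 ∈ opMinusLE 𝒢 N ∧ x.2.1 ∈ opPlusGE 𝒢 m := Iff.rfl

theorem exists_pairVal_eq {X : Op 𝒢 × Op 𝒢} (hX : X ∈ frakD 𝒢) :
    ∃ x ∈ admFrakD 𝒢, pairVal 𝒢 x = X :=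
  ⟨(⟨X.1, opMinus_le_opAdm hX.1⟩, ⟨X.2, opPlus_le_opAdm hX.2⟩), hX, rfl⟩

theorem frakDPart_le_frakD (N m : ℤ) : frakDPart 𝒢 N m ≤ frakD 𝒢 := fun _ h =>
  ⟨⟨N, h.1⟩, ⟨m, h.2⟩⟩

theorem admPart_le_admFrakD (N m : ℤ) : admPart 𝒢 N m ≤ admFrakD 𝒢 := fun _ h =>
  frakDPart_le_frakD N m h

theorem pos_mem_opMinus {P : Op 𝒢} (h : P ∈ opMinus 𝒢) : pos P ∈ opMinus 𝒢 :=
  h.imp fun _ => pos_mem_opMinusLE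

theorem neg_mem_opMinus (P : Op 𝒢) : neg P ∈ opMinus 𝒢 := ⟨-1, neg_mem_opMinusLE_neg_one P⟩

theorem pos_mem_opPlus (P : Op 𝒢) : pos P ∈ opPlus 𝒢 := ⟨0, pos_mem_opPlusGE_zero P⟩

theorem neg_mem_opPlus {P : Op 𝒢} (h : P ∈ opPlus 𝒢) : neg P ∈ opPlus 𝒢 :=
  h.imp fun _ => neg_mem_opPlusGE

theorem Rmat_mem_frakD {X : Op 𝒢 × Op 𝒢} (hX : X ∈ frakD 𝒢) : Rmat X ∈ frakD 𝒢 :=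
  ⟨add_mem (sub_mem (pos_mem_opMinus hX.1) (neg_mem_opMinus _))
      (Submodule.smul_mem _ _ (neg_mem_opMinus _)),
    add_mem (sub_mem (neg_mem_opPlus hX.2) (pos_mem_opPlus _))
      (Submodule.smul_mem _ _ (pos_mem_opPlus _))⟩

theorem RmatAdj_mem_frakD {X : Op 𝒢 × Op 𝒢} (hX : X ∈ frakD 𝒢) : RmatAdj X ∈ frakD 𝒢 :=
  ⟨add_mem (sub_mem (neg_mem_opMinus _) (pos_mem_opMinus hX.1))
      (Submodule.smul_mem _ _ (neg_mem_opMinus _)),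
    add_mem (sub_mem (pos_mem_opPlus _) (neg_mem_opPlus hX.2))
      (Submodule.smul_mem _ _ (pos_mem_opPlus _))⟩

theorem Rmat_pairVal [GradedDerivation 𝒢] (x : AdmPair 𝒢) :
    Rmat (pairVal 𝒢 x) = pairVal 𝒢 (rSkew 𝒢 x + rSymm 𝒢 x) := by
  refine Prod.ext ?_ ?_
  · change pos x.1.1 - neg x.1.1 + (2 : k) • neg x.2.1
      = (pos x.1.1 - neg x.1.1) + (neg x.2.1 + neg x.2.1)
    rw [two_smul]
  · change neg x.2.1 - pos x.2.1 + (2 : k) • pos x.1.1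
      = -(pos x.2.1 - neg x.2.1) + (pos x.1.1 + pos x.1.1)
    rw [two_smul, neg_sub]

theorem RmatAdj_pairVal [GradedDerivation 𝒢] (x : AdmPair 𝒢) :
    RmatAdj (pairVal 𝒢 x) = pairVal 𝒢 (rSymm 𝒢 x - rSkew 𝒢 x) := by
  refine Prod.ext ?_ ?_
  · change neg x.1.1 - pos x.1.1 + (2 : k) • neg x.2.1
      = (neg x.2.1 + neg x.2.1) - (pos x.1.1 - neg x.1.1)
    rw [two_smul]
    abel
  · change pos x.2.1 - neg x.2.1 + (2 : k) • pos x.1.1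
      = (pos x.1.1 + pos x.1.1) - -(pos x.2.1 - neg x.2.1)
    rw [two_smul]
    abel

theorem RmatSkew_pairVal [GradedDerivation 𝒢] [CharZero k] (x : AdmPair 𝒢) :
    RmatSkew (pairVal 𝒢 x) = pairVal 𝒢 (rSkew 𝒢 x) := by
  rw [RmatSkew, Rmat_pairVal, RmatAdj_pairVal, ← map_sub, ← map_smul,
    show rSkew 𝒢 x + rSymm 𝒢 x - (rSymm 𝒢 x - rSkew 𝒢 x) = (2 : k) • rSkew 𝒢 x by
      rw [two_smul]; abel,
    smul_smul, inv_mul_cancel₀ two_ne_zero, one_smul]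

theorem rSymm_mem_admFrakD (x : AdmPair 𝒢) : rSymm 𝒢 x ∈ admFrakD 𝒢 :=
  mem_admFrakD.mpr ⟨add_mem (neg_mem_opMinus _) (neg_mem_opMinus _),
    add_mem (pos_mem_opPlus _) (pos_mem_opPlus _)⟩

theorem posPart_eq_zero_of_order {d : ℤ} (hd : d ≤ -1) {x : opAdm 𝒢 1} (hx : x.1 ∈ opMinusLE 𝒢 d) :
    posPart 𝒢 1 x = 0 := by
  refine Subtype.ext (funext fun i => ?_)
  change (if 0 ≤ i then x.1 i else 0) = 0
  split_ifs with h
  exacts [hx i (by omega), rfl]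

end Lift

section Bracket

variable [GradedDerivation 𝒢]

theorem pairMul_pairVal (x y : AdmPair 𝒢) :
    pairMul (pairVal 𝒢 x) (pairVal 𝒢 y) = pairVal 𝒢 (x * y) := rfl

theorem pairComm_pairVal (x y : AdmPair 𝒢) :
    pairComm (pairVal 𝒢 x) (pairVal 𝒢 y) = pairVal 𝒢 ⁅x, y⁆ := by
  rw [Ring.lie_def, map_sub]
  rfl

theorem pairInner_pairVal (x y : AdmPair 𝒢) :
    pairInner (pairVal 𝒢 x) (pairVal 𝒢 y) = pairTrace 𝒢 (x * y) := rfl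

theorem pairTrace_comm (x y : AdmPair 𝒢) : pairTrace 𝒢 (x * y) = pairTrace 𝒢 (y * x) :=
  (quadraticRMatrix 𝒢).trace_comm x y

theorem pairTrace_rSkew_mul (x y : AdmPair 𝒢) :
    pairTrace 𝒢 (rSkew 𝒢 x * y) = -pairTrace 𝒢 (x * rSkew 𝒢 y) := (quadraticRMatrix 𝒢).skew x y

theorem pairTrace_rSymm_mul (x y : AdmPair 𝒢) :
    pairTrace 𝒢 (rSymm 𝒢 x * y) = pairTrace 𝒢 (x * rSymm 𝒢 y) := (quadraticRMatrix 𝒢).symm x y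

theorem mul_mem_admFrakD {x y : AdmPair 𝒢} (hx : x ∈ admFrakD 𝒢) (hy : y ∈ admFrakD 𝒢) :
    x * y ∈ admFrakD 𝒢 :=
  mem_admFrakD.mpr ⟨opMul_mem_opMinus hx.1 hy.1, opMul_mem_opPlus hx.2 hy.2⟩

theorem rSkew_mem_admFrakD {x : AdmPair 𝒢} (hx : x ∈ admFrakD 𝒢) : rSkew 𝒢 x ∈ admFrakD 𝒢 :=
  mem_admFrakD.mpr ⟨sub_mem (pos_mem_opMinus hx.1) (neg_mem_opMinus _),
    neg_mem (sub_mem (pos_mem_opPlus _) (neg_mem_opPlus hx.2))⟩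

theorem pairInner_Rmat {X Y : Op 𝒢 × Op 𝒢} (hX : X ∈ frakD 𝒢) (hY : Y ∈ frakD 𝒢) :
    pairInner (Rmat X) Y = pairInner X (RmatAdj Y) := by
  obtain ⟨x, -, rfl⟩ := exists_pairVal_eq hX
  obtain ⟨y, -, rfl⟩ := exists_pairVal_eq hY
  rw [Rmat_pairVal, RmatAdj_pairVal, pairInner_pairVal, pairInner_pairVal, add_mul, mul_sub,
    map_add, map_sub, pairTrace_rSkew_mul, pairTrace_rSymm_mul, neg_add_eq_sub]

theorem satisfiesMYBE_Rmat : SatisfiesMYBE (𝒢 := 𝒢) Rmat := by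
  intro X hX Y hY
  obtain ⟨x, -, rfl⟩ := exists_pairVal_eq hX
  obtain ⟨y, -, rfl⟩ := exists_pairVal_eq hY
  have h : ⁅rSkew 𝒢 x + rSymm 𝒢 x, rSkew 𝒢 y + rSymm 𝒢 y⁆
      - (rSkew 𝒢 (⁅rSkew 𝒢 x + rSymm 𝒢 x, y⁆ + ⁅x, rSkew 𝒢 y + rSymm 𝒢 y⁆)
        + rSymm 𝒢 (⁅rSkew 𝒢 x + rSymm 𝒢 x, y⁆ + ⁅x, rSkew 𝒢 y + rSymm 𝒢 y⁆)) = -⁅x, y⁆ :=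
    (quadraticRMatrix 𝒢).lie_Q_add_S x y
  simp only [Rmat_pairVal, pairComm_pairVal, ← map_add, ← map_sub, ← map_neg]
  simp only [← h, map_sub, map_add]

theorem satisfiesMYBE_RmatSkew [CharZero k] : SatisfiesMYBE (𝒢 := 𝒢) RmatSkew := by
  intro X hX Y hY
  obtain ⟨x, -, rfl⟩ := exists_pairVal_eq hX
  obtain ⟨y, -, rfl⟩ := exists_pairVal_eq hY
  have h : ⁅rSkew 𝒢 x, rSkew 𝒢 y⁆ = rSkew 𝒢 (⁅rSkew 𝒢 x, y⁆ + ⁅x, rSkew 𝒢 y⁆) - ⁅x, y⁆ :=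
    (quadraticRMatrix 𝒢).lie_Q_Q x y
  simp only [RmatSkew_pairVal, pairComm_pairVal]
  rw [h, ← map_add, RmatSkew_pairVal, map_sub]
  abel

/-- The quadratic Poisson tensor on admissible pairs. -/
def admTensor (A X : AdmPair 𝒢) : AdmPair 𝒢 :=
  (A.1 * negPart 𝒢 1 (X.1 * A.1) - negPart 𝒢 1 (A.1 * X.1) * A.1
      - A.1 * toMinus 𝒢 (A.2 * X.2) + toMinus 𝒢 (X.2 * A.2) * A.1,
    A.2 * posPart 𝒢 (-1) (X.2 * A.2) - posPart 𝒢 (-1) (A.2 * X.2) * A.2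
      - A.2 * toPlus 𝒢 (A.1 * X.1) + toPlus 𝒢 (X.1 * A.1) * A.2)

theorem admTensor_add_self (A X : AdmPair 𝒢) : admTensor A X + admTensor A X
    = quadTensor (rSkew 𝒢).toAddMonoidHom (rSymm 𝒢).toAddMonoidHom A X := by
  refine Prod.ext ?_ ?_
  · change _ = (sgn 𝒢 1 (A.1 * X.1) + (toMinus 𝒢 (X.2 * A.2) + toMinus 𝒢 (X.2 * A.2))) * A.1
      - A.1 * ((toMinus 𝒢 (A.2 * X.2) + toMinus 𝒢 (A.2 * X.2)) + sgn 𝒢 1 (X.1 * A.1))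
    simp only [admTensor, Prod.fst_add, sgn_eq, negPart_eq_sub, add_mul, sub_mul, mul_add, mul_sub,
      mul_assoc]
    abel
  · change _ = (-sgn 𝒢 (-1) (A.2 * X.2) + (toPlus 𝒢 (X.1 * A.1) + toPlus 𝒢 (X.1 * A.1))) * A.2
      - A.2 * ((toPlus 𝒢 (A.1 * X.1) + toPlus 𝒢 (A.1 * X.1)) + -sgn 𝒢 (-1) (X.2 * A.2))
    simp only [admTensor, Prod.snd_add, sgn_eq, add_mul, sub_mul, mul_add, mul_sub, neg_mul,
      mul_neg, mul_assoc]
    abel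

theorem add_self_injective [CharZero k] {V : Type*} [AddCommGroup V] [Module k V] {x y : V}
    (h : x + x = y + y) : x = y := by
  rw [← two_smul k x, ← two_smul k y] at h
  exact smul_right_injective V (two_ne_zero (α := k)) h

theorem pairTrace_admTensor [CharZero k] (A X Y : AdmPair 𝒢) :
    pairTrace 𝒢 (X * admTensor A Y) = -pairTrace 𝒢 (Y * admTensor A X) := by
  refine add_self_injective (k := k) ?_
  rw [← neg_add, ← map_add, ← map_add, ← mul_add, ← mul_add, admTensor_add_self,
    admTensor_add_self]
  exact (quadraticRMatrix 𝒢).trace_quadTensor A X Y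

theorem quadBracket_pairVal [CharZero k] (A X Y : AdmPair 𝒢) :
    quadBracket (pairVal 𝒢 A) (pairVal 𝒢 X) (pairVal 𝒢 Y) = pairTrace 𝒢 (X * admTensor A Y) := by
  have h : pairTrace 𝒢 (⁅A, X⁆ * (rSkew 𝒢 (A * Y + Y * A) + rSymm 𝒢 (A * Y + Y * A)))
      - pairTrace 𝒢 (⁅A, Y⁆ * (rSkew 𝒢 (A * X + X * A) + rSymm 𝒢 (A * X + X * A)))
      = pairTrace 𝒢 (X * quadTensor (rSkew 𝒢).toAddMonoidHom (rSymm 𝒢).toAddMonoidHom A Y)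
        + pairTrace 𝒢 (X * quadTensor (rSkew 𝒢).toAddMonoidHom (rSymm 𝒢).toAddMonoidHom A Y) :=
    (quadraticRMatrix 𝒢).trace_lie_quadratic A X Y
  rw [← admTensor_add_self, mul_add X, map_add _ (X * _)] at h
  simp only [quadBracket, pairComm_pairVal, pairMul_pairVal, ← map_add, Rmat_pairVal,
    pairInner_pairVal]
  rw [h, ← two_smul k (pairTrace 𝒢 (X * admTensor A Y)), ← add_smul, smul_smul,
    show (4⁻¹ : k) * (2 + 2) = 1 by norm_num, one_smul]

theorem admTensor_mem_admFrakD {A X : AdmPair 𝒢} (hA : A ∈ admFrakD 𝒢) :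
    admTensor A X ∈ admFrakD 𝒢 := by
  refine mem_admFrakD.mpr ⟨?_, ?_⟩
  · have h := (mem_admFrakD.mp hA).1
    exact add_mem (sub_mem (sub_mem (opMul_mem_opMinus h (neg_mem_opMinus _))
      (opMul_mem_opMinus (neg_mem_opMinus _) h)) (opMul_mem_opMinus h (neg_mem_opMinus _)))
      (opMul_mem_opMinus (neg_mem_opMinus _) h)
  · have h := (mem_admFrakD.mp hA).2
    exact add_mem (sub_mem (sub_mem (opMul_mem_opPlus h (pos_mem_opPlus _))
      (opMul_mem_opPlus (pos_mem_opPlus _) h)) (opMul_mem_opPlus h (pos_mem_opPlus _)))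
      (opMul_mem_opPlus (pos_mem_opPlus _) h)

theorem opMul_neg_mem_opMinusLE {N : ℤ} {P : Op 𝒢} (hP : P ∈ opMinusLE 𝒢 N) (Q : Op 𝒢) :
    P ⊛ neg Q ∈ opMinusLE 𝒢 N := fun i hi =>
  opMul_mem_opMinusLE hP (neg_mem_opMinusLE_neg_one Q) i (by omega)

theorem neg_opMul_mem_opMinusLE {N : ℤ} {P : Op 𝒢} (hP : P ∈ opMinusLE 𝒢 N) (Q : Op 𝒢) :
    neg Q ⊛ P ∈ opMinusLE 𝒢 N := fun i hi =>
  opMul_mem_opMinusLE (neg_mem_opMinusLE_neg_one Q) hP i (by omega)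

theorem opMul_pos_mem_opPlusGE {m : ℤ} {P : Op 𝒢} (hP : P ∈ opPlusGE 𝒢 m) (Q : Op 𝒢) :
    P ⊛ pos Q ∈ opPlusGE 𝒢 m := by
  simpa using opMul_mem_opPlusGE hP (pos_mem_opPlusGE_zero Q)

theorem pos_opMul_mem_opPlusGE {m : ℤ} {P : Op 𝒢} (hP : P ∈ opPlusGE 𝒢 m) (Q : Op 𝒢) :
    pos Q ⊛ P ∈ opPlusGE 𝒢 m := by
  simpa using opMul_mem_opPlusGE (pos_mem_opPlusGE_zero Q) hP

theorem admTensor_mem_admPart {N m : ℤ} {A : AdmPair 𝒢} (hA : A ∈ admPart 𝒢 N m) (X : AdmPair 𝒢) :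
    admTensor A X ∈ admPart 𝒢 N m := by
  refine mem_admPart.mpr ⟨?_, ?_⟩
  · have h := (mem_admPart.mp hA).1
    exact add_mem (sub_mem (sub_mem (opMul_neg_mem_opMinusLE h _) (neg_opMul_mem_opMinusLE h _))
      (opMul_neg_mem_opMinusLE h _)) (neg_opMul_mem_opMinusLE h _)
  · have h := (mem_admPart.mp hA).2
    exact add_mem (sub_mem (sub_mem (opMul_pos_mem_opPlusGE h _) (pos_opMul_mem_opPlusGE h _))
      (opMul_pos_mem_opPlusGE h _)) (pos_opMul_mem_opPlusGE h _)

theorem admTensor_add (A X Y : AdmPair 𝒢) :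
    admTensor A (X + Y) = admTensor A X + admTensor A Y := by
  refine Prod.ext ?_ ?_ <;>
  · simp only [admTensor, Prod.fst_add, Prod.snd_add, add_mul, mul_add, map_add]
    abel

theorem toPlus_posPart (x : opAdm 𝒢 1) : toPlus 𝒢 (posPart 𝒢 1 x) = toPlus 𝒢 x := by
  conv_rhs => rw [eq_posPart_add_negPart x, map_add, toPlus_negPart, add_zero]

/-- Covectors of order at most `-N - 2`, which are dual to the coefficients of order above `N`,
lie in the kernel of the tensor: their products with `A` are purely negative. -/
theorem admTensor_eq_zero_of_order {N m : ℤ} {A : AdmPair 𝒢} (hA : A ∈ admPart 𝒢 N m)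
    {Z : opAdm 𝒢 1} (hZ : Z.1 ∈ opMinusLE 𝒢 (-N - 2)) : admTensor A (Z, 0) = 0 := by
  have h1 : posPart 𝒢 1 (A.1 * Z) = 0 :=
    posPart_eq_zero_of_order (by omega) (opMul_mem_opMinusLE (mem_admPart.mp hA).1 hZ)
  have h2 : posPart 𝒢 1 (Z * A.1) = 0 :=
    posPart_eq_zero_of_order (by omega) (opMul_mem_opMinusLE hZ (mem_admPart.mp hA).1)
  have h3 : toPlus 𝒢 (A.1 * Z) = 0 := by rw [← toPlus_posPart, h1, map_zero]
  have h4 : toPlus 𝒢 (Z * A.1) = 0 := by rw [← toPlus_posPart, h2, map_zero]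
  refine Prod.ext ?_ ?_
  · change A.1 * negPart 𝒢 1 (Z * A.1) - negPart 𝒢 1 (A.1 * Z) * A.1
      - A.1 * toMinus 𝒢 (A.2 * 0) + toMinus 𝒢 (0 * A.2) * A.1 = 0
    rw [negPart_eq_sub, negPart_eq_sub, h1, h2]
    simp [mul_assoc]
  · change A.2 * posPart 𝒢 (-1) (0 * A.2) - posPart 𝒢 (-1) (A.2 * 0) * A.2
      - A.2 * toPlus 𝒢 (A.1 * Z) + toPlus 𝒢 (Z * A.1) * A.2 = 0
    rw [h3, h4]
    simp

end Bracket

end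

section

open Coeffs Filter Finset.HasAntidiagonal

variable {k : Type*} [Field k]

/-! ### Partial derivatives of differential functions -/

section Jets

theorem coeffDer_apply {σ O : Type*} [CommRing O] [Algebra k O] (δ : Derivation k O O)
    (b : MvPolynomial σ O) : coeffDer δ b = coeffDerFun δ b := rfl

theorem coeffDer_C {σ O : Type*} [CommRing O] [Algebra k O] (δ : Derivation k O O) (c : O) :
    coeffDer δ (MvPolynomial.C c : MvPolynomial σ O) = MvPolynomial.C (δ c) := by
  classical
  ext m
  rw [coeffDer_apply, coeff_coeffDerFun, MvPolynomial.coeff_C, MvPolynomial.coeff_C]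
  split_ifs
  exacts [rfl, map_zero _]

theorem coeffDer_X {σ O : Type*} [CommRing O] [Algebra k O] (δ : Derivation k O O) (i : σ) :
    coeffDer δ (MvPolynomial.X i : MvPolynomial σ O) = 0 := by
  classical
  ext m
  rw [coeffDer_apply, coeff_coeffDerFun, MvPolynomial.coeff_X, MvPolynomial.coeff_zero]
  split_ifs
  exacts [δ.map_one_eq_zero, map_zero _]

theorem coeffDer_pderiv {σ O : Type*} [CommRing O] [Algebra k O] (δ : Derivation k O O) (i : σ)
    (b : MvPolynomial σ O) :
    coeffDer δ (MvPolynomial.pderiv i b) = MvPolynomial.pderiv i (coeffDer δ b) := by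
  ext m
  rw [coeffDer_apply, coeff_coeffDerFun, MvPolynomial.coeff_pderiv, MvPolynomial.coeff_pderiv,
    coeffDer_apply, coeff_coeffDerFun, Derivation.leibniz]
  have h : δ ((m i : O) + 1) = 0 := by
    rw [map_add, δ.map_natCast, δ.map_one_eq_zero, add_zero]
  rw [h, smul_zero, zero_add, smul_eq_mul, mul_comm]

theorem pderiv_comm {σ O : Type*} [CommRing O] (i j : σ) (b : MvPolynomial σ O) :
    MvPolynomial.pderiv i (MvPolynomial.pderiv j b)
      = MvPolynomial.pderiv j (MvPolynomial.pderiv i b) := by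
  rcases eq_or_ne i j with rfl | h
  · rfl
  · ext m
    simp only [MvPolynomial.coeff_pderiv, Finsupp.add_apply, Finsupp.single_eq_of_ne h,
      Finsupp.single_eq_of_ne h.symm]
    rw [add_right_comm]
    push_cast
    ring

variable {J : Type*} {w : J → ℕ} {O : Type*} [CommRing O] [Algebra k O]
  [CoordinateAlgebra k (JetZero w) O]

theorem jetPd_comm (p q : J × ℕ) (b : DiffPoly w O) :
    jetPd k w O p (jetPd k w O q b) = jetPd k w O q (jetPd k w O p b) := by
  by_cases hp : jetDeg w p = 0 <;> by_cases hq : jetDeg w q = 0 <;>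
    simp only [jetPd, hp, hq, dite_true, dite_false]
  · ext m
    simp only [coeffDer_apply, coeff_coeffDerFun]
    exact CoordinateAlgebra.pd_comm _ _ _
  · exact coeffDer_pderiv _ _ _
  · exact (coeffDer_pderiv _ _ _).symm
  · exact pderiv_comm _ _ _

theorem jetPd_jet_self (p : J × ℕ) : jetPd k w O p (jet k w O p) = 1 := by
  by_cases hp : jetDeg w p = 0
  · simp only [jetPd, jet, hp, dite_true]
    rw [coeffDer_C, CoordinateAlgebra.pd_coord_self, MvPolynomial.C_1]
  · simp only [jetPd, jet, hp, dite_false]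
    exact MvPolynomial.pderiv_X_self _

theorem jetPd_jet_of_ne {p q : J × ℕ} (h : p ≠ q) : jetPd k w O p (jet k w O q) = 0 := by
  by_cases hp : jetDeg w p = 0 <;> by_cases hq : jetDeg w q = 0 <;>
    simp only [jetPd, jet, hp, hq, dite_true, dite_false]
  · rw [coeffDer_C, CoordinateAlgebra.pd_coord_of_ne, map_zero]
    exact fun h' => h (congrArg Subtype.val h')
  · exact coeffDer_X _ _
  · exact MvPolynomial.pderiv_C
  · exact MvPolynomial.pderiv_X_of_ne fun h' => h (congrArg Subtype.val h').symm

variable (k w O) in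
/-- The partial derivative with respect to a jet variable as a linear map. -/
def partialₗ (p : J × ℕ) : DiffFun k w O →ₗ[k] DiffFun k w O where
  toFun := partialFun k w O p
  map_add' f g := ext_comp fun n => by simp [partialFun]
  map_smul' c f := ext_comp fun n => by simp [partialFun]

@[simp] theorem comp_partialₗ (p : J × ℕ) (n : ℕ) (f : DiffFun k w O) :
    comp n (partialₗ k w O p f) = jetPd k w O p (comp (n + jetDeg w p) f) := by
  change comp n (partialFun k w O p f) = _
  simp [partialFun]

/-- If the components of `f` of degree less than `n` do not depend on the jet variable `p`, then
`∂f/∂p` vanishes below degree `n - deg p`. -/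
theorem partialₗ_mem_fil {p : J × ℕ} {n : ℕ} {f : DiffFun k w O}
    (h : ∀ l < n, jetPd k w O p (comp l f) = 0) :
    partialₗ k w O p f ∈ fil _ (n - jetDeg w p) := fun l hl => by
  rw [comp_partialₗ]
  exact h _ (by omega)

theorem mul_partialₗ_mem_fil {p : J × ℕ} {n : ℕ} {f v : DiffFun k w O}
    (hv : v ∈ fil _ (jetDeg w p)) (h : ∀ l < n, jetPd k w O p (comp l f) = 0) :
    v * partialₗ k w O p f ∈ fil _ n :=
  fil_anti (by omega) (fil_mul hv (partialₗ_mem_fil h))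

theorem eventually_jetPd_eq_zero (f : DiffFun k w O) (n : ℕ) :
    ∀ᶠ p in cofinite, ∀ l < n, jetPd k w O p (comp l f) = 0 := by
  refine ((Set.finite_Iio n).biUnion fun l _ => jetPd_finite k w O (comp l f)).subset ?_
  intro p hp
  change ¬ ∀ l < n, _ at hp
  push Not at hp
  obtain ⟨l, hl, h⟩ := hp
  exact Set.mem_biUnion hl h

theorem Cont.partialₗ (p : J × ℕ) : Cont (partialₗ k w O p) := fun n =>
  ⟨n + jetDeg w p, fun f hf => fil_anti (by omega) (partialₗ_mem_fil (n := n + jetDeg w p)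
    fun l hl => by rw [hf l hl, map_zero])⟩

/-- Sums over the antidiagonal of `n + d` whose terms vanish for `b < d`. -/
theorem sum_antidiagonal_add_right {M : Type*} [AddCommMonoid M] (n d : ℕ) (F : ℕ → ℕ → M)
    (hF : ∀ a b, b < d → F a b = 0) :
    ∑ x ∈ antidiagonal (n + d), F x.1 x.2 = ∑ x ∈ antidiagonal n, F x.1 (x.2 + d) := by
  symm
  refine Finset.sum_of_injOn (fun x => (x.1, x.2 + d)) ?_ ?_ ?_ fun _ _ => rfl
  · intro x _ y _ h
    simp only [Prod.mk.injEq, add_left_inj] at h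
    exact Prod.ext h.1 h.2
  · intro x hx
    simp only [Finset.mem_coe, mem_antidiagonal] at hx ⊢
    omega
  · intro x hx hx'
    refine hF _ _ (by_contra fun h => hx' ⟨(x.1, x.2 - d), ?_, ?_⟩)
    · simp only [Finset.mem_coe, mem_antidiagonal] at hx ⊢
      omega
    · ext
      · rfl
      · simp only
        omega

theorem sum_antidiagonal_add_left {M : Type*} [AddCommMonoid M] (n d : ℕ) (F : ℕ → ℕ → M)
    (hF : ∀ a b, a < d → F a b = 0) :
    ∑ x ∈ antidiagonal (n + d), F x.1 x.2 = ∑ x ∈ antidiagonal n, F (x.1 + d) x.2 := by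
  rw [← Finset.Nat.sum_antidiagonal_swap, ← Finset.Nat.sum_antidiagonal_swap (n := n)]
  exact sum_antidiagonal_add_right n d (fun a b => F b a) fun a b => hF b a

theorem partialₗ_mul (p : J × ℕ) (f g : DiffFun k w O) :
    partialₗ k w O p (f * g) = f * partialₗ k w O p g + partialₗ k w O p f * g := by
  refine ext_comp fun n => ?_
  have h1 := sum_antidiagonal_add_right n (jetDeg w p)
    (fun a b => comp a f * jetPd k w O p (comp b g)) fun a b hb => by
      rw [jetPd_eq_zero k w O p b (comp b g) (g.2 b) hb, mul_zero]
  have h2 := sum_antidiagonal_add_left n (jetDeg w p)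
    (fun a b => comp b g * jetPd k w O p (comp a f)) fun a b ha => by
      rw [jetPd_eq_zero k w O p a (comp a f) (f.2 a) ha, mul_zero]
  rw [comp_partialₗ, comp_mul, _root_.map_sum, comp_add, comp_mul, comp_mul]
  simp only [Derivation.leibniz, comp_partialₗ, Finset.sum_add_distrib, smul_eq_mul]
  rw [h1, h2]
  exact congrArg _ (Finset.sum_congr rfl fun x _ => mul_comm _ _)

theorem partialₗ_comm (p q : J × ℕ) (f : DiffFun k w O) :
    partialₗ k w O p (partialₗ k w O q f) = partialₗ k w O q (partialₗ k w O p f) :=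
  ext_comp fun n => by
    simp only [comp_partialₗ]
    rw [jetPd_comm, add_right_comm]

theorem comp_jetFun (n : ℕ) (p : J × ℕ) :
    comp n (jetFun k w O p) = if n = jetDeg w p then jet k w O p else 0 := by
  simp [jetFun, ofHomogeneous]

theorem jetFun_mem_fil (p : J × ℕ) : jetFun k w O p ∈ fil _ (jetDeg w p) := fun l hl => by
  rw [comp_jetFun, if_neg hl.ne]

theorem comp_jetFun_mul (n : ℕ) (p : J × ℕ) (f : DiffFun k w O) :
    comp n (jetFun k w O p * f)
      = if jetDeg w p ≤ n then jet k w O p * comp (n - jetDeg w p) f else 0 := by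
  rw [comp_mul]
  split_ifs with h
  · rw [Finset.sum_eq_single (jetDeg w p, n - jetDeg w p)]
    · rw [comp_jetFun, if_pos rfl]
    · intro x hx hne
      rw [mem_antidiagonal] at hx
      rw [comp_jetFun, if_neg, zero_mul]
      intro h1
      exact hne (Prod.ext h1 (by simp only; omega))
    · intro h1
      exact absurd (mem_antidiagonal.mpr (by simp only; omega)) h1
  · refine Finset.sum_eq_zero fun x hx => ?_
    rw [mem_antidiagonal] at hx
    rw [comp_jetFun, if_neg (by omega), zero_mul]

theorem partialₗ_jetFun_self (p : J × ℕ) : partialₗ k w O p (jetFun k w O p) = 1 :=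
  ext_comp fun n => by
    rw [comp_partialₗ, comp_jetFun]
    cases n with
    | zero => rw [if_pos (by omega), jetPd_jet_self, comp_one_zero]
    | succ n => rw [if_neg (by omega), map_zero, comp_one_succ]

theorem partialₗ_jetFun_of_ne {p q : J × ℕ} (h : p ≠ q) :
    partialₗ k w O p (jetFun k w O q) = 0 :=
  ext_comp fun n => by
    rw [comp_partialₗ, comp_jetFun]
    split_ifs
    · rw [jetPd_jet_of_ne h, comp_zero]
    · rw [map_zero, comp_zero]

theorem partialₗ_one (p : J × ℕ) : partialₗ k w O p 1 = 0 := by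
  have h := partialₗ_mul p (1 : DiffFun k w O) 1
  rw [mul_one, one_mul, mul_one] at h
  exact left_eq_add.mp h

/-! ### Vector fields on the jet space -/

variable (k w O) in
/-- Coefficients `(v_p)` of a formal vector field `∑ v_p ∂/∂p` that does not lower the degree. -/
def jetFields : Submodule k (J × ℕ → DiffFun k w O) where
  carrier := {v | ∀ p, v p ∈ fil _ (jetDeg w p)}
  zero_mem' := fun _ => zero_mem _
  add_mem' := fun h1 h2 p => add_mem (h1 p) (h2 p)
  smul_mem' := fun c _ h p => Submodule.smul_mem _ c (h p)

theorem locFin_jetField {v : J × ℕ → DiffFun k w O} (hv : v ∈ jetFields k w O)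
    (f : DiffFun k w O) : LocFin fun p => v p * partialₗ k w O p f := fun n =>
  (eventually_jetPd_eq_zero f n).mono fun p hp => mul_partialₗ_mem_fil (hv p) hp

/-- The action of the vector field `∑ v_p ∂/∂p` on differential functions. -/
def fieldDer (v : jetFields k w O) : DiffFun k w O →ₗ[k] DiffFun k w O where
  toFun f := Coeffs.sum fun p => v.1 p * partialₗ k w O p f
  map_add' f g := by
    rw [← sum_add (locFin_jetField v.2 f) (locFin_jetField v.2 g)]
    exact sum_congr fun p => by rw [map_add, mul_add]
  map_smul' c f := by
    rw [RingHom.id_apply, ← sum_smul c (locFin_jetField v.2 f)]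
    exact sum_congr fun p => by rw [map_smul, mul_smul_comm]

theorem fieldDer_apply (v : jetFields k w O) (f : DiffFun k w O) :
    fieldDer v f = Coeffs.sum fun p => v.1 p * partialₗ k w O p f := rfl

theorem fieldDer_mem_fil (v : jetFields k w O) {n : ℕ} {f : DiffFun k w O} (hf : f ∈ fil _ n) :
    fieldDer v f ∈ fil _ n :=
  fil_sum fun p => mul_partialₗ_mem_fil (v.2 p) fun l hl => by rw [hf l hl, map_zero]

theorem Cont.fieldDer (v : jetFields k w O) : Cont (fieldDer v) :=
  Cont.of_filtered fun _ _ => fieldDer_mem_fil v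

theorem fieldDer_mul (v : jetFields k w O) (f g : DiffFun k w O) :
    fieldDer v (f * g) = f * fieldDer v g + fieldDer v f * g := by
  have h1 := locFin_jetField v.2 g
  have h2 := locFin_jetField v.2 f
  simp only [fieldDer_apply]
  rw [mul_sum _ h1, sum_mul _ h2, ← sum_add (h1.mul_left _) (h2.mul_right _)]
  refine sum_congr fun p => ?_
  rw [partialₗ_mul]
  ring

theorem fieldDer_jetFun (v : jetFields k w O) (p : J × ℕ) :
    fieldDer v (jetFun k w O p) = v.1 p := by
  rw [fieldDer_apply, sum_eq_single p, partialₗ_jetFun_self, mul_one]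
  intro q hq
  rw [partialₗ_jetFun_of_ne hq, mul_zero]

/-- The commutator of two vector fields. -/
def fieldLie (v u : jetFields k w O) : jetFields k w O :=
  ⟨fun p => fieldDer v (u.1 p) - fieldDer u (v.1 p), fun p =>
    sub_mem (fieldDer_mem_fil v (u.2 p)) (fieldDer_mem_fil u (v.2 p))⟩

theorem locFin_jetField₂ (v u : jetFields k w O) (f : DiffFun k w O) :
    LocFin fun x : (J × ℕ) × (J × ℕ) =>
      u.1 x.1 * (v.1 x.2 * partialₗ k w O x.2 (partialₗ k w O x.1 f)) := by
  intro n
  refine ((Set.finite_Iio n).biUnion fun l _ => (jetPd_finite k w O (comp l f)).biUnion fun q _ =>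
    (jetPd_finite k w O (jetPd k w O q (comp l f))).image (Prod.mk q)).subset ?_
  rintro ⟨q, p⟩ hx
  by_contra hcon
  have h0 : ∀ l < n, jetPd k w O p (jetPd k w O q (comp l f)) = 0 := by
    intro l hl
    by_contra h
    refine hcon (Set.mem_biUnion hl (Set.mem_biUnion ?_ ⟨p, h, rfl⟩))
    intro h'
    exact h (by rw [h', map_zero])
  refine hx (fil_anti ?_ (fil_mul (u.2 q) (mul_partialₗ_mem_fil (n := n - jetDeg w q) (v.2 p)
    fun l hl => ?_)))
  · omega
  · rw [comp_partialₗ]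
    exact h0 (l + jetDeg w q) (by omega)

theorem fieldDer_fieldDer (v u : jetFields k w O) (f : DiffFun k w O) :
    fieldDer v (fieldDer u f) = (Coeffs.sum fun x : (J × ℕ) × (J × ℕ) =>
        u.1 x.1 * (v.1 x.2 * partialₗ k w O x.2 (partialₗ k w O x.1 f)))
      + Coeffs.sum fun p => fieldDer v (u.1 p) * partialₗ k w O p f := by
  have h0 := locFin_jetField u.2 f
  have h1 := locFin_jetField₂ v u f
  have h2 := locFin_jetField (v := fun p => fieldDer v (u.1 p))
    (fun p => fieldDer_mem_fil v (u.2 p)) f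
  rw [fieldDer_apply u, map_sum (Cont.fieldDer v) h0, sum_prod h1, ← sum_add h1.sum_fst h2]
  refine sum_congr fun q => ?_
  rw [fieldDer_mul, fieldDer_apply v (partialₗ k w O q f), mul_sum _ (locFin_jetField v.2 _)]

theorem fieldDer_lie (v u : jetFields k w O) (f : DiffFun k w O) :
    fieldDer v (fieldDer u f) - fieldDer u (fieldDer v f) = fieldDer (fieldLie v u) f := by
  have hs : (Coeffs.sum fun x : (J × ℕ) × (J × ℕ) =>
        u.1 x.1 * (v.1 x.2 * partialₗ k w O x.2 (partialₗ k w O x.1 f)))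
      = Coeffs.sum fun x : (J × ℕ) × (J × ℕ) =>
        v.1 x.1 * (u.1 x.2 * partialₗ k w O x.2 (partialₗ k w O x.1 f)) := by
    rw [← sum_equiv (Equiv.prodComm _ _)]
    refine sum_congr fun x => ?_
    rw [Equiv.prodComm_apply, Prod.fst_swap, Prod.snd_swap, partialₗ_comm]
    ring
  rw [fieldDer_fieldDer, fieldDer_fieldDer, hs, add_sub_add_left_eq_sub, fieldDer_apply,
    ← sum_sub]
  · exact sum_congr fun p => by rw [fieldLie, sub_mul]
  · exact locFin_jetField (v := fun p => fieldDer v (u.1 p)) (fun p => fieldDer_mem_fil v (u.2 p)) f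
  · exact locFin_jetField (v := fun p => fieldDer u (v.1 p)) (fun p => fieldDer_mem_fil u (v.2 p)) f

variable (k w O) in
/-- The total derivative as a vector field. -/
def totalField : jetFields k w O :=
  ⟨fun p => jetFun k w O (p.1, p.2 + 1), fun p =>
    fil_anti (by simp only [jetDeg]; omega) (jetFun_mem_fil (p.1, p.2 + 1))⟩

theorem D_eq_fieldDer (f : DiffFun k w O) : D f = fieldDer (totalField k w O) f := by
  refine ext_comp fun n => ?_
  rw [fieldDer_apply, comp_sum]
  cases n with
  | zero =>
    rw [comp_D_zero]
    refine (finsum_eq_zero_of_forall_eq_zero fun p => ?_).symm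
    rw [totalField, comp_jetFun_mul, if_neg]
    simp only [jetDeg]
    omega
  | succ n =>
    rw [comp_D_succ]
    change (∑ᶠ p : J × ℕ, jet k w O (p.1, p.2 + 1) * jetPd k w O p (comp n f)) = _
    refine finsum_congr fun p => ?_
    rw [totalField, comp_jetFun_mul, comp_partialₗ]
    have hd : jetDeg w (p.1, p.2 + 1) = jetDeg w p + 1 := by simp only [jetDeg]; omega
    by_cases h : jetDeg w p ≤ n
    · rw [if_pos (by omega), show n + 1 - jetDeg w (p.1, p.2 + 1) + jetDeg w p = n by omega]
    · rw [if_neg (by omega), jetPd_eq_zero k w O p n (comp n f) (f.2 n) (by omega), mul_zero]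

/-- `∂/∂u^{(s)}` commutes with `D` up to `∂/∂u^{(s-1)}`. -/
theorem partialₗ_D (j : J) (s : ℕ) (f : DiffFun k w O) :
    partialₗ k w O (j, s) (D f) = D (partialₗ k w O (j, s) f)
      + Nat.casesOn s 0 fun r => partialₗ k w O (j, r) f := by
  have h1 := locFin_jetField (totalField k w O).2 (partialₗ k w O (j, s) f)
  have h2 : LocFin fun q : J × ℕ =>
      partialₗ k w O (j, s) (jetFun k w O (q.1, q.2 + 1)) * partialₗ k w O q f := by
    intro n
    refine (Set.finite_singleton (j, s - 1)).subset fun q hq => ?_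
    by_contra hne
    refine hq ?_
    change partialₗ k w O (j, s) (jetFun k w O (q.1, q.2 + 1)) * partialₗ k w O q f ∈ fil _ n
    rw [partialₗ_jetFun_of_ne, zero_mul]
    · exact zero_mem _
    · intro h
      obtain ⟨rfl, rfl⟩ := Prod.mk.inj h
      exact hne rfl
  have h3 : (Coeffs.sum fun q : J × ℕ =>
      partialₗ k w O (j, s) (jetFun k w O (q.1, q.2 + 1)) * partialₗ k w O q f)
      = Nat.casesOn s 0 fun r => partialₗ k w O (j, r) f := by
    cases s with
    | zero =>
      refine (sum_congr fun q => ?_).trans sum_zero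
      rw [partialₗ_jetFun_of_ne (by simp), zero_mul]
    | succ r =>
      rw [sum_eq_single (j, r), partialₗ_jetFun_self, one_mul]
      rintro ⟨i, t⟩ hne
      rw [partialₗ_jetFun_of_ne, zero_mul]
      intro h
      obtain ⟨rfl, h'⟩ := Prod.mk.inj h
      exact hne (by rw [Nat.succ.inj h'])
  rw [D_eq_fieldDer, fieldDer_apply,
    map_sum (Cont.partialₗ (j, s)) (locFin_jetField (totalField k w O).2 f), ← h3,
    D_eq_fieldDer (partialₗ k w O (j, s) f), fieldDer_apply, ← sum_add h1 h2]
  refine sum_congr fun q => ?_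
  rw [partialₗ_mul, partialₗ_comm]
  rfl

/-! ### Evolutionary vector fields and variational derivatives -/

variable (k w O) in
/-- Characteristics of evolutionary vector fields: the velocity of the dependent variable `j` has
degree at least that of `j`. -/
def characteristics : Submodule k (J → DiffFun k w O) where
  carrier := {v | ∀ j, v j ∈ fil _ (w j)}
  zero_mem' := fun _ => zero_mem _
  add_mem' := fun h1 h2 p => add_mem (h1 p) (h2 p)
  smul_mem' := fun c _ h p => Submodule.smul_mem _ c (h p)

/-- The prolongation `∑ Dˢ(ξ_j) ∂/∂u_j^{(s)}` of a characteristic. -/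
def prolong (ξ : characteristics k w O) : jetFields k w O :=
  ⟨fun p => D^[p.2] (ξ.1 p.1), fun p => fil_D_iterate p.2 (ξ.2 p.1)⟩

theorem prolong_apply (ξ : characteristics k w O) (p : J × ℕ) :
    (prolong ξ).1 p = D^[p.2] (ξ.1 p.1) := rfl

/-- The derivation of differential functions with `u_j ↦ ξ_j` that commutes with `D`. -/
def evol (ξ : characteristics k w O) : DiffFun k w O →ₗ[k] DiffFun k w O := fieldDer (prolong ξ)

theorem evol_D (ξ : characteristics k w O) (f : DiffFun k w O) : evol ξ (D f) = D (evol ξ f) := by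
  rw [← sub_eq_zero, D_eq_fieldDer, D_eq_fieldDer, evol, fieldDer_lie, fieldDer_apply]
  refine (sum_congr fun p => ?_).trans sum_zero
  have h : (fieldLie (prolong ξ) (totalField k w O)).1 p = 0 := by
    change fieldDer (prolong ξ) (jetFun k w O (p.1, p.2 + 1))
      - fieldDer (totalField k w O) (D^[p.2] (ξ.1 p.1)) = 0
    rw [fieldDer_jetFun, ← D_eq_fieldDer, prolong_apply, Function.iterate_succ_apply', sub_self]
  rw [h, zero_mul]

theorem evol_D_iterate (ξ : characteristics k w O) (r : ℕ) (f : DiffFun k w O) :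
    evol ξ (D^[r] f) = D^[r] (evol ξ f) := by
  induction r with
  | zero => rfl
  | succ r ih => rw [Function.iterate_succ_apply', Function.iterate_succ_apply', evol_D, ih]

theorem evol_mem_fil (ξ : characteristics k w O) {n : ℕ} {f : DiffFun k w O} (hf : f ∈ fil _ n) :
    evol ξ f ∈ fil _ n := fieldDer_mem_fil _ hf

theorem evol_jetFun (ξ : characteristics k w O) (j : J) :
    evol ξ (jetFun k w O (j, 0)) = ξ.1 j := fieldDer_jetFun _ _

/-- The characteristic of the commutator of two evolutionary vector fields. -/
def charLie (ξ η : characteristics k w O) : characteristics k w O :=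
  ⟨fun j => evol ξ (η.1 j) - evol η (ξ.1 j), fun j =>
    sub_mem (evol_mem_fil ξ (η.2 j)) (evol_mem_fil η (ξ.2 j))⟩

theorem evol_lie (ξ η : characteristics k w O) (f : DiffFun k w O) :
    evol ξ (evol η f) - evol η (evol ξ f) = evol (charLie ξ η) f := by
  rw [evol, evol, fieldDer_lie, evol]
  congr 2
  refine Subtype.ext (funext fun p => ?_)
  change evol ξ (D^[p.2] (η.1 p.1)) - evol η (D^[p.2] (ξ.1 p.1))
    = D^[p.2] (evol ξ (η.1 p.1) - evol η (ξ.1 p.1))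
  rw [evol_D_iterate, evol_D_iterate, D_iterate_eq_pow, D_iterate_eq_pow, D_iterate_eq_pow, map_sub]

theorem locFin_varDer (j : J) (f : DiffFun k w O) :
    LocFin fun s : ℕ => (-1 : ℤ) ^ s • D^[s] (partialₗ k w O (j, s) f) := fun n =>
  (Set.finite_Iio n).subset fun s hs => by
    by_contra hcon
    exact hs (fil_zsmul _ (fil_D_iterate_of_le _ (not_lt.mp hcon)))

theorem varDer_eq (j : J) (f : DiffFun k w O) : varDer k w O j f
    = Coeffs.sum fun s : ℕ => (-1 : ℤ) ^ s • D^[s] (partialₗ k w O (j, s) f) := rfl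

variable (k w O) in
/-- The variational derivative as a linear map. -/
def varDerₗ (j : J) : DiffFun k w O →ₗ[k] DiffFun k w O where
  toFun := varDer k w O j
  map_add' f g := by
    simp only [varDer_eq]
    rw [← sum_add (locFin_varDer j f) (locFin_varDer j g)]
    exact sum_congr fun s => by rw [map_add, D_iterate_add, zsmul_add]
  map_smul' c f := by
    simp only [varDer_eq, RingHom.id_apply]
    rw [← sum_smul c (locFin_varDer j f)]
    exact sum_congr fun s => by rw [map_smul, D_iterate_smul, smul_comm]

theorem varDerₗ_apply (j : J) (f : DiffFun k w O) : varDerₗ k w O j f = varDer k w O j f := rfl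

/-- Variational derivatives annihilate total derivatives: the sum over `s` telescopes. -/
theorem varDer_D (j : J) (f : DiffFun k w O) : varDer k w O j (D f) = 0 := by
  have h1 : LocFin fun s : ℕ => (-1 : ℤ) ^ s • D^[s + 1] (partialₗ k w O (j, s) f) :=
    ((locFin_varDer j f).D).mono fun n s h => by
      rwa [map_zsmul, ← Function.iterate_succ_apply' D] at h
  let F : ℕ → DiffFun k w O := fun s =>
    Nat.casesOn s 0 fun r => (-1 : ℤ) ^ r • D^[r + 1] (partialₗ k w O (j, r) f)
  have hF : LocFin F := fun n => (Set.finite_Iio n).subset fun s hs => by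
    by_contra hcon
    refine hs ?_
    cases s with
    | zero =>
      change (0 : DiffFun k w O) ∈ fil _ n
      exact zero_mem _
    | succ r => exact fil_zsmul _ (fil_D_iterate_of_le _ (not_lt.mp hcon))
  have hs : Coeffs.sum F
      = Coeffs.sum fun s : ℕ => (-1 : ℤ) ^ s • D^[s + 1] (partialₗ k w O (j, s) f) := by
    refine (sum_injective (e := Nat.succ) Nat.succ_injective fun i hi => ?_).symm
    cases i with
    | zero => rfl
    | succ i => exact absurd ⟨i, rfl⟩ hi
  rw [varDer_eq, ← sub_eq_zero.mpr hs.symm, ← sum_sub h1 hF]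
  refine sum_congr fun s => ?_
  rw [partialₗ_D, D_iterate_add, D_iterate_D, ← Function.iterate_succ_apply' D, zsmul_add,
    sub_eq_add_neg]
  congr 1
  cases s with
  | zero => simp [F]
  | succ r =>
    simp only [F]
    rw [pow_succ, mul_neg_one, neg_zsmul]

theorem varDer_one (j : J) : varDer k w O j 1 = 0 :=
  (sum_congr fun s => by
    change (-1 : ℤ) ^ s • D^[s] (partialₗ k w O (j, s) 1) = 0
    rw [partialₗ_one, D_iterate_zero, zsmul_zero]).trans sum_zero

theorem varDer_eq_of_functional_eq {f g : DiffFun k w O} (h : functional f = functional g) (j : J) :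
    varDer k w O j f = varDer k w O j g := by
  obtain ⟨a, c, h⟩ := functional_eq_iff.mp h
  rw [← sub_eq_zero, ← varDerₗ_apply, ← varDerₗ_apply, ← map_sub, h, map_add, map_smul,
    varDerₗ_apply, varDerₗ_apply, varDer_D, varDer_one, smul_zero, add_zero]

theorem locFin_varDer_mul (ξ : characteristics k w O) (f : DiffFun k w O) :
    LocFin fun p : J × ℕ => ξ.1 p.1 * ((-1 : ℤ) ^ p.2 • D^[p.2] (partialₗ k w O p f)) := fun n =>
  (eventually_jetPd_eq_zero f n).mono fun p hp => fil_anti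
    (by simp only [jetDeg]; omega)
    (fil_mul (ξ.2 p.1) (fil_zsmul _ (fil_D_iterate p.2 (partialₗ_mem_fil hp))))

/-- The first variation: up to a total derivative, the derivative of `f` along an evolutionary
vector field is the pairing of the characteristic with the variational derivatives. -/
theorem functional_evol (ξ : characteristics k w O) (f : DiffFun k w O) :
    functional (evol ξ f) = functional (Coeffs.sum fun j => ξ.1 j * varDer k w O j f) := by
  have h1 := locFin_varDer_mul ξ f
  have h2 : (Coeffs.sum fun j => ξ.1 j * varDer k w O j f) = Coeffs.sum fun p : J × ℕ =>
      ξ.1 p.1 * ((-1 : ℤ) ^ p.2 • D^[p.2] (partialₗ k w O p f)) := by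
    rw [sum_prod h1]
    refine sum_congr fun j => ?_
    rw [varDer_eq, mul_sum _ (locFin_varDer j f)]
  let K : J × ℕ → DiffFun k w O := fun p => byParts p.2 (partialₗ k w O p f) (ξ.1 p.1)
  have hK : LocFin K := fun n => (eventually_jetPd_eq_zero f (n + 1)).mono fun p hp =>
    fil_anti (by simp only [jetDeg]; omega) (byParts_fil p.2 (partialₗ_mem_fil hp) (ξ.2 p.1))
  refine functional_eq_of_sub_eq_D (Coeffs.sum K) ?_
  rw [h2, D_sum hK, evol, fieldDer_apply, ← sum_sub (locFin_jetField (prolong ξ).2 f) h1]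
  refine sum_congr fun p => ?_
  simp only [K]
  rw [D_byParts, prolong_apply, mul_comm, mul_comm (ξ.1 p.1), smul_mul_assoc]

end Jets

end

section

open Coeffs Filter Finset.HasAntidiagonal opAdm

variable {k : Type*} [Field k]

/-! ### Derivations acting on operators -/

section Gradients

variable {B : Type*} [CommRing B] [Algebra k B]
  {𝒢 : ℕ → Submodule k B} [SetLike.GradedMonoid 𝒢]

theorem comp_pos (L : Coeffs 𝒢 →ₗ[k] Coeffs 𝒢) (P : Op 𝒢) :
    (fun i => L (pos P i)) = pos fun i => L (P i) := by
  funext i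
  by_cases h : 0 ≤ i <;> simp [pos, h]

theorem comp_neg (L : Coeffs 𝒢 →ₗ[k] Coeffs 𝒢) (P : Op 𝒢) :
    (fun i => L (neg P i)) = neg fun i => L (P i) := by
  funext i
  by_cases h : i < 0 <;> simp [neg, h]

theorem opMonomial_mem_opAdm (ε : ℤˣ) (i : ℤ) (a : Coeffs 𝒢) : opMonomial i a ∈ opAdm 𝒢 ε :=
  fun n => ⟨ε * i, fun l hl => by
    rw [opMonomial, Pi.single_eq_of_ne]
    · exact zero_mem _
    · rintro rfl
      exact lt_irrefl _ hl⟩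

section Derivation

variable [GradedDerivation 𝒢]

/-- Derivations of `𝒜` that commute with `D` and do not lower the degree. They act on operators
coefficientwise, as derivations. -/
structure IsCoeffDer (L : Coeffs 𝒢 →ₗ[k] Coeffs 𝒢) : Prop where
  map_mul : ∀ f g, L (f * g) = f * L g + L f * g
  map_D : ∀ f, L (D f) = D (L f)
  mem_fil : ∀ n, ∀ f ∈ fil 𝒢 n, L f ∈ fil 𝒢 n

namespace IsCoeffDer

variable {L : Coeffs 𝒢 →ₗ[k] Coeffs 𝒢} (hL : IsCoeffDer L)

include hL

theorem map_D_iterate (r : ℕ) (f : Coeffs 𝒢) : L (D^[r] f) = D^[r] (L f) := by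
  induction r with
  | zero => rfl
  | succ r ih => rw [Function.iterate_succ_apply', Function.iterate_succ_apply', hL.map_D, ih]

theorem comp_mem_opAdm {ε : ℤˣ} {P : Op 𝒢} (hP : P ∈ opAdm 𝒢 ε) :
    (fun i => L (P i)) ∈ opAdm 𝒢 ε := fun n =>
  (hP n).imp fun _ hd i hi => hL.mem_fil n _ (hd i hi)

theorem comp_opMul {ε : ℤˣ} {P Q : Op 𝒢} (hP : P ∈ opAdm 𝒢 ε) (hQ : Q ∈ opAdm 𝒢 ε) :
    (fun i => L ((P ⊛ Q) i)) = P ⊛ (fun i => L (Q i)) + (fun i => L (P i)) ⊛ Q := by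
  funext n
  refine (map_sum (Cont.of_filtered hL.mem_fil) (locFin_opMul hP hQ n)).trans (Eq.trans ?_
    (sum_add (locFin_opMul hP (hL.comp_mem_opAdm hQ) n)
      (locFin_opMul (hL.comp_mem_opAdm hP) hQ n)))
  refine sum_congr fun p => ?_
  dsimp only
  rw [map_zsmul, hL.map_mul, hL.map_D_iterate, zsmul_add]

/-- The action of a derivation on admissible operators. -/
def opMap (ε : ℤˣ) : opAdm 𝒢 ε →ₗ[k] opAdm 𝒢 ε :=
  LinearMap.restrict (LinearMap.compLeft L ℤ) fun _ hP => hL.comp_mem_opAdm hP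

theorem opMap_mul (ε : ℤˣ) (P Q : opAdm 𝒢 ε) :
    hL.opMap ε (P * Q) = P * hL.opMap ε Q + hL.opMap ε P * Q :=
  Subtype.ext (hL.comp_opMul P.2 Q.2)

theorem opMap_posPart (ε : ℤˣ) (P : opAdm 𝒢 ε) :
    hL.opMap ε (posPart 𝒢 ε P) = posPart 𝒢 ε (hL.opMap ε P) := Subtype.ext (comp_pos L P.1)

theorem opMap_negPart (ε : ℤˣ) (P : opAdm 𝒢 ε) :
    hL.opMap ε (negPart 𝒢 ε P) = negPart 𝒢 ε (hL.opMap ε P) := Subtype.ext (comp_neg L P.1)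

theorem opMap_toPlus (P : opAdm 𝒢 1) :
    hL.opMap (-1) (toPlus 𝒢 P) = toPlus 𝒢 (hL.opMap 1 P) := Subtype.ext (comp_pos L P.1)

theorem opMap_toMinus (P : opAdm 𝒢 (-1)) :
    hL.opMap 1 (toMinus 𝒢 P) = toMinus 𝒢 (hL.opMap (-1) P) := Subtype.ext (comp_neg L P.1)

theorem opMap_sgn (ε : ℤˣ) (P : opAdm 𝒢 ε) :
    hL.opMap ε (sgn 𝒢 ε P) = sgn 𝒢 ε (hL.opMap ε P) := by
  rw [sgn_apply, map_sub, opMap_posPart, opMap_negPart, sgn_apply]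

/-- The action of a derivation on admissible pairs. -/
def pairMap : AdmPair 𝒢 →ₗ[k] AdmPair 𝒢 := (hL.opMap 1).prodMap (hL.opMap (-1))

theorem pairMap_mul (x y : AdmPair 𝒢) :
    hL.pairMap (x * y) = x * hL.pairMap y + hL.pairMap x * y :=
  Prod.ext (hL.opMap_mul 1 x.1 y.1) (hL.opMap_mul (-1) x.2 y.2)

theorem pairMap_rSkew (x : AdmPair 𝒢) : hL.pairMap (rSkew 𝒢 x) = rSkew 𝒢 (hL.pairMap x) := by
  refine Prod.ext (hL.opMap_sgn 1 x.1) ?_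
  change hL.opMap (-1) (-sgn 𝒢 (-1) x.2) = -sgn 𝒢 (-1) (hL.opMap (-1) x.2)
  rw [map_neg, opMap_sgn]

theorem pairMap_rSymm (x : AdmPair 𝒢) : hL.pairMap (rSymm 𝒢 x) = rSymm 𝒢 (hL.pairMap x) := by
  refine Prod.ext ?_ ?_
  · change hL.opMap 1 (toMinus 𝒢 x.2 + toMinus 𝒢 x.2)
      = toMinus 𝒢 (hL.opMap (-1) x.2) + toMinus 𝒢 (hL.opMap (-1) x.2)
    rw [map_add, opMap_toMinus]
  · change hL.opMap (-1) (toPlus 𝒢 x.1 + toPlus 𝒢 x.1)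
      = toPlus 𝒢 (hL.opMap 1 x.1) + toPlus 𝒢 (hL.opMap 1 x.1)
    rw [map_add, opMap_toPlus]

theorem pairMap_mem_admFrakD {x : AdmPair 𝒢} (hx : x ∈ admFrakD 𝒢) :
    hL.pairMap x ∈ admFrakD 𝒢 := by
  rw [mem_admFrakD] at hx ⊢
  obtain ⟨⟨d, hd⟩, ⟨e, he⟩⟩ := hx
  refine ⟨⟨d, fun i hi => ?_⟩, ⟨e, ?_⟩⟩
  · change L (x.1.1 i) = 0
    rw [hd i hi, map_zero]
  · rw [mem_opPlusGE_iff] at he ⊢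
    exact fun i => hL.mem_fil _ _ (he i)

theorem pairMap_mem_admPart {N m : ℤ} {x : AdmPair 𝒢} (hx : x ∈ admPart 𝒢 N m) :
    hL.pairMap x ∈ admPart 𝒢 N m := by
  rw [mem_admPart] at hx ⊢
  obtain ⟨hd, he⟩ := hx
  refine ⟨fun i hi => ?_, ?_⟩
  · change L (x.1.1 i) = 0
    rw [hd i hi, map_zero]
  · rw [mem_opPlusGE_iff] at he ⊢
    exact fun i => hL.mem_fil _ _ (he i)

theorem pairMap_quadTensor (A X : AdmPair 𝒢) :
    hL.pairMap (quadTensor (rSkew 𝒢).toAddMonoidHom (rSymm 𝒢).toAddMonoidHom A X)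
      = quadTensorDeriv (rSkew 𝒢).toAddMonoidHom (rSymm 𝒢).toAddMonoidHom A (hL.pairMap A) X
        + quadTensor (rSkew 𝒢).toAddMonoidHom (rSymm 𝒢).toAddMonoidHom A (hL.pairMap X) :=
  map_quadTensor (δ := hL.pairMap.toAddMonoidHom) hL.pairMap_mul hL.pairMap_rSkew
    hL.pairMap_rSymm A X

end IsCoeffDer

variable (𝒢) in
/-- The density `res X + res X̂` of the trace form. -/
def pairRes : AdmPair 𝒢 →ₗ[k] Coeffs 𝒢 where
  toFun x := res x.1.1 + res x.2.1
  map_add' _ _ := add_add_add_comm _ _ _ _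
  map_smul' c x := (smul_add c (res x.1.1) (res x.2.1)).symm

theorem functional_pairRes (x : AdmPair 𝒢) : functional (pairRes 𝒢 x) = pairTrace 𝒢 x :=
  functional_add _ _

theorem IsCoeffDer.pairRes_pairMap {L : Coeffs 𝒢 →ₗ[k] Coeffs 𝒢} (hL : IsCoeffDer L)
    (x : AdmPair 𝒢) : pairRes 𝒢 (hL.pairMap x) = L (pairRes 𝒢 x) :=
  (map_add L (res x.1.1) (res x.2.1)).symm

/-! ### Operators with coefficients on the right -/

/-- The operator `∑ D^{-i-1} g_i`. -/
def gradOp (g : ℤ → Coeffs 𝒢) : Op 𝒢 := fun n =>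
  Coeffs.sum fun q : ℕ => Ring.choose (n + q) q • D^[q] (g (-n - 1 - q))

/-- The residue of `Dˡ X`, which recovers the coefficients of `∑ D^{-i-1} g_i`. -/
def dualCoeff (l : ℤ) (X : Op 𝒢) : Coeffs 𝒢 :=
  Coeffs.sum fun r : ℕ => Ring.choose l r • D^[r] (X (-1 + r - l))

theorem locFin_D_iterate (c : ℕ → ℤ) (a : ℕ → Coeffs 𝒢) :
    LocFin fun q : ℕ => c q • D^[q] (a q) := fun n => (Set.finite_Iio n).subset fun q hq => by
  by_contra hcon
  exact hq (fil_zsmul _ (fil_D_iterate_of_le _ (not_lt.mp hcon)))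

theorem choose_sub_one_self (t : ℕ) : Ring.choose ((t : ℤ) - 1) t = if t = 0 then 1 else 0 := by
  cases t with
  | zero => simp
  | succ t =>
    rw [Nat.cast_succ, add_sub_cancel_right, Ring.choose_natCast,
      Nat.choose_eq_zero_of_lt t.lt_succ_self, if_neg t.succ_ne_zero, Nat.cast_zero]

/-- The inversion formula rests on the Chu-Vandermonde identity
`∑_{r+q=t} binom(l, r) binom(t-1-l, q) = binom(t-1, t)`. -/
theorem dualCoeff_gradOp (l : ℤ) (g : ℤ → Coeffs 𝒢) : dualCoeff l (gradOp g) = g l := by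
  let G : ℕ → ℕ → Coeffs 𝒢 := fun r q =>
    (Ring.choose l r * Ring.choose (-1 + (r + q : ℕ) - l) q) •
      D^[r + q] (g (l - (r + q : ℕ)))
  have hG : LocFin fun p : ℕ × ℕ => G p.1 p.2 := fun n =>
    ((Set.finite_Iio n).prod (Set.finite_Iio n)).subset fun p hp => by
      by_contra hcon
      simp only [Set.mem_prod, Set.mem_Iio, not_and_or, not_lt] at hcon
      exact hp (fil_zsmul _ (fil_D_iterate_of_le _ (by omega)))
  have h1 : dualCoeff l (gradOp g) = Coeffs.sum fun p : ℕ × ℕ => G p.1 p.2 := by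
    rw [sum_prod hG]
    refine sum_congr fun r => ?_
    have h := locFin_D_iterate (fun q => Ring.choose (-1 + (r : ℤ) - l + q) q)
      fun q => g (-(-1 + (r : ℤ) - l) - 1 - q)
    dsimp only [gradOp]
    rw [D_iterate_sum r h, ← sum_zsmul _ (h.mono fun _ _ h => fil_D_iterate_of_mem r h)]
    refine sum_congr fun q => ?_
    simp only [G]
    rw [D_iterate_zsmul, ← Function.iterate_add_apply, smul_smul,
      show -(-1 + (r : ℤ) - l) - 1 - q = l - (r + q : ℕ) by push_cast; ring,
      show -1 + (r : ℤ) - l + q = -1 + (r + q : ℕ) - l by push_cast; ring]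
  rw [h1, ← sum_antidiagonal hG]
  have h2 : ∀ t : ℕ, ∑ p ∈ antidiagonal t, G p.1 p.2
      = (if t = 0 then (1 : ℤ) else 0) • D^[t] (g (l - t)) := by
    intro t
    rw [← choose_sub_one_self, show (t : ℤ) - 1 = l + (-1 + t - l) by ring,
      Ring.add_choose_eq t (Commute.all _ _)]
    refine Eq.trans ?_ Finset.sum_smul.symm
    refine Finset.sum_congr rfl fun p hp => ?_
    rw [mem_antidiagonal] at hp
    subst hp
    rfl
  rw [sum_eq_single 0 fun t ht => by rw [h2, if_neg ht, zero_zsmul], h2, if_pos rfl, one_zsmul]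
  simp

theorem res_opMul_eq_sum_dualCoeff {ε : ℤˣ} {P X : Op 𝒢} (hP : P ∈ opAdm 𝒢 ε)
    (hX : X ∈ opAdm 𝒢 ε) : res (P ⊛ X) = Coeffs.sum fun l => P l * dualCoeff l X := by
  refine (sum_prod (locFin_opMul hP hX (-1))).trans (sum_congr fun l => ?_)
  rw [dualCoeff, mul_sum _ (locFin_D_iterate _ _)]
  exact sum_congr fun r => (mul_smul_comm _ _ _).symm

theorem gradOp_add (g h : ℤ → Coeffs 𝒢) : gradOp (g + h) = gradOp g + gradOp h := by
  funext n
  refine Eq.trans (sum_congr fun q => ?_)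
    (sum_add (locFin_D_iterate _ _) (locFin_D_iterate _ _))
  rw [Pi.add_apply, D_iterate_add, zsmul_add]

theorem gradOp_smul (c : k) (g : ℤ → Coeffs 𝒢) : gradOp (c • g) = c • gradOp g := by
  funext n
  refine Eq.trans (sum_congr fun q => ?_) (sum_smul c (locFin_D_iterate _ _))
  rw [Pi.smul_apply, D_iterate_smul, smul_comm]

theorem gradOp_mem_opAdm_one {g : ℤ → Coeffs 𝒢}
    (h : ∀ n, ∃ d, ∀ i, i < d → g i ∈ fil 𝒢 n) : gradOp g ∈ opAdm 𝒢 1 := fun n => by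
  obtain ⟨d, hd⟩ := h n
  refine ⟨-d, fun i hi => fil_sum fun q => fil_zsmul _ (fil_D_iterate_of_mem q (hd _ ?_))⟩
  simp only [Units.val_one] at hi
  omega

theorem gradOp_mem_opAdm_neg_one {g : ℤ → Coeffs 𝒢}
    (h : ∀ n, ∃ d, ∀ i, d < i → g i ∈ fil 𝒢 n) : gradOp g ∈ opAdm 𝒢 (-1) := fun n => by
  obtain ⟨d, hd⟩ := h n
  refine ⟨d + n + 1, fun i hi => fil_sum fun q => fil_zsmul _ ?_⟩
  simp only [Units.val_neg, Units.val_one] at hi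
  by_cases hq : n ≤ q
  · exact fil_D_iterate_of_le _ hq
  · exact fil_D_iterate_of_mem q (hd _ (by omega))

theorem gradOp_mem_opMinus {g : ℤ → Coeffs 𝒢} (d : ℤ) (h : ∀ i, i < -d - 1 → g i = 0) :
    gradOp g ∈ opMinus 𝒢 := by
  refine ⟨d, fun i hi => (sum_congr fun q => ?_).trans sum_zero⟩
  rw [h _ (by omega), D_iterate_zero, zsmul_zero]

theorem gradOp_mem_opPlus {g : ℤ → Coeffs 𝒢} (d : ℤ)
    (h : ∀ i, g i ∈ fil 𝒢 (d + i + 1).toNat) : gradOp g ∈ opPlus 𝒢 := by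
  refine ⟨d, ?_⟩
  rw [mem_opPlusGE_iff]
  refine fun i => fil_sum fun q => fil_zsmul _ (fil_anti ?_ (fil_D_iterate q (h _)))
  omega

theorem dualCoeff_eq_zero_of_order {d : ℤ} {X : Op 𝒢} (hX : X ∈ opMinusLE 𝒢 d) {l : ℤ}
    (hl : l < -d - 1) : dualCoeff l X = 0 :=
  (sum_congr fun r => by rw [hX _ (by omega), D_iterate_zero, zsmul_zero]).trans sum_zero

theorem dualCoeff_mem_fil {d : ℤ} {X : Op 𝒢} (hX : X ∈ opPlusGE 𝒢 d) (l : ℤ) :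
    dualCoeff l X ∈ fil 𝒢 (d + l + 1).toNat := by
  rw [mem_opPlusGE_iff] at hX
  refine fil_sum fun r => fil_zsmul _ (fil_anti ?_ (fil_D_iterate r (hX _)))
  omega

theorem opMonomial_mul_opMonomial (a n : ℤ) (g : Coeffs 𝒢) :
    (opMonomial a (1 : Coeffs 𝒢) ⊛ opMonomial 0 g) n
      = if n ≤ a then Ring.choose a (a - n).toNat • D^[(a - n).toNat] g else 0 := by
  have hz : ∀ p : ℤ × ℕ, ¬ (p.1 = a ∧ n + p.2 = p.1) →
      Ring.choose p.1 p.2 • (opMonomial a (1 : Coeffs 𝒢) p.1 *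
        (D^[p.2]) (opMonomial 0 g (n + p.2 - p.1))) = 0 := by
    intro p hp
    by_cases h1 : p.1 = a
    · have h2 : n + p.2 - p.1 ≠ 0 := fun h => hp ⟨h1, sub_eq_zero.mp h⟩
      rw [opMonomial, opMonomial, Pi.single_eq_of_ne h2, D_iterate_zero, mul_zero, zsmul_zero]
    · rw [opMonomial, Pi.single_eq_of_ne h1, zero_mul, zsmul_zero]
  split_ifs with h
  · refine (sum_eq_single (a, (a - n).toNat) fun p hp => hz p fun h' => hp ?_).trans ?_
    · exact Prod.ext h'.1 (by have := h'.1; have := h'.2; simp only; omega)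
    · dsimp only
      rw [show n + ((a - n).toNat : ℤ) - a = 0 by omega, opMonomial, opMonomial,
        Pi.single_eq_same, Pi.single_eq_same, one_mul]
  · refine (sum_congr fun p => hz p fun h' => ?_).trans sum_zero
    have := h'.1
    have := h'.2
    omega

theorem opSum_opMonomial_mul {ι : Type*} {e : ι → ℤ} (he : Function.Injective e)
    {g : ℤ → Coeffs 𝒢} (hg : ∀ i, i ∉ Set.range e → g i = 0) :
    (opSum fun i : ι => opMonomial (-e i - 1) (1 : Coeffs 𝒢) ⊛ opMonomial 0 (g (e i)))
      = gradOp g := by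
  funext n
  let F : ℤ → Coeffs 𝒢 := fun i => if n ≤ -i - 1 then
    Ring.choose (-i - 1) (-i - 1 - n).toNat • D^[(-i - 1 - n).toNat] (g i) else 0
  have h1 : (Coeffs.sum fun i => F (e i)) = Coeffs.sum F := sum_injective he fun i hi => by
    simp only [F]
    rw [hg i hi, D_iterate_zero, zsmul_zero, ite_self]
  have h2 : (Coeffs.sum fun q : ℕ => F (-n - 1 - q)) = Coeffs.sum F :=
    sum_injective (e := fun q : ℕ => -n - 1 - (q : ℤ)) (fun a b h => by
      simp only at h; omega) fun i hi => if_neg fun h =>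
        hi ⟨(-i - 1 - n).toNat, by simp only; omega⟩
  refine (sum_congr fun i => opMonomial_mul_opMonomial _ _ _).trans (h1.trans (h2.symm.trans ?_))
  refine sum_congr fun q => ?_
  simp only [F]
  rw [if_pos (by omega), show (-(-n - 1 - (q : ℤ)) - 1 - n).toNat = q by omega,
    show -(-n - 1 - (q : ℤ)) - 1 = n + q by ring]

theorem res_opMonomial_mul {ε : ℤˣ} {X : Op 𝒢} (hX : X ∈ opAdm 𝒢 ε) (i : ℤ) (a : Coeffs 𝒢) :
    res (opMonomial i a ⊛ X) = a * dualCoeff i X := by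
  rw [res_opMul_eq_sum_dualCoeff (opMonomial_mem_opAdm ε i a) hX, sum_eq_single i]
  · rw [opMonomial, Pi.single_eq_same]
  · intro j hj
    rw [opMonomial, Pi.single_eq_of_ne hj, zero_mul]

end Derivation

end Gradients

end

section

open Coeffs Filter Finset.HasAntidiagonal opAdm

variable {k : Type*} [Field k]

/-! ### Separation of differential functions by functionals -/

section Separation

variable {J : Type*} {w : J → ℕ} {O : Type*} [CommRing O] [Algebra k O]
  [CoordinateAlgebra k (JetZero w) O]

theorem eventually_forall_jetPd_eq_zero (f : DiffFun k w O) (n : ℕ) :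
    ∀ᶠ j in cofinite, ∀ s, ∀ l < n, jetPd k w O (j, s) (comp l f) = 0 := by
  refine (Set.Finite.image Prod.fst (eventually_jetPd_eq_zero f n)).subset fun j hj => ?_
  obtain ⟨s, hs⟩ := not_forall.mp hj
  exact ⟨(j, s), hs, rfl⟩

theorem varDer_mem_fil {j : J} {n : ℕ} {f : DiffFun k w O}
    (h : ∀ s, ∀ l < n + w j, jetPd k w O (j, s) (comp l f) = 0) :
    varDer k w O j f ∈ fil _ n := by
  rw [varDer_eq]
  refine fil_sum fun s => fil_zsmul _ (fil_anti ?_ (fil_D_iterate s (partialₗ_mem_fil (h s))))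
  simp only [jetDeg]
  omega

/-- Up to terms of high degree, the variational derivative with respect to a variable that occurs
only as an undifferentiated factor removes that factor. -/
theorem varDer_jetFun_mul_sub_mem {j : J} {n : ℕ} {g : DiffFun k w O}
    (h : ∀ s, partialₗ k w O (j, s) g ∈ fil _ (n - s)) :
    varDer k w O j (jetFun k w O (j, 0) * g) - g ∈ fil _ n := by
  have h0 := sum_sub_finset_mem (n := n) (f := fun s : ℕ =>
    (-1 : ℤ) ^ s • D^[s] (partialₗ k w O (j, s) (jetFun k w O (j, 0) * g))) {0} fun s hs => by
      rw [Finset.mem_singleton] at hs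
      have hne : ((j, s) : J × ℕ) ≠ (j, 0) := fun he => hs (congrArg Prod.snd he)
      rw [partialₗ_mul, partialₗ_jetFun_of_ne hne, zero_mul, add_zero]
      exact fil_zsmul _ (fil_anti (by omega) (fil_D_iterate s (fil_mul_left _ (h s))))
  rw [Finset.sum_singleton, pow_zero, one_zsmul, Function.iterate_zero_apply, partialₗ_mul,
    partialₗ_jetFun_self, one_mul] at h0
  have h1 := add_mem h0 (fil_mul_left (jetFun k w O (j, 0)) (h 0))
  rw [varDer_eq]
  convert h1 using 1
  abel

/-- A differential function that is orthogonal to all differential functions of degree at least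
`d` vanishes, provided there are infinitely many variables of degree zero: test it against
`u · v^{(d)}`, where `u` and `v` are variables of degree zero that do not occur in low degrees. -/
theorem eq_zero_of_functional_mul_eq_zero {e : DiffFun k w O} {d : ℕ}
    (hw : {j | w j = 0}.Infinite)
    (h : ∀ a ∈ fil _ d, functional (a * e) = (0 : LocalFunctional (jetGrading k w O))) :
    e = 0 := by
  refine ext_comp fun n => ?_
  have hfin := eventually_forall_jetPd_eq_zero e (n + 1)
  have hgood : {j | w j = 0 ∧ ∀ s, ∀ l < n + 1, jetPd k w O (j, s) (comp l e) = 0}.Infinite :=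
    fun hc => hw ((hc.union hfin).subset fun j hj => by
      by_cases hg : ∀ s, ∀ l < n + 1, jetPd k w O (j, s) (comp l e) = 0
      exacts [Or.inl ⟨hj, hg⟩, Or.inr hg])
  obtain ⟨a, ⟨ha0, ha⟩⟩ := hgood.nonempty
  obtain ⟨b, ⟨hb0, hb⟩, hba⟩ := (hgood.sdiff (Set.finite_singleton a)).nonempty
  have hba : b ≠ a := hba
  have hdeg : jetDeg w (b, d) = d := by simp only [jetDeg]; omega
  have hy : jetFun k w O (b, d) ∈ fil (jetGrading k w O) d := by
    have := jetFun_mem_fil (k := k) (w := w) (O := O) (b, d)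
    rwa [hdeg] at this
  have h1 : varDer k w O a (jetFun k w O (a, 0) * (jetFun k w O (b, d) * e)) = 0 := by
    rw [← mul_assoc, varDer_eq_of_functional_eq (g := 0), ← varDerₗ_apply, map_zero]
    exact (h _ (fil_mul_left _ hy)).trans (map_zero (functionalₗ (jetGrading k w O))).symm
  have h2 := varDer_jetFun_mul_sub_mem (k := k) (w := w) (O := O) (j := a) (n := d + (n + 1))
    (g := jetFun k w O (b, d) * e) fun s => by
      have hne : ((a, s) : J × ℕ) ≠ (b, d) := fun he => hba (congrArg Prod.fst he).symm
      rw [partialₗ_mul, partialₗ_jetFun_of_ne hne, zero_mul, add_zero]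
      refine fil_anti ?_ (fil_mul hy (partialₗ_mem_fil (ha s)))
      simp only [jetDeg]
      omega
  rw [h1, zero_sub, neg_mem_iff] at h2
  have h3 := h2 (d + n) (by omega)
  rw [comp_jetFun_mul, hdeg, if_pos (by omega), Nat.add_sub_cancel_left] at h3
  have h4 := congrArg (jetPd k w O (b, d)) h3
  rw [Derivation.leibniz, jetPd_jet_self, hb d n n.lt_succ_self, smul_zero, zero_add, smul_eq_mul,
    mul_one, map_zero] at h4
  rw [h4, comp_zero]

theorem locFin_mul_varDer (ξ : characteristics k w O) (f : DiffFun k w O) :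
    LocFin fun j => ξ.1 j * varDer k w O j f := by
  refine (locFin_varDer_mul ξ f).sum_fst.mono fun n j h => ?_
  rwa [varDer_eq, mul_sum _ (locFin_varDer j f)]

theorem isCoeffDer_evol (ξ : characteristics k w O) : IsCoeffDer (evol ξ) where
  map_mul := fieldDer_mul _
  map_D := evol_D ξ
  mem_fil _ _ := evol_mem_fil ξ

end Separation

/-! ### Gradients of functionals -/

section Gradient

variable {N m : ℤ} {O : Type*} [CommRing O] [Algebra k O]
  [CoordinateAlgebra k (JetZero (coordDeg N m)) O]

local notation "𝒥" => jetGrading k (coordDeg N m) O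

/-- The variational derivatives `δ/δw_i`, extended by zero to `i > N`. -/
def varDerMinus (f : Coeffs 𝒥) (i : ℤ) : Coeffs 𝒥 :=
  if h : i ≤ N then varDer k (coordDeg N m) O (Sum.inl ⟨i, h⟩) f else 0

/-- The variational derivatives `δ/δŵ_i`. -/
def varDerPlus (f : Coeffs 𝒥) (i : ℤ) : Coeffs 𝒥 := varDer k (coordDeg N m) O (Sum.inr i) f

theorem varDerMinus_add (f g : Coeffs 𝒥) :
    varDerMinus (f + g) = varDerMinus f + varDerMinus g := by
  funext i
  rw [Pi.add_apply]
  unfold varDerMinus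
  split_ifs
  · exact map_add (varDerₗ k (coordDeg N m) O _) f g
  · rw [add_zero]

theorem varDerMinus_smul (c : k) (f : Coeffs 𝒥) :
    varDerMinus (c • f) = c • varDerMinus f := by
  funext i
  rw [Pi.smul_apply]
  unfold varDerMinus
  split_ifs
  · exact map_smul (varDerₗ k (coordDeg N m) O _) c f
  · rw [smul_zero]

theorem varDerPlus_add (f g : Coeffs 𝒥) : varDerPlus (f + g) = varDerPlus f + varDerPlus g :=
  funext fun _ => map_add (varDerₗ k (coordDeg N m) O _) f g

theorem varDerPlus_smul (c : k) (f : Coeffs 𝒥) : varDerPlus (c • f) = c • varDerPlus f :=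
  funext fun _ => map_smul (varDerₗ k (coordDeg N m) O _) c f

/-- Up to terms of high degree, a differential function depends on finitely many of the `w_i`. -/
theorem gradOp_varDerMinus_mem (f : Coeffs 𝒥) : gradOp (varDerMinus f) ∈ opAdm 𝒥 1 := by
  refine gradOp_mem_opAdm_one fun n => ?_
  have h : ∀ᶠ i : ℤ in cofinite, varDerMinus f i ∈ fil 𝒥 n := by
    refine ((Sum.inl_injective.tendsto_cofinite.eventually
      (eventually_forall_jetPd_eq_zero f n)).image Subtype.val).subset fun i hi => ?_
    by_cases hN : i ≤ N
    · refine ⟨⟨i, hN⟩, fun hc => hi ?_, rfl⟩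
      change varDerMinus f i ∈ fil 𝒥 n
      rw [varDerMinus, dif_pos hN]
      exact varDer_mem_fil hc
    · refine absurd ?_ hi
      change varDerMinus f i ∈ fil 𝒥 n
      rw [varDerMinus, dif_neg hN]
      exact zero_mem _
  rw [Int.cofinite_eq, eventually_sup] at h
  obtain ⟨d, hd⟩ := eventually_atBot.mp h.1
  exact ⟨d, fun i hi => hd i hi.le⟩

/-- Up to terms of high degree, a differential function depends on finitely many of the `ŵ_i` with
`i ≥ m`, which have degree zero. -/
theorem gradOp_varDerPlus_mem (f : Coeffs 𝒥) : gradOp (varDerPlus f) ∈ opAdm 𝒥 (-1) := by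
  refine gradOp_mem_opAdm_neg_one fun n => ?_
  have h : ∀ᶠ i : ℤ in cofinite, ∀ s, ∀ l < n,
      jetPd k (coordDeg N m) O (Sum.inr i, s) (comp l f) = 0 :=
    Sum.inr_injective.tendsto_cofinite.eventually (eventually_forall_jetPd_eq_zero f n)
  rw [Int.cofinite_eq, eventually_sup] at h
  obtain ⟨d, hd⟩ := eventually_atTop.mp h.2
  refine ⟨max d m, fun i hi => varDer_mem_fil ?_⟩
  have hw : coordDeg N m (Sum.inr i) = 0 := by
    simp only [coordDeg, Sum.elim_inr]
    omega
  rw [hw]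
  exact hd i (by omega)

/-- The variational gradient of `∫ f dx` as an admissible pair. It always exists there, whether or
not it lies in `𝔇`. -/
def grad : Coeffs 𝒥 →ₗ[k] AdmPair 𝒥 where
  toFun f := (⟨_, gradOp_varDerMinus_mem f⟩, ⟨_, gradOp_varDerPlus_mem f⟩)
  map_add' f g := AdmPair.ext_val
    ((congrArg gradOp (varDerMinus_add f g)).trans (gradOp_add _ _))
    ((congrArg gradOp (varDerPlus_add f g)).trans (gradOp_add _ _))
  map_smul' c f := AdmPair.ext_val
    ((congrArg gradOp (varDerMinus_smul c f)).trans (gradOp_smul _ _))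
    ((congrArg gradOp (varDerPlus_smul c f)).trans (gradOp_smul _ _))

theorem grad_fst (f : Coeffs 𝒥) : (grad f).1.1 = gradOp (varDerMinus f) := rfl

theorem grad_snd (f : Coeffs 𝒥) : (grad f).2.1 = gradOp (varDerPlus f) := rfl

theorem pairVal_grad (f : Coeffs 𝒥) : pairVal 𝒥 (grad f) = varGrad k N m O f := by
  refine Prod.ext ?_ ?_
  · have h := opSum_opMonomial_mul (e := fun i : {i : ℤ // i ≤ N} => i.1) Subtype.val_injective
      (g := varDerMinus f) fun i hi => dif_neg fun h => hi ⟨⟨i, h⟩, rfl⟩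
    refine h.symm.trans (congrArg opSum (funext fun i => ?_))
    rw [varDerMinus, dif_pos i.2]
  · exact (opSum_opMonomial_mul (e := fun i : ℤ => i) Function.injective_id
      (g := varDerPlus f) fun i hi => absurd ⟨i, rfl⟩ hi).symm

theorem grad_eq_of_functional_eq {f g : Coeffs 𝒥} (h : functional f = functional g) :
    grad f = grad g := by
  have h1 : varDerMinus f = varDerMinus g := by
    funext i
    unfold varDerMinus
    split_ifs
    exacts [varDer_eq_of_functional_eq h _, rfl]
  have h2 : varDerPlus f = varDerPlus g := funext fun _ => varDer_eq_of_functional_eq h _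
  exact AdmPair.ext_val (congrArg gradOp h1) (congrArg gradOp h2)

/-! ### Derivatives along tangent vectors -/

theorem genericPoint_mem : genericPoint k N m O ∈ frakDPart 𝒥 N m := by
  refine ⟨fun i hi => dif_neg (not_le.mpr hi), ?_⟩
  change (genericPoint k N m O).2 ∈ opPlusGE 𝒥 m
  rw [mem_opPlusGE_iff]
  exact fun i => jetFun_mem_fil (Sum.inr i, 0)

variable (k N m O) in
/-- The generic point as an admissible pair. -/
def genericAdm : AdmPair 𝒥 :=
  (⟨(genericPoint k N m O).1, opMinus_le_opAdm (frakDPart_le_frakD N m genericPoint_mem).1⟩,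
    ⟨(genericPoint k N m O).2, opPlus_le_opAdm (frakDPart_le_frakD N m genericPoint_mem).2⟩)

theorem pairVal_genericAdm : pairVal 𝒥 (genericAdm k N m O) = genericPoint k N m O := rfl

theorem genericAdm_mem : genericAdm k N m O ∈ admPart 𝒥 N m := genericPoint_mem (k := k) (O := O)

/-- The characteristic of the evolutionary vector field `A ↦ ξ`. -/
def tangentChar (ξ : admPart 𝒥 N m) : characteristics k (coordDeg N m) O :=
  ⟨Sum.elim (fun i => ξ.1.1.1 i.1) fun i => ξ.1.2.1 i, fun j => by
    cases j with
    | inl i => exact fil_zero _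
    | inr i => exact mem_opPlusGE_iff.mp (mem_admPart.mp ξ.2).2 i⟩

/-- The derivative of admissible pairs along the evolutionary vector field `A ↦ ξ`. -/
def pairDer (ξ : admPart 𝒥 N m) : AdmPair 𝒥 →ₗ[k] AdmPair 𝒥 :=
  (isCoeffDer_evol (tangentChar ξ)).pairMap

theorem pairDer_genericAdm (ξ : admPart 𝒥 N m) : pairDer ξ (genericAdm k N m O) = ξ := by
  refine AdmPair.ext_val (funext fun i => ?_) (funext fun i => evol_jetFun _ _)
  change evol (tangentChar ξ) (if h : i ≤ N then
    jetFun k (coordDeg N m) O (Sum.inl ⟨i, h⟩, 0) else 0) = ξ.1.1.1 i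
  split_ifs with h
  · exact evol_jetFun _ _
  · rw [map_zero, (mem_admPart.mp ξ.2).1 i (not_le.mp h)]

theorem pairDer_mem_admPart (ξ η : admPart 𝒥 N m) : pairDer ξ η ∈ admPart 𝒥 N m :=
  IsCoeffDer.pairMap_mem_admPart _ η.2

theorem pairDer_mem_admFrakD (ξ : admPart 𝒥 N m) {x : AdmPair 𝒥} (hx : x ∈ admFrakD 𝒥) :
    pairDer ξ x ∈ admFrakD 𝒥 := IsCoeffDer.pairMap_mem_admFrakD _ hx

/-- The bracket of tangent vectors. -/
def tangentLie (ξ η : admPart 𝒥 N m) : admPart 𝒥 N m :=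
  ⟨pairDer ξ η - pairDer η ξ, sub_mem (pairDer_mem_admPart ξ η) (pairDer_mem_admPart η ξ)⟩

theorem charLie_tangentChar (ξ η : admPart 𝒥 N m) :
    charLie (tangentChar ξ) (tangentChar η) = tangentChar (tangentLie ξ η) := by
  refine Subtype.ext (funext fun j => ?_)
  cases j <;> rfl

/-- The gradient represents the differential: the derivative of `∫ f dx` along `ξ` is
`⟨δf/δA, ξ⟩`. -/
theorem functional_evol_tangentChar (ξ : admPart 𝒥 N m) (f : Coeffs 𝒥) :
    functional (evol (tangentChar ξ) f) = pairTrace 𝒥 (grad f * ξ) := by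
  have h1 : res (ξ.1.1.1 ⊛ (grad f).1.1) = Coeffs.sum fun i : {i : ℤ // i ≤ N} =>
      ξ.1.1.1 i.1 * varDer k (coordDeg N m) O (Sum.inl i) f := by
    rw [res_opMul_eq_sum_dualCoeff ξ.1.1.2 (grad f).1.2, ← sum_injective
      (e := fun i : {i : ℤ // i ≤ N} => i.1) Subtype.val_injective]
    · refine sum_congr fun i => ?_
      rw [grad_fst, dualCoeff_gradOp, varDerMinus, dif_pos i.2]
    · intro i hi
      rw [grad_fst, dualCoeff_gradOp, varDerMinus, dif_neg fun h => hi ⟨⟨i, h⟩, rfl⟩, mul_zero]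
  have h2 : res (ξ.1.2.1 ⊛ (grad f).2.1) = Coeffs.sum fun i : ℤ =>
      ξ.1.2.1 i * varDer k (coordDeg N m) O (Sum.inr i) f := by
    rw [res_opMul_eq_sum_dualCoeff ξ.1.2.2 (grad f).2.2]
    refine sum_congr fun i => ?_
    rw [grad_snd, dualCoeff_gradOp, varDerPlus]
  rw [functional_evol, sum_sumType (locFin_mul_varDer _ f), pairTrace_comm, ← functional_pairRes]
  exact congrArg functional (congrArg₂ (· + ·) h1.symm h2.symm)

theorem functional_evol_pairRes_mul (ξ : admPart 𝒥 N m) (x y : AdmPair 𝒥) :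
    functional (evol (tangentChar ξ) (pairRes 𝒥 (x * y)))
      = pairTrace 𝒥 (x * pairDer ξ y) + pairTrace 𝒥 (pairDer ξ x * y) := by
  rw [← (isCoeffDer_evol (tangentChar ξ)).pairRes_pairMap, functional_pairRes,
    IsCoeffDer.pairMap_mul, map_add]
  rfl

/-- The second variation is symmetric, because evolutionary vector fields form a Lie algebra. -/
theorem pairTrace_pairDer_grad (ξ η : admPart 𝒥 N m) (f : Coeffs 𝒥) :
    pairTrace 𝒥 (pairDer ξ (grad f) * η) = pairTrace 𝒥 (pairDer η (grad f) * ξ) := by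
  have key : ∀ ξ η : admPart 𝒥 N m, functional (evol (tangentChar ξ) (evol (tangentChar η) f))
      = pairTrace 𝒥 (grad f * pairDer ξ η) + pairTrace 𝒥 (pairDer ξ (grad f) * η) := by
    intro ξ η
    have h : functional (evol (tangentChar η) f) = functional (pairRes 𝒥 (grad f * η)) := by
      rw [functional_evol_tangentChar, functional_pairRes]
    rw [functional_evol_tangentChar, grad_eq_of_functional_eq h, ← functional_evol_tangentChar,
      functional_evol_pairRes_mul]
  have h1 := functional_sub (evol (tangentChar ξ) (evol (tangentChar η) f))
    (evol (tangentChar η) (evol (tangentChar ξ) f))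
  rw [evol_lie, charLie_tangentChar, functional_evol_tangentChar, key, key, tangentLie, mul_sub,
    map_sub] at h1
  rw [add_sub_add_comm] at h1
  exact sub_eq_zero.mp (left_eq_add.mp h1)

end Gradient

end

section

open Coeffs opAdm

variable {k : Type*} [Field k]

/-! ### The derivative of the Poisson tensor -/

section Tensor

variable {B : Type*} [CommRing B] [Algebra k B]
  {𝒢 : ℕ → Submodule k B} [SetLike.GradedMonoid 𝒢] [GradedDerivation 𝒢]

theorem pairTrace_inl_mul (P : opAdm 𝒢 1) (y : AdmPair 𝒢) :
    pairTrace 𝒢 ((P, 0) * y) = trace 𝒢 1 (P * y.1) := by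
  have h : trace 𝒢 (-1) (0 * y.2) = 0 := by rw [zero_mul, map_zero]
  exact (congrArg (trace 𝒢 1 (P * y.1) + ·) h).trans (add_zero _)

theorem pairTrace_inr_mul (P : opAdm 𝒢 (-1)) (y : AdmPair 𝒢) :
    pairTrace 𝒢 ((0, P) * y) = trace 𝒢 (-1) (P * y.2) := by
  have h : trace 𝒢 1 (0 * y.1) = 0 := by rw [zero_mul, map_zero]
  exact (congrArg (· + trace 𝒢 (-1) (P * y.2)) h).trans (zero_add _)

/-- The left factor of twice the Poisson tensor at `A`, which is `X ↦ l(X) A - A r(X)`. -/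
def tensorLeft (A X : AdmPair 𝒢) : AdmPair 𝒢 := rSkew 𝒢 (A * X) + rSymm 𝒢 (X * A)

/-- The right factor of twice the Poisson tensor at `A`, which is `X ↦ l(X) A - A r(X)`. -/
def tensorRight (A X : AdmPair 𝒢) : AdmPair 𝒢 := rSymm 𝒢 (A * X) + rSkew 𝒢 (X * A)

/-- Twice the Poisson tensor. -/
def doubleTensor (A X : AdmPair 𝒢) : AdmPair 𝒢 :=
  quadTensor (rSkew 𝒢).toAddMonoidHom (rSymm 𝒢).toAddMonoidHom A X

/-- The derivative of twice the Poisson tensor with respect to `A`. -/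
def doubleTensorDeriv (A ξ X : AdmPair 𝒢) : AdmPair 𝒢 :=
  quadTensorDeriv (rSkew 𝒢).toAddMonoidHom (rSymm 𝒢).toAddMonoidHom A ξ X

theorem doubleTensor_eq (A X : AdmPair 𝒢) :
    doubleTensor A X = admTensor A X + admTensor A X := (admTensor_add_self A X).symm

theorem pairTrace_doubleTensor (A X Z : AdmPair 𝒢) :
    pairTrace 𝒢 (X * doubleTensor A Z) = -pairTrace 𝒢 (Z * doubleTensor A X) :=
  (quadraticRMatrix 𝒢).trace_quadTensor A X Z

/-- The transpose of `ξ ↦ doubleTensorDeriv A ξ Z`. -/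
theorem pairTrace_doubleTensorDeriv (A ξ X Z : AdmPair 𝒢) :
    pairTrace 𝒢 (X * doubleTensorDeriv A ξ Z)
      = pairTrace 𝒢 ((X * tensorLeft A Z - tensorRight A Z * X
        - (Z * tensorLeft A X - tensorRight A X * Z)) * ξ) := by
  have hmove : ∀ x y : AdmPair 𝒢, pairTrace 𝒢 (x * (tensorLeft A y * ξ - ξ * tensorRight A y))
      = pairTrace 𝒢 ((x * tensorLeft A y - tensorRight A y * x) * ξ) := fun x y => by
    rw [mul_sub, sub_mul, map_sub, map_sub, mul_assoc, ← mul_assoc x ξ, pairTrace_comm (x * ξ),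
      mul_assoc]
  have h : pairTrace 𝒢 (X * doubleTensorDeriv A ξ Z)
      = pairTrace 𝒢 (X * (tensorLeft A Z * ξ - ξ * tensorRight A Z))
        - pairTrace 𝒢 (Z * (tensorLeft A X * ξ - ξ * tensorRight A X)) :=
    (quadraticRMatrix 𝒢).trace_quadTensorDeriv A ξ X Z
  rw [h, hmove, hmove, ← map_sub, ← sub_mul]

theorem cyclic_doubleTensorDeriv (A X Y Z : AdmPair 𝒢) :
    pairTrace 𝒢 (X * doubleTensorDeriv A (doubleTensor A Y) Z)
      + pairTrace 𝒢 (Y * doubleTensorDeriv A (doubleTensor A Z) X)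
      + pairTrace 𝒢 (Z * doubleTensorDeriv A (doubleTensor A X) Y) = 0 :=
  (quadraticRMatrix 𝒢).cyclic_quadTensorDeriv A X Y Z

theorem IsCoeffDer.pairMap_doubleTensor {L : Coeffs 𝒢 →ₗ[k] Coeffs 𝒢} (hL : IsCoeffDer L)
    (A X : AdmPair 𝒢) : hL.pairMap (doubleTensor A X)
      = doubleTensorDeriv A (hL.pairMap A) X + doubleTensor A (hL.pairMap X) :=
  hL.pairMap_quadTensor A X

theorem tensorLeft_mem {A X : AdmPair 𝒢} (hA : A ∈ admFrakD 𝒢) (hX : X ∈ admFrakD 𝒢) :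
    tensorLeft A X ∈ admFrakD 𝒢 :=
  add_mem (rSkew_mem_admFrakD (mul_mem_admFrakD hA hX)) (rSymm_mem_admFrakD _)

theorem tensorRight_mem {A X : AdmPair 𝒢} (hA : A ∈ admFrakD 𝒢) (hX : X ∈ admFrakD 𝒢) :
    tensorRight A X ∈ admFrakD 𝒢 :=
  add_mem (rSymm_mem_admFrakD _) (rSkew_mem_admFrakD (mul_mem_admFrakD hX hA))

theorem smul_mul_admPair (c : k) (x y : AdmPair 𝒢) : c • x * y = c • (x * y) :=
  AdmPair.ext_val (smul_opMul c x.1.2 y.1.2) (smul_opMul c x.2.2 y.2.2)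

theorem pairTrace_add_self_mul_add_self (x y : AdmPair 𝒢) :
    pairTrace 𝒢 ((x + x) * (y + y)) = (4 : k) • pairTrace 𝒢 (x * y) := by
  rw [mul_add, add_mul, map_add, map_add, ← two_smul k (pairTrace 𝒢 (x * y)), ← add_smul]
  norm_num

theorem pairTrace_sub_add_mul (x y z ξ : AdmPair 𝒢) : pairTrace 𝒢 ((x - y + z) * ξ)
    = pairTrace 𝒢 (x * ξ) - pairTrace 𝒢 (y * ξ) + pairTrace 𝒢 (z * ξ) := by
  rw [add_mul, sub_mul, map_add, map_sub]

end Tensor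

section Bracket

variable {N m : ℤ} {O : Type*} [CommRing O] [Algebra k O]
  [CoordinateAlgebra k (JetZero (coordDeg N m)) O]

local notation "𝒥" => jetGrading k (coordDeg N m) O

/-! ### Functionals with gradient in `𝔇` -/

theorem infinite_coordDeg_eq_zero : {j | coordDeg N m j = 0}.Infinite := by
  refine ((Set.Ici_infinite m).image Sum.inr_injective.injOn).mono ?_
  rintro _ ⟨i, hi, rfl⟩
  have hi : m ≤ i := hi
  change (m - i).toNat = 0
  omega

theorem functional_mul_dualCoeff_sub {ε : ℤˣ} (i : ℤ) (a : Coeffs 𝒥) (P Q : opAdm 𝒥 ε) :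
    functional (a * (dualCoeff i P.1 - dualCoeff i Q.1))
      = trace 𝒥 ε (⟨opMonomial i a, opMonomial_mem_opAdm ε i a⟩ * P)
        - trace 𝒥 ε (⟨opMonomial i a, opMonomial_mem_opAdm ε i a⟩ * Q) := by
  rw [mul_sub, functional_sub, ← res_opMonomial_mul P.2, ← res_opMonomial_mul Q.2]
  rfl

/-- A gradient lies in `𝔇` as soon as its pairing with tangent vectors agrees with the pairing of
some element of `𝔇`: testing against monomials shows that the variational derivatives are then the
dual coefficients of that element. -/
theorem grad_mem_admFrakD {f : Coeffs 𝒥} {x : AdmPair 𝒥} (hx : x ∈ admFrakD 𝒥)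
    (h : ∀ ξ : admPart 𝒥 N m, pairTrace 𝒥 (grad f * ξ) = pairTrace 𝒥 (x * ξ)) :
    grad f ∈ admFrakD 𝒥 := by
  have h1 : ∀ i ≤ N, varDerMinus f i = dualCoeff i x.1.1 := by
    intro i hi
    rw [← dualCoeff_gradOp i (varDerMinus f), ← sub_eq_zero]
    refine eq_zero_of_functional_mul_eq_zero (d := 0) infinite_coordDeg_eq_zero fun a _ => ?_
    have hmem : ((⟨opMonomial i a, opMonomial_mem_opAdm 1 i a⟩, 0) : AdmPair 𝒥)
        ∈ admPart 𝒥 N m :=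
      mem_admPart.mpr ⟨fun l hl => Pi.single_eq_of_ne (by omega) _, zero_mem _⟩
    have h2 := h ⟨_, hmem⟩
    rw [pairTrace_comm, pairTrace_comm x, pairTrace_inl_mul, pairTrace_inl_mul] at h2
    exact (functional_mul_dualCoeff_sub i a (grad f).1 x.1).trans (sub_eq_zero.mpr h2)
  have h2 : ∀ i, varDerPlus f i = dualCoeff i x.2.1 := by
    intro i
    rw [← dualCoeff_gradOp i (varDerPlus f), ← sub_eq_zero]
    refine eq_zero_of_functional_mul_eq_zero (d := (m - i).toNat) infinite_coordDeg_eq_zero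
      fun a ha => ?_
    have hmem : ((0, ⟨opMonomial i a, opMonomial_mem_opAdm (-1) i a⟩) : AdmPair 𝒥)
        ∈ admPart 𝒥 N m := by
      refine mem_admPart.mpr ⟨zero_mem _, mem_opPlusGE_iff.mpr fun l => ?_⟩
      change opMonomial i a l ∈ _
      by_cases hl : l = i
      · subst hl
        rwa [opMonomial, Pi.single_eq_same]
      · rw [opMonomial, Pi.single_eq_of_ne hl]
        exact zero_mem _
    have h2 := h ⟨_, hmem⟩
    rw [pairTrace_comm, pairTrace_comm x, pairTrace_inr_mul, pairTrace_inr_mul] at h2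
    exact (functional_mul_dualCoeff_sub i a (grad f).2 x.2).trans (sub_eq_zero.mpr h2)
  obtain ⟨⟨d, hd⟩, ⟨e, he⟩⟩ := mem_admFrakD.mp hx
  refine mem_admFrakD.mpr ⟨gradOp_mem_opMinus d fun i hi => ?_, gradOp_mem_opPlus e fun i => ?_⟩
  · by_cases hN : i ≤ N
    · rw [h1 i hN, dualCoeff_eq_zero_of_order hd hi]
    · exact dif_neg hN
  · rw [h2]
    exact dualCoeff_mem_fil he i

/-! ### The bracket of functionals -/

/-- The Hamiltonian vector field of `2 ∫ f dx`. The factor avoids halves in the tensor. -/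
def hamField (f : Coeffs 𝒥) : admPart 𝒥 N m :=
  ⟨doubleTensor (genericAdm k N m O) (grad f), by
    rw [doubleTensor_eq]
    exact add_mem (admTensor_mem_admPart genericAdm_mem _)
      (admTensor_mem_admPart genericAdm_mem _)⟩

theorem coe_hamField (f : Coeffs 𝒥) :
    (hamField f).1 = doubleTensor (genericAdm k N m O) (grad f) := rfl

/-- A density of the bracket. -/
def bracketDensity (f g : Coeffs 𝒥) : Coeffs 𝒥 :=
  pairRes 𝒥 (grad f * admTensor (genericAdm k N m O) (grad g))

theorem bracketDensity_add_self (f g : Coeffs 𝒥) :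
    bracketDensity f g + bracketDensity f g = pairRes 𝒥 (grad f * hamField g) := by
  rw [bracketDensity, ← map_add, ← mul_add, coe_hamField, doubleTensor_eq]

theorem pairDer_hamField (ξ : admPart 𝒥 N m) (g : Coeffs 𝒥) :
    pairDer ξ (hamField g).1 = doubleTensorDeriv (genericAdm k N m O) ξ (grad g)
      + doubleTensor (genericAdm k N m O) (pairDer ξ (grad g)) := by
  rw [coe_hamField, pairDer, IsCoeffDer.pairMap_doubleTensor]
  refine congrArg (doubleTensorDeriv _ · _ + _) ?_
  exact pairDer_genericAdm ξ

/-- The second variation of `∫ f dx`. -/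
def secondVariation (f : Coeffs 𝒥) (ξ η : admPart 𝒥 N m) : LocalFunctional 𝒥 :=
  pairTrace 𝒥 (pairDer ξ (grad f) * η)

theorem secondVariation_comm (f : Coeffs 𝒥) (ξ η : admPart 𝒥 N m) :
    secondVariation f ξ η = secondVariation f η ξ := pairTrace_pairDer_grad ξ η f

/-- The differential of the bracket: the terms are the second variations of the two functionals and
the derivative of the tensor. -/
theorem pairTrace_grad_bracketDensity (f g : Coeffs 𝒥) (ξ : admPart 𝒥 N m) :
    pairTrace 𝒥 (grad (bracketDensity f g + bracketDensity f g) * ξ)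
      = secondVariation f ξ (hamField g) - secondVariation g ξ (hamField f)
        + pairTrace 𝒥 (grad f * doubleTensorDeriv (genericAdm k N m O) ξ (grad g)) := by
  rw [← functional_evol_tangentChar, bracketDensity_add_self, functional_evol_pairRes_mul,
    pairDer_hamField, mul_add, map_add, pairTrace_doubleTensor, secondVariation, secondVariation,
    coe_hamField f]
  abel

/-- The second variations cancel by their symmetry, and the derivatives of the tensor cancel
because its Schouten bracket with itself vanishes. -/
theorem cyclic_bracketDensity (f g e : Coeffs 𝒥) :
    pairTrace 𝒥 (grad (bracketDensity f g + bracketDensity f g) * hamField e)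
      + pairTrace 𝒥 (grad (bracketDensity g e + bracketDensity g e) * hamField f)
      + pairTrace 𝒥 (grad (bracketDensity e f + bracketDensity e f) * hamField g) = 0 := by
  refine (congrArg₂ (· + ·) (congrArg₂ (· + ·) (pairTrace_grad_bracketDensity f g (hamField e))
    (pairTrace_grad_bracketDensity g e (hamField f)))
    (pairTrace_grad_bracketDensity e f (hamField g))).trans ?_
  refine Eq.trans ?_
    (cyclic_doubleTensorDeriv (genericAdm k N m O) (grad f) (grad e) (grad g))
  rw [← coe_hamField e, ← coe_hamField f, ← coe_hamField g, secondVariation_comm f (hamField e),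
    secondVariation_comm g (hamField f), secondVariation_comm e (hamField g)]
  abel

/-- The bracket of functionals with gradient in `𝔇` has its gradient in `𝔇`. -/
theorem grad_bracketDensity_mem [CharZero k] {f g : Coeffs 𝒥} (hf : grad f ∈ admFrakD 𝒥)
    (hg : grad g ∈ admFrakD 𝒥) : grad (bracketDensity f g) ∈ admFrakD 𝒥 := by
  have hA : genericAdm k N m O ∈ admFrakD 𝒥 := admPart_le_admFrakD N m genericAdm_mem
  -- Transposing the differential of the bracket gives an element of `𝔇` that represents it.
  have hx := add_mem (sub_mem (pairDer_mem_admFrakD (hamField g) hf)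
    (pairDer_mem_admFrakD (hamField f) hg))
      (sub_mem (sub_mem (mul_mem_admFrakD hf (tensorLeft_mem hA hg))
        (mul_mem_admFrakD (tensorRight_mem hA hg) hf))
        (sub_mem (mul_mem_admFrakD hg (tensorLeft_mem hA hf))
          (mul_mem_admFrakD (tensorRight_mem hA hf) hg)))
  have h2 : grad (bracketDensity f g + bracketDensity f g) ∈ admFrakD 𝒥 :=
    grad_mem_admFrakD hx fun ξ => (pairTrace_grad_bracketDensity f g ξ).trans
      ((congrArg₂ (· + ·) (congrArg₂ (· - ·) (secondVariation_comm f ξ _)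
        (secondVariation_comm g ξ _)) (pairTrace_doubleTensorDeriv _ _ _ _)).trans
        (pairTrace_sub_add_mul _ _ _ _).symm)
  have h3 : (2 : k) • grad (bracketDensity f g) ∈ admFrakD 𝒥 := by
    rwa [two_smul, ← map_add]
  exact ((admFrakD 𝒥).smul_mem_iff two_ne_zero).mp h3

/-! ### The Poisson algebra of functionals -/

variable (k N m O) in
/-- The gradient of local functionals. -/
def gradFunctional : LocalFunctional 𝒥 →ₗ[k] AdmPair 𝒥 :=
  Submodule.liftQ _ grad (by
    intro f hf
    have h : functional f = functional (0 : Coeffs 𝒥) :=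
      (Submodule.Quotient.eq _).mpr (by rwa [sub_zero])
    rw [LinearMap.mem_ker, grad_eq_of_functional_eq h, map_zero])

theorem exists_functional_eq (F : LocalFunctional 𝒥) : ∃ f, functional f = F :=
  Submodule.Quotient.mk_surjective _ F

variable (k N m O) in
/-- The local functionals whose gradient lies in `𝔇`. -/
def gradSubmodule : Submodule k (LocalFunctional 𝒥) :=
  (admFrakD 𝒥).comap (gradFunctional k N m O)

theorem coe_gradSubmodule :
    (gradSubmodule k N m O : Set (LocalFunctional 𝒥)) = functionalsWithGrad k N m O := by
  ext F
  constructor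
  · intro hF
    obtain ⟨f, rfl⟩ := exists_functional_eq F
    refine ⟨f, rfl, ?_⟩
    rw [← pairVal_grad]
    exact hF
  · rintro ⟨f, rfl, hf⟩
    rw [← pairVal_grad] at hf
    exact hf

/-- The bracket of two local functionals. -/
def bracketFun (F G : LocalFunctional 𝒥) : LocalFunctional 𝒥 :=
  pairTrace 𝒥 (gradFunctional k N m O F
    * admTensor (genericAdm k N m O) (gradFunctional k N m O G))

theorem bracketFun_functional (f g : Coeffs 𝒥) :
    bracketFun (functional f) (functional g) = functional (bracketDensity f g) :=
  (functional_pairRes _).symm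

theorem bracketFun_add_left (F F' G : LocalFunctional 𝒥) :
    bracketFun (F + F') G = bracketFun F G + bracketFun F' G := by
  rw [bracketFun, map_add, add_mul, map_add]
  rfl

theorem bracketFun_smul_left (c : k) (F G : LocalFunctional 𝒥) :
    bracketFun (c • F) G = c • bracketFun F G := by
  rw [bracketFun, map_smul, smul_mul_admPair, map_smul]
  rfl

variable [CharZero k]

theorem bracketFun_skew (F G : LocalFunctional 𝒥) : bracketFun F G = -bracketFun G F :=
  pairTrace_admTensor _ _ _

theorem bracketFun_add_right (F G G' : LocalFunctional 𝒥) :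
    bracketFun F (G + G') = bracketFun F G + bracketFun F G' := by
  rw [bracketFun_skew, bracketFun_add_left, neg_add, ← bracketFun_skew, ← bracketFun_skew]

theorem bracketFun_smul_right (c : k) (F G : LocalFunctional 𝒥) :
    bracketFun F (c • G) = c • bracketFun F G := by
  rw [bracketFun_skew, bracketFun_smul_left, ← smul_neg, ← bracketFun_skew]

theorem bracketFun_mem {F G : LocalFunctional 𝒥} (hF : F ∈ gradSubmodule k N m O)
    (hG : G ∈ gradSubmodule k N m O) : bracketFun F G ∈ gradSubmodule k N m O := by
  obtain ⟨f, rfl⟩ := exists_functional_eq F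
  obtain ⟨g, rfl⟩ := exists_functional_eq G
  rw [bracketFun_functional]
  exact grad_bracketDensity_mem hF hG

theorem bracketFun_self (F : LocalFunctional 𝒥) : bracketFun F F = 0 := by
  refine add_self_injective (k := k) ?_
  rw [add_zero]
  exact eq_neg_iff_add_eq_zero.mp (bracketFun_skew F F)

theorem bracketFun_jacobi (F G H : LocalFunctional 𝒥) :
    bracketFun (bracketFun F G) H + bracketFun (bracketFun G H) F
      + bracketFun (bracketFun H F) G = 0 := by
  obtain ⟨f, rfl⟩ := exists_functional_eq F
  obtain ⟨g, rfl⟩ := exists_functional_eq G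
  obtain ⟨e, rfl⟩ := exists_functional_eq H
  have h : ∀ f g e : Coeffs 𝒥,
      pairTrace 𝒥 (grad (bracketDensity f g + bracketDensity f g) * hamField e)
        = (4 : k) • bracketFun (bracketFun (functional f) (functional g)) (functional e) := by
    intro f g e
    rw [bracketFun_functional, coe_hamField, doubleTensor_eq, map_add]
    exact pairTrace_add_self_mul_add_self _ _
  have h1 := (congrArg₂ (· + ·) (congrArg₂ (· + ·) (h f g e) (h g e f)) (h e f g)).symm.trans
    (cyclic_bracketDensity f g e)
  rw [← smul_add, ← smul_add] at h1
  exact (smul_eq_zero.mp h1).resolve_left (by norm_num)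

variable (k N m O) in
/-- The Poisson bracket of the functionals with gradient in `𝔇`. -/
def poissonBracket :
    gradSubmodule k N m O →ₗ[k] gradSubmodule k N m O →ₗ[k] gradSubmodule k N m O :=
  LinearMap.mk₂ k (fun F G => ⟨bracketFun F.1 G.1, bracketFun_mem F.2 G.2⟩)
    (fun _ _ _ => Subtype.ext (bracketFun_add_left _ _ _))
    (fun _ _ _ => Subtype.ext (bracketFun_smul_left _ _ _))
    (fun _ _ _ => Subtype.ext (bracketFun_add_right _ _ _))
    (fun _ _ _ => Subtype.ext (bracketFun_smul_right _ _ _))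

end Bracket

end

end

end TwoBKP

theorem mainTheorem4 {k : Type*} [Field k] [CharZero k]
    {B : Type*} [CommRing B] [Algebra k B] (𝒢 : ℕ → Submodule k B) [SetLike.GradedMonoid 𝒢]
    [TwoBKP.GradedDerivation 𝒢]
    (N m : ℤ) {O : Type*} [CommRing O] [Algebra k O]
    [TwoBKP.CoordinateAlgebra k (TwoBKP.JetZero (TwoBKP.coordDeg N m)) O] :
    -- `R` and its adjoint act on `𝔇`; `R` and `R_a` solve the modified Yang-Baxter equation
    ((∀ X ∈ TwoBKP.frakD 𝒢,
        TwoBKP.Rmat X ∈ TwoBKP.frakD 𝒢 ∧ TwoBKP.RmatAdj X ∈ TwoBKP.frakD 𝒢) ∧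
      (∀ X ∈ TwoBKP.frakD 𝒢, ∀ Y ∈ TwoBKP.frakD 𝒢,
        TwoBKP.pairInner (TwoBKP.Rmat X) Y = TwoBKP.pairInner X (TwoBKP.RmatAdj Y)) ∧
      TwoBKP.SatisfiesMYBE (𝒢 := 𝒢) TwoBKP.Rmat ∧
      TwoBKP.SatisfiesMYBE (𝒢 := 𝒢) TwoBKP.RmatSkew) ∧
    -- the quadratic bracket has the explicit tensor, which maps `𝔇` to `𝔇` and is skew
    (∀ A ∈ TwoBKP.frakD 𝒢, ∀ X ∈ TwoBKP.frakD 𝒢, ∀ Y ∈ TwoBKP.frakD 𝒢,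
      TwoBKP.poissonTensor A X ∈ TwoBKP.frakD 𝒢 ∧
      TwoBKP.quadBracket A X Y = TwoBKP.pairInner X (TwoBKP.poissonTensor A Y) ∧
      TwoBKP.pairInner X (TwoBKP.poissonTensor A Y)
        = -TwoBKP.pairInner Y (TwoBKP.poissonTensor A X)) ∧
    -- the tensor is tangent to the part of order `≤ N` and degree `≥ m`, and there it ignores the
    -- components of the gradient that are dual to the coefficients `w_i` with `i > N`
    (∀ A ∈ TwoBKP.frakDPart 𝒢 N m, ∀ X ∈ TwoBKP.frakD 𝒢,
      TwoBKP.poissonTensor A X ∈ TwoBKP.frakDPart 𝒢 N m ∧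
      ∀ Z ∈ TwoBKP.opMinusLE 𝒢 (-N - 2),
        TwoBKP.poissonTensor A (X + (Z, 0)) = TwoBKP.poissonTensor A X) ∧
    -- the generic point lies in that part
    TwoBKP.genericPoint k N m O
      ∈ TwoBKP.frakDPart (TwoBKP.jetGrading k (TwoBKP.coordDeg N m) O) N m ∧
    -- the variational gradient depends only on the functional
    (∀ f f' : TwoBKP.DiffFun k (TwoBKP.coordDeg N m) O,
      TwoBKP.functional f = TwoBKP.functional f' →
        TwoBKP.varGrad k N m O f = TwoBKP.varGrad k N m O f') ∧
    -- Poisson bracket on the functionals in `F₀`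
    (∃ (F₀ : Submodule k (TwoBKP.LocalFunctional
          (TwoBKP.jetGrading k (TwoBKP.coordDeg N m) O)))
        (br : F₀ →ₗ[k] F₀ →ₗ[k] F₀),
      (F₀ : Set (TwoBKP.LocalFunctional (TwoBKP.jetGrading k (TwoBKP.coordDeg N m) O)))
        = TwoBKP.functionalsWithGrad k N m O ∧
      (∀ F G : F₀, ∀ f g : TwoBKP.DiffFun k (TwoBKP.coordDeg N m) O,
        TwoBKP.functional f = F → TwoBKP.functional g = G →
          (br F G : TwoBKP.LocalFunctional (TwoBKP.jetGrading k (TwoBKP.coordDeg N m) O))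
              = TwoBKP.pairInner (TwoBKP.varGrad k N m O f)
                  (TwoBKP.poissonTensor (TwoBKP.genericPoint k N m O)
                    (TwoBKP.varGrad k N m O g)) ∧
          (br F G : TwoBKP.LocalFunctional (TwoBKP.jetGrading k (TwoBKP.coordDeg N m) O))
              = TwoBKP.quadBracket (TwoBKP.genericPoint k N m O)
                  (TwoBKP.varGrad k N m O f) (TwoBKP.varGrad k N m O g)) ∧
      (∀ F : F₀, br F F = 0) ∧
      (∀ F G H : F₀, br (br F G) H + br (br G H) F + br (br H F) G = 0)) := by
  refine ⟨⟨fun X hX => ⟨TwoBKP.Rmat_mem_frakD hX, TwoBKP.RmatAdj_mem_frakD hX⟩,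
      fun X hX Y hY => TwoBKP.pairInner_Rmat hX hY, TwoBKP.satisfiesMYBE_Rmat,
      TwoBKP.satisfiesMYBE_RmatSkew⟩, fun A hA X hX Y hY => ?_, fun A hA X hX => ?_,
    TwoBKP.genericPoint_mem, fun f f' h => ?_,
    TwoBKP.gradSubmodule k N m O, TwoBKP.poissonBracket k N m O, TwoBKP.coe_gradSubmodule,
    fun F G f g hf hg => ?_, fun F => Subtype.ext (TwoBKP.bracketFun_self _),
    fun F G H => Subtype.ext (TwoBKP.bracketFun_jacobi _ _ _)⟩
  · obtain ⟨a, ha, rfl⟩ := TwoBKP.exists_pairVal_eq hA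
    obtain ⟨x, hx, rfl⟩ := TwoBKP.exists_pairVal_eq hX
    obtain ⟨y, hy, rfl⟩ := TwoBKP.exists_pairVal_eq hY
    exact ⟨TwoBKP.admTensor_mem_admFrakD ha, TwoBKP.quadBracket_pairVal a x y,
      TwoBKP.pairTrace_admTensor a x y⟩
  · obtain ⟨a, -, rfl⟩ := TwoBKP.exists_pairVal_eq (TwoBKP.frakDPart_le_frakD N m hA)
    obtain ⟨x, hx, rfl⟩ := TwoBKP.exists_pairVal_eq hX
    have ha : a ∈ TwoBKP.admPart 𝒢 N m := hA
    refine ⟨TwoBKP.admTensor_mem_admPart ha x, fun Z hZ => ?_⟩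
    let z : TwoBKP.opAdm 𝒢 1 := ⟨Z, TwoBKP.opMinus_le_opAdm ⟨_, hZ⟩⟩
    have hz : TwoBKP.admTensor a (x + (z, 0)) = TwoBKP.admTensor a x := by
      rw [TwoBKP.admTensor_add, TwoBKP.admTensor_eq_zero_of_order ha hZ, add_zero]
    exact congrArg (TwoBKP.pairVal 𝒢) hz
  · rw [← TwoBKP.pairVal_grad, ← TwoBKP.pairVal_grad, TwoBKP.grad_eq_of_functional_eq h]
  · have hbr : (TwoBKP.poissonBracket k N m O F G).1 = TwoBKP.pairTrace _
        (TwoBKP.grad f * TwoBKP.admTensor (TwoBKP.genericAdm k N m O) (TwoBKP.grad g)) := by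
      change TwoBKP.bracketFun F.1 G.1 = _
      rw [← hf, ← hg]
      rfl
    rw [← TwoBKP.pairVal_grad, ← TwoBKP.pairVal_grad, ← TwoBKP.pairVal_genericAdm,
      TwoBKP.quadBracket_pairVal]
    exact ⟨hbr, hbr⟩
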